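/- Let $\mathfrak X$ and $U$ be separable Hilbert spaces over $\mathbb K\in\{\mathbb R,\mathbb C\}$, let $T>0$, let $B\in L(U,\mathfrak X)$, and let $A$ be the generator of a strongly continuous semigroup $\mathfrak U(t)$, $t\ge 0$, on $\mathfrak X$ such that $\mathfrak U(t)$ is compact for every $t>0$. Let $f,g:[0,T]\times\mathfrak X\to\mathfrak X$ be continuous and assume: (F) $f$ has a Fréchet derivative $f'_z(t,z)\in L(\mathfrak X)$ with respect to $z$, continuous in $(t,z)\in[0,T]\times\mathfrak X$ for the operator norm, and $\|f'_z(t,z)\|\le L$ for some constant $L$ and all $(t,z)$; (G) there is a continuous $m:[0,T]\to[0,\infty)$ with $\|g(t,z)\|\le m(t)$ for all $(t,z)$; (AC) for every $G\in L^2(0,T;L(\mathfrak X))$ the system $y(t)=\mathfrak U(t)y_0+\int_0^t\mathfrak U(t-s)[Bu(s)+G(s)y(s)]\,ds$, $t\in[0,T]$, is approximately controllable: for all $y_0,y_f\in\mathfrak X$ and $\delta>0$ there is $u\in L^2(0,T;U)$ whose solution $y\in C([0,T],\mathfrak X)$ satisfies $\|y(T)-y_f\|<\delta$. Put $F(t,z)=\int_0^1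 f'_z(t,rz)\,dr\in L(\mathfrak X)$. For $z\in C([0,T],\mathfrak X)$ let $\mathfrak T(t,s)=\mathfrak T(t,s;F(z))$, $0\le s\le t\le T$, be the evolution operator generated by $A+F(\cdot,z(\cdot))$, i.e. the strongly continuous $L(\mathfrak X)$-valued solution of $$\mathfrak T(t,s)x=\mathfrak U(t-s)x+\int_s^t\mathfrak U(t-r)F(r,z(r))\mathfrak T(r,s)x\,dr ,\qquad x\in\mathfrak X,$$ and let $\Gamma_0^T(F(z))x=\int_0^T\mathfrak T(T,s)BB^*\mathfrak T(T,s)^*x\,ds$. Let $M\subset\mathfrak X$ be a finite-dimensional subspace with orthogonal projection $\pi_M$, let $x_0,h\in\mathfrak X$ and $\varepsilon>0$, and define $$u_\varepsilon(t,z)=B^*\mathfrak T(T,t)^*\bigl(\varepsilon(I-\pi_M)+\Gamma_0^T(F(z))\bigr)^{-1}\Bigl(h-\mathfrak T(T,0)x_0-\int_0^T\mathfrak T(T,s)g(s,z(s))\,ds\Bigr),$$ $$(\Theta_\varepsilon z)(t)=\mathfrak T(t,0)x_0+\int_0^t\mathfrak T(t,s)\bigl[Bu_\varepsilon(s,z)+g(s,z(s))\bigr]ds,\qquad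 t\in[0,T].$$ Then for every $z\in C([0,T],\mathfrak X)$ the evolution operator $\mathfrak T(\cdot,\cdot;F(z))$ exists and $\varepsilon(I-\pi_M)+\Gamma_0^T(F(z))$ is boundedly invertible, $\Theta_\varepsilon$ maps $C([0,T],\mathfrak X)$ into itself, and $\Theta_\varepsilon$ has at least one fixed point in $C([0,T],\mathfrak X)$. -/

import Mathlib

open Set Filter Topology MeasureTheory

noncomputable section

namespace EvolutionControl

/-- A strongly continuous (`C₀`) semigroup of bounded linear operators on `X`. Only the values at
times `t ≥ 0` are meaningful. -/
structure C0Semigroup (𝕜 X : Type*) [RCLike 𝕜] [NormedAddCommGroup X] [NormedSpace 𝕜 X] where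
  op : ℝ → X →L[𝕜] X
  op_zero : op 0 = ContinuousLinearMap.id 𝕜 X
  op_add : ∀ s t : ℝ, 0 ≤ s → 0 ≤ t → op (s + t) = (op s).comp (op t)
  continuousOn_op : ∀ x : X, ContinuousOn (fun t => op t x) (Ici 0)

variable {𝕜 X W : Type*} [RCLike 𝕜]
  [NormedAddCommGroup X] [InnerProductSpace 𝕜 X] [NormedSpace ℝ X] [IsScalarTower ℝ 𝕜 X]
  [CompleteSpace X]
  [NormedAddCommGroup W] [InnerProductSpace 𝕜 W] [CompleteSpace W]

/-- The (unbounded) operator `A` is the infinitesimal generator of the semigroup: `x ∈ D(A)` and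
`A x = y` if and only if `(S(t) x - x) / t → y` as `t → 0⁺`. -/
def C0Semigroup.IsGenerator (S : C0Semigroup 𝕜 X) (A : X →ₗ.[𝕜] X) : Prop :=
  ∀ x y : X, (x, y) ∈ A.graph ↔
    Tendsto (fun t : ℝ => t⁻¹ • (S.op t x - x)) (𝓝[>] 0) (𝓝 y)

/-- The semigroup is compact: `S(t)` is a compact operator for every `t > 0`. -/
def C0Semigroup.IsCompactSemigroup (S : C0Semigroup 𝕜 X) : Prop :=
  ∀ t : ℝ, 0 < t → IsCompactOperator (S.op t)

/-- `y` is a mild solution on `[0,T]` of `y' = A y + B u + G y`, `y(0) = y₀`. -/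
def IsLinearMildSolution (S : C0Semigroup 𝕜 X) (B : W →L[𝕜] X) (T : ℝ) (G : ℝ → X →L[𝕜] X)
    (y₀ : X) (u : ℝ → W) (y : ℝ → X) : Prop :=
  ContinuousOn y (Icc 0 T) ∧
    ∀ t ∈ Icc (0 : ℝ) T,
      y t = S.op t y₀ + ∫ s in (0 : ℝ)..t, S.op (t - s) (B (u s) + G s (y s))

/-- Approximate controllability on `[0,T]` of `y' = A y + B u + G y`, with controls in
`L²(0,T;W)`. -/
def IsApproxControllable (S : C0Semigroup 𝕜 X) (B : W →L[𝕜] X) (T : ℝ)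
    (G : ℝ → X →L[𝕜] X) : Prop :=
  ∀ y₀ yf : X, ∀ δ : ℝ, 0 < δ →
    ∃ u : ℝ → W, MemLp u 2 (volume.restrict (Icc 0 T)) ∧
      ∃ y : ℝ → X, IsLinearMildSolution S B T G y₀ u y ∧ ‖y T - yf‖ < δ

/-- `E` is the evolution operator generated by `A + G(·)` on `0 ≤ s ≤ t ≤ T`: it is strongly
continuous there and solves the variation of constants equation. -/
structure IsEvolutionOperator (S : C0Semigroup 𝕜 X) (T : ℝ) (G : ℝ → X →L[𝕜] X)
    (E : ℝ → ℝ → X →L[𝕜] X) : Prop where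
  continuousOn : ∀ x : X,
    ContinuousOn (fun p : ℝ × ℝ => E p.1 p.2 x) {p | 0 ≤ p.2 ∧ p.2 ≤ p.1 ∧ p.1 ≤ T}
  eq_integral : ∀ (x : X) (s t : ℝ), 0 ≤ s → s ≤ t → t ≤ T →
    E t s x = S.op (t - s) x + ∫ r in s..t, S.op (t - r) (G r (E r s x))

/-- The evolution operator `𝔗(t,s;G)` generated by `A + G(·)`. Its values for `0 ≤ s ≤ t ≤ T` are
determined by `IsEvolutionOperator`; no other value is ever used. -/
def evolutionOperator (S : C0Semigroup 𝕜 X) (T : ℝ) (G : ℝ → X →L[𝕜] X) :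
    ℝ → ℝ → X →L[𝕜] X :=
  Classical.epsilon (IsEvolutionOperator S T G)

/-- The controllability Gramian `Γ₀ᵀ(G) x = ∫₀ᵀ 𝔗(T,s;G) B B* 𝔗(T,s;G)* x ds`. -/
def gramian (S : C0Semigroup 𝕜 X) (B : W →L[𝕜] X) (T : ℝ) (G : ℝ → X →L[𝕜] X) (x : X) : X :=
  ∫ s in (0 : ℝ)..T,
    evolutionOperator S T G T s
      (B (ContinuousLinearMap.adjoint B
        (ContinuousLinearMap.adjoint (evolutionOperator S T G T s) x)))

/-- The map `ε (I - π_M) + Γ₀ᵀ(G)`, where `π_M` is the orthogonal projection onto `M`. -/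
def regularizedGramian (S : C0Semigroup 𝕜 X) (B : W →L[𝕜] X) (T : ℝ) (M : Submodule 𝕜 X)
    [M.HasOrthogonalProjection] (ε : ℝ) (G : ℝ → X →L[𝕜] X) (x : X) : X :=
  ε • (x - M.starProjection x) + gramian S B T G x

/-- `F(t,z) = ∫₀¹ f'_z(t, r z) dr`, an operator on `X`. -/
def meanDerivative (f : ℝ → X → X) (t : ℝ) (z : X) : X →L[𝕜] X :=
  ∫ r in (0 : ℝ)..1, fderiv 𝕜 (f t) (r • z)

/-- The operator family `F(z) : t ↦ F(t, z(t))`. -/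
def linearization (f : ℝ → X → X) (z : ℝ → X) (t : ℝ) : X →L[𝕜] X :=
  meanDerivative f t (z t)

/-- The feedback control
`u_ε(t,z) = B* 𝔗(T,t;F(z))* (ε (I - π_M) + Γ₀ᵀ(F(z)))⁻¹
  (h - 𝔗(T,0;F(z)) x₀ - ∫₀ᵀ 𝔗(T,s;F(z)) g(s,z(s)) ds)`. -/
def feedbackControl (S : C0Semigroup 𝕜 X) (B : W →L[𝕜] X) (T : ℝ) (f g : ℝ → X → X)
    (M : Submodule 𝕜 X) [M.HasOrthogonalProjection] (x₀ h : X) (ε : ℝ) (z : ℝ → X) (t : ℝ) : W :=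
  ContinuousLinearMap.adjoint B
    (ContinuousLinearMap.adjoint (evolutionOperator S T (linearization f z) T t)
      (Function.invFun (regularizedGramian S B T M ε (linearization f z))
        (h - evolutionOperator S T (linearization f z) T 0 x₀
          - ∫ s in (0 : ℝ)..T, evolutionOperator S T (linearization f z) T s (g s (z s)))))

/-- `(Θ_ε z)(t) = 𝔗(t,0;F(z)) x₀ + ∫₀ᵗ 𝔗(t,s;F(z)) (B u_ε(s,z) + g(s,z(s))) ds`. -/
def thetaFun (S : C0Semigroup 𝕜 X) (B : W →L[𝕜] X) (T : ℝ) (f g : ℝ → X → X)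
    (M : Submodule 𝕜 X) [M.HasOrthogonalProjection] (x₀ h : X) (ε : ℝ) (z : ℝ → X) (t : ℝ) : X :=
  evolutionOperator S T (linearization f z) t 0 x₀
    + ∫ s in (0 : ℝ)..t, evolutionOperator S T (linearization f z) t s
        (B (feedbackControl S B T f g M x₀ h ε z s) + g s (z s))

end EvolutionControl

end

/-! The linearization F(z) is a norm-continuous operator family on [0,T] of norm at most L, whatever
z is, so the linear theory is developed for an arbitrary continuous G with ‖G‖ ≤ L, with constants
that depend on L but not on G. In an exponentially weighted sup norm the Volterra operator of the
variation of constants equation has norm at most 1/2. Inverting `1 - volterra` yields the evolution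
operator, its uniqueness (`IsEvolutionOperator.eq_evolution`), a bound uniform in G, and continuity
in G.

The heart is `exists_uniform_coercivity`: the quadratic form of ε(I - π_M) + Γ is at least c‖x‖²
with one c for all G. Otherwise there are unit vectors x_n and families G_n along which the form
tends to 0. Then x_n - π_M x_n → 0, and as M is finite-dimensional, x_n has a unit limit x. The
adjoint states P_n converge uniformly to some p, by compactness of the semigroup, and B*p = 0. The
forcing terms G_n P_n converge only weakly in L², to some q, but ‖G_n P_n‖ ≤ L‖P_n‖ survives as ‖q‖
≤ L‖p‖ almost everywhere. No limit of G_n is needed: the rank-one family G = ‖p‖⁻² ⟨q,·⟩ p is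
bounded and satisfies G*p = q, so p solves the adjoint equation of a system covered by (AC). Duality
(`mild_duality`) with B*p = 0 makes every state reachable from 0 orthogonal to x, which forces x =
0, a contradiction.

Coercivity gives invertibility with a uniform bound on the inverse, hence controls that are bounded
uniformly in z and depend continuously on z. Thus Θ_ε is continuous, and Θ_ε z is the orbit of x₀
plus a Duhamel integral of a forcing bounded uniformly in z. Since the semigroup is compact, these
functions lie in one compact subset of C([0,T],X) (`exists_compact_duhamel`), and Schauder's theorem
applies. Schauder is derived from Brouwer, and Brouwer from the Milnor–Rogers volume argument. -/

noncomputable section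

namespace EvolutionControl

/-! ### Brouwer's fixed point theorem by the Milnor–Rogers volume argument -/

section Brouwer

variable {E : Type*} [NormedAddCommGroup E] [InnerProductSpace ℝ E] [FiniteDimensional ℝ E]

/-- In a basis this is the determinant of a matrix whose entries have degree at most one in t.
Polynomiality is what transports information from small t, where the perturbed identity is
invertible, to t = 1. -/
lemma exists_polynomial_eval_eq_det (A : E →L[ℝ] E) :
    ∃ p : Polynomial ℝ, p.natDegree ≤ Module.finrank ℝ E ∧
      ∀ t : ℝ, p.eval t = (1 + t • A : E →L[ℝ] E).det := by
  classical
  let b := Module.finBasis ℝ E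
  let M := LinearMap.toMatrix b b (A : E →ₗ[ℝ] E)
  refine ⟨((Polynomial.X : Polynomial ℝ) • M.map Polynomial.C +
    (1 : Matrix (Fin (Module.finrank ℝ E)) (Fin (Module.finrank ℝ E)) ℝ).map Polynomial.C).det, ?_, fun t => ?_⟩
  · simpa using Polynomial.natDegree_det_X_add_C_le M 1
  · have h1 : (1 + t • A : E →L[ℝ] E).det
        = LinearMap.det ((1 : E →ₗ[ℝ] E) + t • (A : E →ₗ[ℝ] E)) := rfl
    rw [h1, ← LinearMap.det_toMatrix b, ← Polynomial.coe_evalRingHom, RingHom.map_det]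
    congr 1
    ext i j
    simp only [map_add, map_smul, LinearMap.toMatrix_one, RingHom.mapMatrix_apply,
      Matrix.map_apply, Matrix.add_apply, Matrix.smul_apply, smul_eq_mul, map_mul, M]
    simp [add_comm]

/-- Values at `1` of polynomials of bounded degree are fixed affine combinations of values at
small positive nodes. -/
lemma exists_nodes_eval_one (n : ℕ) (τ : ℝ) (hτ : 0 < τ) :
    ∃ v c : Fin (n + 1) → ℝ, (∀ i, 0 < v i ∧ v i < τ) ∧
      ∀ p : Polynomial ℝ, p.natDegree ≤ n → p.eval 1 = ∑ i, c i * p.eval (v i) := by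
  classical
  -- There are n + 1 distinct nodes, enough to determine degree at most n; since 1 ≤ i + 1 < n + 2,
  -- they lie strictly between 0 and τ.
  let v : Fin (n + 1) → ℝ := fun i => τ * ((i + 1 : ℝ) / (n + 2))
  have hn : (0 : ℝ) < n + 2 := by positivity
  have hv : Function.Injective v := by
    intro i j hij
    have h1 : ((i + 1 : ℝ) / (n + 2)) = ((j + 1 : ℝ) / (n + 2)) :=
      mul_left_cancel₀ hτ.ne' hij
    rw [div_left_inj' hn.ne'] at h1
    have h2 : (i : ℝ) = (j : ℝ) := by linarith
    exact Fin.ext (by exact_mod_cast h2)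
  refine ⟨v, fun i => (Lagrange.basis Finset.univ v i).eval 1, fun i => ⟨by positivity, ?_⟩, ?_⟩
  · have : ((i + 1 : ℝ) / (n + 2)) < 1 := by
      rw [div_lt_one hn]
      have : ((i : ℕ) : ℝ) < (n + 1 : ℕ) := by exact_mod_cast i.2
      push_cast at this
      linarith
    simpa using mul_lt_mul_of_pos_left this hτ
  · intro p hp
    have h := Lagrange.eq_interpolate (s := Finset.univ) (v := v) (f := p) hv.injOn ?_
    · conv_lhs => rw [h]
      rw [Lagrange.interpolate_apply, Polynomial.eval_finsetSum]
      exact Finset.sum_congr rfl fun i _ => by simp [mul_comm]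
    · refine lt_of_le_of_lt Polynomial.degree_le_natDegree ?_
      simp only [Finset.card_univ, Fintype.card_fin]
      exact_mod_cast Nat.lt_succ_of_le hp


lemma exists_lipschitz_bound_of_contDiffAt {g : E → E}
    (hg : ∀ x ∈ Metric.closedBall (0 : E) 1, ContDiffAt ℝ 1 g x) :
    ∃ C : ℝ, 0 ≤ C ∧ (∀ x ∈ Metric.closedBall (0 : E) 1, ‖fderiv ℝ g x‖ ≤ C) ∧
      ∀ x ∈ Metric.closedBall (0 : E) 1, ∀ y ∈ Metric.closedBall (0 : E) 1,
        ‖g y - g x‖ ≤ C * ‖y - x‖ := by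
  have hc : ContinuousOn (fderiv ℝ g) (Metric.closedBall (0 : E) 1) := fun x hx =>
    ((hg x hx).fderiv_right (m := 0) (by simp)).continuousAt.continuousWithinAt
  obtain ⟨C, hC⟩ := (isCompact_closedBall (0 : E) 1).exists_bound_of_continuousOn hc
  have h0 : 0 ≤ C := (norm_nonneg _).trans (hC 0 (by simp))
  refine ⟨C, h0, hC, fun x hx y hy => ?_⟩
  exact Convex.norm_image_sub_le_of_norm_fderiv_le (𝕜 := ℝ)
    (fun z hz => (hg z hz).differentiableAt (by simp)) hC (convex_closedBall 0 1) hx hy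

lemma isUnit_one_add_smul {A : E →L[ℝ] E} {C t : ℝ} (hA : ‖A‖ ≤ C) (ht : 0 ≤ t)
    (htC : t * C < 1) : IsUnit (1 + t • A : E →L[ℝ] E) := by
  have h := isUnit_one_sub_of_norm_lt_one (x := -(t • A)) ?_
  · simpa using h
  · rw [norm_neg, norm_smul, Real.norm_of_nonneg ht]
    exact lt_of_le_of_lt (by gcongr) htC

/-- The determinant equals 1 at parameter 0 and cannot vanish up to t, where the operator stays
invertible by the Neumann series; the intermediate value theorem fixes its sign. -/
lemma det_one_add_smul_pos {A : E →L[ℝ] E} {C t : ℝ} (hA : ‖A‖ ≤ C) (ht : 0 ≤ t)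
    (htC : t * C < 1) : 0 < (1 + t • A : E →L[ℝ] E).det := by
  obtain ⟨p, -, hp⟩ := exists_polynomial_eval_eq_det A
  have hC : 0 ≤ C := (norm_nonneg _).trans hA
  have hne : ∀ s ∈ Icc 0 t, p.eval s ≠ 0 := by
    intro s hs
    rw [hp]
    have hu := isUnit_one_add_smul hA hs.1
      ((mul_le_mul_of_nonneg_right hs.2 hC).trans_lt htC)
    have h2 : IsUnit (LinearMap.det ((1 + s • A : E →L[ℝ] E) : E →ₗ[ℝ] E)) :=
      (hu.map (ContinuousLinearMap.toLinearMapRingHom (R₁ := ℝ) (M₁ := E))).map LinearMap.det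
    exact h2.ne_zero
  rw [← hp]
  by_contra hneg
  push Not at hneg
  have h0 : p.eval 0 = 1 := by rw [hp]; simp [ContinuousLinearMap.det]
  obtain ⟨s, hs, hs0⟩ := intermediate_value_Icc' ht (f := fun s => p.eval s)
    p.continuous.continuousOn ⟨hneg, by simp [h0]⟩
  exact hne s hs hs0

/-- The perturbation `x + t g(x)` of the identity along a retraction maps the ball onto itself. -/
lemma image_ball_eq_of_retraction {r : E → E}
    (hr : ∀ x ∈ Metric.closedBall (0 : E) 1, ContDiffAt ℝ 1 r x)
    (h1 : ∀ x ∈ Metric.closedBall (0 : E) 1, ‖r x‖ = 1)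
    (h2 : ∀ x : E, ‖x‖ = 1 → r x = x) {C t : ℝ}
    (hC : ∀ x ∈ Metric.closedBall (0 : E) 1, ‖fderiv ℝ (fun x => r x - x) x‖ ≤ C)
    (ht : 0 < t) (ht1 : t < 1) (htC : t * C < 1) :
    (fun x => x + t • (r x - x)) '' Metric.ball (0 : E) 1 = Metric.ball 0 1 := by
  set φ : E → E := fun x => x + t • (r x - x) with hφ
  have hφc : ∀ x ∈ Metric.closedBall (0 : E) 1, ContDiffAt ℝ 1 φ x := fun x hx =>
    contDiffAt_id.add (((hr x hx).sub contDiffAt_id).const_smul t)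
  have hsub : φ '' Metric.ball (0 : E) 1 ⊆ Metric.ball 0 1 := by
    rintro _ ⟨x, hx, rfl⟩
    have hx' := Metric.ball_subset_closedBall hx
    rw [mem_ball_zero_iff] at hx ⊢
    have e : φ x = (1 - t) • x + t • r x := by simp only [hφ]; module
    calc ‖φ x‖ ≤ ‖(1 - t) • x‖ + ‖t • r x‖ := by rw [e]; exact norm_add_le _ _
      _ = (1 - t) * ‖x‖ + t := by
        rw [norm_smul, norm_smul, h1 x hx', Real.norm_of_nonneg ht.le,
          Real.norm_of_nonneg (by linarith), mul_one]
      _ < (1 - t) * 1 + t := by gcongr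
      _ = 1 := by ring
  refine hsub.antisymm ?_
  -- The image is open by the inverse function theorem, and relatively closed in the ball because φ
  -- fixes the sphere; connectedness of the ball then gives surjectivity.
  have hopen : IsOpen (φ '' Metric.ball (0 : E) 1) := by
    rw [isOpen_iff_mem_nhds]
    rintro _ ⟨x, hx, rfl⟩
    have hx' := Metric.ball_subset_closedBall hx
    have hg : ContDiffAt ℝ 1 (fun x => r x - x) x := (hr x hx').sub contDiffAt_id
    have hd : HasStrictFDerivAt φ (1 + t • fderiv ℝ (fun x => r x - x) x : E →L[ℝ] E) x :=
      (hasStrictFDerivAt_id x).add ((hg.hasStrictFDerivAt (by simp)).const_smul t)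
    obtain ⟨u, hu⟩ := isUnit_one_add_smul (hC x hx') ht.le htC
    have hsurj : ((1 + t • fderiv ℝ (fun x => r x - x) x : E →L[ℝ] E)).range = ⊤ := by
      rw [LinearMap.range_eq_top, ← hu]
      intro y
      refine ⟨(↑u⁻¹ : E →L[ℝ] E) y, ?_⟩
      have : ((u : E →L[ℝ] E) * (↑u⁻¹ : E →L[ℝ] E)) y = y := by rw [u.mul_inv]; rfl
      exact this
    rw [← hd.map_nhds_eq_of_surj hsurj]
    exact image_mem_map (Metric.isOpen_ball.mem_nhds hx)
  have hcl : closure (φ '' Metric.ball (0 : E) 1) ⊆ φ '' Metric.closedBall 0 1 := by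
    refine closure_minimal (image_mono Metric.ball_subset_closedBall) ?_
    refine ((isCompact_closedBall (0 : E) 1).image_of_continuousOn ?_).isClosed
    exact fun x hx => (hφc x hx).continuousAt.continuousWithinAt
  refine (convex_ball (0 : E) 1).isPreconnected.subset_of_closure_inter_subset hopen ?_ ?_
  · have h0 : (0 : E) ∈ Metric.ball (0 : E) 1 := by simp
    exact ⟨φ 0, hsub (mem_image_of_mem φ h0), mem_image_of_mem φ h0⟩
  · rintro y ⟨hy, hyb⟩
    obtain ⟨x, hx, rfl⟩ := hcl hy
    refine mem_image_of_mem φ ?_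
    rw [mem_closedBall_zero_iff] at hx
    rcases hx.lt_or_eq with h | h
    · simpa using h
    · have : φ x = x := by simp [hφ, h2 x h]
      rw [this] at hyb
      exact hyb

/-- For small t the map x + t(r x - x) is a diffeomorphism of the ball onto itself, so its Jacobian
determinant integrates to the volume V. Pointwise the determinant is a polynomial in t, so its value
at 1 is a fixed affine combination of values at small nodes and also integrates to V > 0. But at t =
1 it is det Dr, which vanishes since r takes values in the sphere. -/
theorem not_exists_contDiff_retraction {r : E → E}
    (hr : ∀ x ∈ Metric.closedBall (0 : E) 1, ContDiffAt ℝ 1 r x)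
    (h1 : ∀ x ∈ Metric.closedBall (0 : E) 1, ‖r x‖ = 1)
    (h2 : ∀ x : E, ‖x‖ = 1 → r x = x) : False := by
  borelize E
  set g : E → E := fun x => r x - x with hg
  have hgc : ∀ x ∈ Metric.closedBall (0 : E) 1, ContDiffAt ℝ 1 g x := fun x hx =>
    (hr x hx).sub contDiffAt_id
  obtain ⟨C, hC0, hC, hlip⟩ := exists_lipschitz_bound_of_contDiffAt hgc
  obtain ⟨v, c, hv, hvc⟩ := exists_nodes_eval_one (Module.finrank ℝ E) (1 / (C + 1)) (by positivity)
  set D : ℝ → E → ℝ := fun t x => (1 + t • fderiv ℝ g x : E →L[ℝ] E).det with hD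
  set V : ℝ := (volume : Measure E).real (Metric.ball (0 : E) 1) with hV
  have hVpos : 0 < V := by
    rw [hV, Measure.real, ENNReal.toReal_pos_iff]
    exact ⟨Metric.measure_ball_pos _ _ one_pos, measure_ball_lt_top⟩
  have hInt : ∀ i, IntegrableOn (D (v i)) (Metric.ball (0 : E) 1) ∧
      ∫ x in Metric.ball (0 : E) 1, D (v i) x = V := by
    intro i
    obtain ⟨ht, ht'⟩ := hv i
    set t := v i
    have htC1 : t * (C + 1) < 1 := by rwa [lt_div_iff₀ (by positivity)] at ht'
    have htC : t * C < 1 := by nlinarith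
    have ht1 : t < 1 := by nlinarith
    have hcont : ContinuousOn (D t) (Metric.closedBall (0 : E) 1) := by
      refine ContinuousLinearMap.continuous_det.comp_continuousOn ?_
      refine continuousOn_const.add (ContinuousOn.const_smul ?_ t)
      exact fun x hx =>
        ((hgc x hx).fderiv_right (m := 0) (by simp)).continuousAt.continuousWithinAt
    refine ⟨(hcont.integrableOn_compact (isCompact_closedBall 0 1)).mono_set
      Metric.ball_subset_closedBall, ?_⟩
    have hinj : InjOn (fun x => x + t • (r x - x)) (Metric.ball (0 : E) 1) := by
      intro x hx y hy hxy
      have e : x - y = t • (g y - g x) := by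
        have : x + t • g x = y + t • g y := hxy
        have h3 : x - y = t • g y - t • g x := by
          rw [sub_eq_sub_iff_add_eq_add, this, add_comm]
        rw [h3, smul_sub t (g y) (g x)]
      have h3 : ‖x - y‖ ≤ t * (C * ‖x - y‖) := by
        calc ‖x - y‖ = t * ‖g y - g x‖ := by rw [e, norm_smul, Real.norm_of_nonneg ht.le]
          _ ≤ t * (C * ‖y - x‖) := by
            gcongr
            exact hlip x (Metric.ball_subset_closedBall hx) y (Metric.ball_subset_closedBall hy)
          _ = _ := by rw [norm_sub_rev]
      have h4 : ‖x - y‖ = 0 := by nlinarith [norm_nonneg (x - y)]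
      exact sub_eq_zero.1 (norm_eq_zero.1 h4)
    have hder : ∀ x ∈ Metric.ball (0 : E) 1, HasFDerivWithinAt (fun x => x + t • (r x - x))
        (1 + t • fderiv ℝ g x : E →L[ℝ] E) (Metric.ball 0 1) x := fun x hx =>
      ((hasFDerivAt_id x).add (((hgc x (Metric.ball_subset_closedBall hx)).differentiableAt
        (by simp)).hasFDerivAt.const_smul t)).hasFDerivWithinAt
    have hchg := integral_image_eq_integral_abs_det_fderiv_smul (volume : Measure E)
      measurableSet_ball hder hinj (fun _ => (1 : ℝ))
    rw [image_ball_eq_of_retraction hr h1 h2 hC ht ht1 htC] at hchg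
    simp only [integral_const, MeasurableSet.univ, measureReal_restrict_apply, univ_inter,
      smul_eq_mul, mul_one] at hchg
    rw [hV, hchg]
    refine setIntegral_congr_fun measurableSet_ball fun x hx => ?_
    exact (abs_of_pos (det_one_add_smul_pos (hC x (Metric.ball_subset_closedBall hx)) ht.le
      htC)).symm
  have hzero : ∀ x ∈ Metric.ball (0 : E) 1, D 1 x = 0 := by
    intro x hx
    have hx' := Metric.ball_subset_closedBall hx
    have hrd : DifferentiableAt ℝ r x := (hr x hx').differentiableAt (by simp)
    have e : (1 + (1 : ℝ) • fderiv ℝ g x : E →L[ℝ] E) = fderiv ℝ r x := by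
      have : fderiv ℝ g x = fderiv ℝ r x - 1 := by
        rw [hg, fderiv_fun_sub hrd differentiableAt_fun_id, fderiv_fun_id]; rfl
      rw [this]; simp
    -- Differentiating ‖r‖² = 1 shows that the range of Dr is orthogonal to the nonzero vector r x,
    -- so Dr is not surjective.
    have horth : ∀ w : E, inner ℝ (r x) (fderiv ℝ r x w) = 0 := by
      intro w
      have hc : (fun y => inner ℝ (r y) (r y)) =ᶠ[𝓝 x] fun _ => (1 : ℝ) := by
        filter_upwards [Metric.isOpen_ball.mem_nhds hx] with y hy
        rw [real_inner_self_eq_norm_sq, h1 y (Metric.ball_subset_closedBall hy), one_pow]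
      have h3 := fderiv_inner_apply ℝ hrd hrd w
      rw [hc.fderiv_eq] at h3
      simp only [fderiv_fun_const, Pi.zero_apply, zero_apply] at h3
      rw [real_inner_comm (r x) (fderiv ℝ r x w)] at h3
      linarith
    simp only [hD, e]
    by_contra hne
    have hu : IsUnit (LinearMap.det (fderiv ℝ r x : E →ₗ[ℝ] E)) := isUnit_iff_ne_zero.2 hne
    obtain ⟨w, hw⟩ := (LinearEquiv.ofIsUnitDet (v := Module.finBasis ℝ E)
      (v' := Module.finBasis ℝ E) (f := (fderiv ℝ r x : E →ₗ[ℝ] E))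
      (by rwa [LinearMap.det_toMatrix])).surjective (r x)
    have hw' : fderiv ℝ r x w = r x := hw
    have h3 := horth w
    rw [hw', real_inner_self_eq_norm_sq, h1 x hx'] at h3
    norm_num at h3
  have hpoly : ∀ x, D 1 x = ∑ i, c i * D (v i) x := by
    intro x
    obtain ⟨p, hp, hpe⟩ := exists_polynomial_eval_eq_det (fderiv ℝ g x)
    simpa only [hpe] using hvc p hp
  have hsum : ∑ i, c i = 1 := by
    simpa using (hvc 1 (by simp)).symm
  have key : ∫ x in Metric.ball (0 : E) 1, D 1 x = V := by
    simp_rw [hpoly]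
    rw [integral_finsetSum _ fun i _ => (hInt i).1.const_mul (c i)]
    simp_rw [integral_const_mul, (hInt _).2]
    rw [← Finset.sum_mul, hsum, one_mul]
  rw [setIntegral_congr_fun measurableSet_ball hzero] at key
  simp at key
  linarith

/-- The Brouwer fixed point theorem, for maps of the whole space into the closed unit ball. -/
theorem exists_fixedPoint_of_norm_le_one {f : E → E} (hf : Continuous f) (hb : ∀ x, ‖f x‖ ≤ 1) :
    ∃ x, f x = x := by
  by_contra! hne
  obtain ⟨x₁, -, hx₁⟩ := (isCompact_closedBall (0 : E) 1).exists_isMinOn ⟨0, by simp⟩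
    ((hf.sub continuous_id).norm.continuousOn)
  set δ := ‖f x₁ - x₁‖ with hδ
  have hδ0 : 0 < δ := norm_pos_iff.2 (sub_ne_zero.2 (hne x₁))
  -- The errors δ/4 from smoothing and δ/3 from the rescaling by k add up to less than the minimal
  -- displacement δ, so p has no fixed point in the closed ball. The rescaling makes ‖p‖ < 1 strict,
  -- which is needed on the sphere.
  obtain ⟨q, hq, hqf, -⟩ := hf.exists_contDiff_approx (ε := fun _ => δ / 4) 1
    continuous_const (fun _ => by positivity)
  set k : ℝ := (1 + δ / 3)⁻¹ with hk
  have hk0 : 0 < k := by positivity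
  set p : E → E := fun x => k • q x with hp
  have hqn : ∀ x, ‖q x‖ < 1 + δ / 3 := by
    intro x
    have h3 : ‖q x‖ ≤ ‖q x - f x‖ + ‖f x‖ := by simpa using norm_add_le (q x - f x) (f x)
    have h4 := hqf x
    rw [dist_eq_norm] at h4
    linarith [hb x]
  have hp1 : ∀ x, ‖p x‖ < 1 := by
    intro x
    rw [hp, norm_smul, Real.norm_of_nonneg hk0.le, hk, inv_mul_lt_one₀ (by positivity)]
    exact hqn x
  have hpq : ∀ x, ‖p x - q x‖ < δ / 3 := by
    intro x
    have e : p x - q x = -((δ / 3) • p x) := by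
      have : q x = (1 + δ / 3) • p x := by
        rw [hp, smul_smul, hk, mul_inv_cancel₀ (by positivity), one_smul]
      rw [this]; module
    rw [e, norm_neg, norm_smul, Real.norm_of_nonneg (by positivity)]
    nlinarith [hp1 x, norm_nonneg (p x)]
  have hpd : ∀ x ∈ Metric.closedBall (0 : E) 1, 0 < ‖x - p x‖ := by
    intro x hx
    have h3 : δ ≤ ‖f x - x‖ := hx₁ hx
    have h4 := hqf x
    rw [dist_eq_norm] at h4
    have h5 : ‖f x - x‖ ≤ ‖q x - f x‖ + ‖p x - q x‖ + ‖x - p x‖ := by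
      have e : f x - x = -((q x - f x) + (p x - q x) + (x - p x)) := by abel
      rw [e, norm_neg]
      exact norm_add₃_le
    linarith [hpq x]
  have hpc : ContDiff ℝ 1 p := hq.const_smul k
  -- The retraction sends x to the point where the ray from p x through x leaves the ball: `lam` is
  -- the larger root of ‖x + λ(x - p x)‖² = 1, and `disc` is the reduced discriminant of this
  -- quadratic. It is positive on the closed ball, so the square root is C¹. On the sphere b > 0,
  -- whence `lam` = 0.
  set b : E → ℝ := fun x => inner ℝ x (x - p x) with hbdef
  set disc : E → ℝ := fun x => b x ^ 2 + ‖x - p x‖ ^ 2 * (1 - ‖x‖ ^ 2) with hdisc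
  set lam : E → ℝ := fun x => (-b x + √(disc x)) / ‖x - p x‖ ^ 2 with hlam
  have hbpos : ∀ x : E, ‖x‖ = 1 → 0 < b x := by
    intro x hx
    have h3 : inner ℝ x (p x) ≤ ‖x‖ * ‖p x‖ := real_inner_le_norm _ _
    simp only [hbdef, inner_sub_right, real_inner_self_eq_norm_sq, hx]
    rw [hx] at h3
    linarith [hp1 x]
  have hdpos : ∀ x ∈ Metric.closedBall (0 : E) 1, 0 < disc x := by
    intro x hx
    have hx0 := hpd x hx
    rw [mem_closedBall_zero_iff] at hx
    rcases hx.lt_or_eq with h | h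
    · have : 0 < 1 - ‖x‖ ^ 2 := by nlinarith [norm_nonneg x]
      simp only [hdisc]; positivity
    · have := hbpos x h
      simp only [hdisc, h]
      norm_num
      positivity
  have hbc : ContDiff ℝ 1 b := contDiff_id.inner ℝ (contDiff_id.sub hpc)
  have hac : ContDiff ℝ 1 fun x => ‖x - p x‖ ^ 2 := (contDiff_id.sub hpc).norm_sq ℝ
  have hdc : ContDiff ℝ 1 disc :=
    (hbc.pow 2).add (hac.mul (contDiff_const.sub (contDiff_id.norm_sq ℝ)))
  refine not_exists_contDiff_retraction (r := fun x => x + lam x • (x - p x)) ?_ ?_ ?_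
  · intro x hx
    have hx0 := hpd x hx
    refine contDiffAt_id.add (ContDiffAt.smul ?_ (contDiffAt_id.sub hpc.contDiffAt))
    exact (hbc.contDiffAt.neg.add (hdc.contDiffAt.sqrt (hdpos x hx).ne')).div hac.contDiffAt
      (by positivity)
  · intro x hx
    have hx0 := hpd x hx
    have hs : √(disc x) ^ 2 = disc x := Real.sq_sqrt (hdpos x hx).le
    have e : ‖x + lam x • (x - p x)‖ ^ 2 = 1 := by
      rw [norm_add_sq_real, norm_smul, inner_smul_right, mul_pow, Real.norm_eq_abs, sq_abs]
      have e1 : inner ℝ x (x - p x) = b x := rfl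
      have e2 : lam x * ‖x - p x‖ ^ 2 = -b x + √(disc x) := by
        simp only [hlam]; field_simp
      have e3 : ‖x - p x‖ ^ 2 ≠ 0 := by positivity
      rw [e1]
      apply mul_left_cancel₀ e3
      have e4 : ‖x - p x‖ ^ 2 * (‖x‖ ^ 2 + 2 * (lam x * b x) + lam x ^ 2 * ‖x - p x‖ ^ 2)
          = ‖x - p x‖ ^ 2 * ‖x‖ ^ 2 + 2 * (lam x * ‖x - p x‖ ^ 2) * b x
            + (lam x * ‖x - p x‖ ^ 2) ^ 2 := by ring
      rw [e4, e2]
      have e5 : disc x = b x ^ 2 + ‖x - p x‖ ^ 2 * (1 - ‖x‖ ^ 2) := rfl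
      nlinarith
    exact (pow_eq_one_iff_of_nonneg (norm_nonneg _) two_ne_zero).1 e
  · intro x hx
    have hb0 := hbpos x hx
    have e5 : disc x = b x ^ 2 := by simp [hdisc, hx]
    have : lam x = 0 := by simp [hlam, e5, Real.sqrt_sq hb0.le]
    simp [this]

end Brouwer

/-! ### Schauder's fixed point theorem -/

/-- The Schauder fixed point theorem for continuous self-maps with relatively compact range. -/
theorem exists_fixedPoint_of_range_subset_compact {E : Type*} [NormedAddCommGroup E]
    [NormedSpace ℝ E] {f : E → E} (hf : Continuous f) {K : Set E} (hK : IsCompact K)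
    (hfK : ∀ x, f x ∈ K) : ∃ x, f x = x := by
  have happrox : ∀ n : ℕ, ∃ x, ‖f x - x‖ ≤ 1 / ((n : ℝ) + 1) := by
    intro n
    set ε : ℝ := 1 / ((n : ℝ) + 1)
    have hε : 0 < ε := by positivity
    obtain ⟨t, -, htf, ht⟩ := hK.finite_cover_balls hε
    classical
    have : Fintype t := htf.fintype
    let w : t → E → ℝ := fun i y => max 0 (ε - ‖y - i‖)
    have hw0 : ∀ i y, 0 ≤ w i y := fun i y => le_max_left _ _
    have hwc : ∀ i, Continuous (w i) := fun i => by fun_prop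
    let W : E → ℝ := fun y => ∑ i, w i y
    have hWc : Continuous W := continuous_finsetSum _ fun i _ => hwc i
    have hWpos : ∀ x, 0 < W (f x) := by
      intro x
      obtain ⟨i, hi, hxi⟩ := mem_iUnion₂.1 (ht (hfK x))
      refine Finset.sum_pos' (fun i _ => hw0 i _) ⟨⟨i, hi⟩, Finset.mem_univ _, ?_⟩
      refine lt_max_of_lt_right ?_
      rw [Metric.mem_ball, dist_eq_norm] at hxi
      exact sub_pos.2 hxi
    let c : EuclideanSpace ℝ t → E := fun l => ∑ i, l i • (i : E)
    have hcc : Continuous c := by fun_prop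
    -- Brouwer is applied to the barycentric weights of f(c l) relative to an ε-net. Since f is
    -- defined on all of E, l need not lie in the simplex; at a fixed point it does, and the weights
    -- charge only net points within ε of f(c l), so c l is moved by at most ε.
    let Φ : EuclideanSpace ℝ t → EuclideanSpace ℝ t := fun l =>
      WithLp.toLp 2 fun i => w i (f (c l)) / W (f (c l))
    have hΦc : Continuous Φ := by
      refine (PiLp.continuous_toLp 2 _).comp (continuous_pi fun i => ?_)
      exact ((hwc i).comp (hf.comp hcc)).div (hWc.comp (hf.comp hcc)) fun l => (hWpos _).ne'
    have hsum : ∀ l, ∑ i, Φ l i = 1 := by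
      intro l
      have : ∀ i, Φ l i = w i (f (c l)) / W (f (c l)) := fun i => rfl
      simp_rw [this, ← Finset.sum_div]
      exact div_self (hWpos _).ne'
    have hnn : ∀ l i, 0 ≤ Φ l i := fun l i => div_nonneg (hw0 _ _) (hWpos _).le
    have hle : ∀ l i, Φ l i ≤ 1 := fun l i => by
      rw [← hsum l]
      exact Finset.single_le_sum (fun j _ => hnn l j) (Finset.mem_univ i)
    have hΦb : ∀ l, ‖Φ l‖ ≤ 1 := by
      intro l
      rw [← sq_le_one_iff₀ (norm_nonneg _), EuclideanSpace.norm_sq_eq, ← hsum l]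
      refine Finset.sum_le_sum fun i _ => ?_
      rw [Real.norm_of_nonneg (hnn l i), sq]
      exact mul_le_of_le_one_left (hnn l i) (hle l i)
    obtain ⟨l, hl⟩ := exists_fixedPoint_of_norm_le_one hΦc hΦb
    refine ⟨c l, ?_⟩
    have e1 : f (c l) - c l = ∑ i, l i • (f (c l) - (i : E)) := by
      have hs : ∑ i, l i = 1 := by rw [← hsum l, hl]
      simp_rw [smul_sub]
      rw [Finset.sum_sub_distrib, ← Finset.sum_smul, hs, one_smul]
    have e2 : ∀ i, ‖l i • (f (c l) - (i : E))‖ ≤ l i * ε := by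
      intro i
      have e3 : l i = w i (f (c l)) / W (f (c l)) := by
        conv_lhs => rw [← hl]
      have e4 : 0 ≤ l i := by rw [← hl]; exact hnn l i
      rw [norm_smul, Real.norm_of_nonneg e4]
      by_cases h : ‖f (c l) - i‖ ≤ ε
      · gcongr
      · have : w i (f (c l)) = 0 := max_eq_left (by linarith)
        rw [e3, this]; simp
    calc ‖f (c l) - c l‖ ≤ ∑ i, l i * ε := by
          rw [e1]
          exact norm_sum_le_of_le _ fun i _ => e2 i
      _ = ε := by
        rw [← Finset.sum_mul]
        have hs : ∑ i, l i = 1 := by rw [← hsum l, hl]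
        rw [hs, one_mul]
  choose x hx using happrox
  obtain ⟨y, -, φ, hφ, hy⟩ := hK.tendsto_subseq fun n => hfK (x n)
  refine ⟨y, ?_⟩
  have hd : Tendsto (fun n => f (x (φ n)) - x (φ n)) atTop (𝓝 0) := by
    refine squeeze_zero_norm (fun n => hx (φ n)) ?_
    exact tendsto_one_div_add_atTop_nhds_zero_nat.comp hφ.tendsto_atTop
  have hxy : Tendsto (fun n => x (φ n)) atTop (𝓝 y) := by
    simpa using (hy : Tendsto (fun n => f (x (φ n))) atTop (𝓝 y)).sub hd
  exact tendsto_nhds_unique ((hf.tendsto y).comp hxy) hy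

/-! ### Compact semigroups and their adjoints -/

section Semigroup

set_option linter.unusedSectionVars false

variable {𝕜 X : Type*} [RCLike 𝕜]
  [NormedAddCommGroup X] [InnerProductSpace 𝕜 X] [CompleteSpace X]

/-- The semigroup extended to negative times by the identity. -/
def C0Semigroup.ext (S : C0Semigroup 𝕜 X) (t : ℝ) : X →L[𝕜] X := S.op (max t 0)

lemma C0Semigroup.ext_of_nonneg (S : C0Semigroup 𝕜 X) {t : ℝ} (ht : 0 ≤ t) :
    S.ext t = S.op t := by rw [ext, max_eq_left ht]

@[simp] lemma C0Semigroup.ext_zero (S : C0Semigroup 𝕜 X) :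
    S.ext 0 = ContinuousLinearMap.id 𝕜 X := by rw [S.ext_of_nonneg le_rfl, S.op_zero]

lemma C0Semigroup.ext_add_apply (S : C0Semigroup 𝕜 X) {s t : ℝ} (hs : 0 ≤ s) (ht : 0 ≤ t)
    (x : X) : S.ext (s + t) x = S.ext s (S.ext t x) := by
  rw [S.ext_of_nonneg hs, S.ext_of_nonneg ht, S.ext_of_nonneg (add_nonneg hs ht), S.op_add s t hs ht]
  rfl

lemma C0Semigroup.continuous_ext_const (S : C0Semigroup 𝕜 X) (x : X) :
    Continuous fun t => S.ext t x :=
  (S.continuousOn_op x).comp_continuous (by fun_prop) fun t => le_max_right t 0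

lemma C0Semigroup.exists_bound (S : C0Semigroup 𝕜 X) (T : ℝ) :
    ∃ K : ℝ, 1 ≤ K ∧ ∀ t ≤ T, ‖S.ext t‖ ≤ K := by
  obtain ⟨C, hC⟩ := banach_steinhaus (ι := Icc (0 : ℝ) (max T 0)) (g := fun t => S.ext t)
    fun x => by
      obtain ⟨C, hC⟩ := (isCompact_Icc (a := (0 : ℝ)) (b := max T 0)).exists_bound_of_continuousOn
        (S.continuous_ext_const x).continuousOn
      exact ⟨C, fun i => hC i i.2⟩
  refine ⟨max C 1, le_max_right _ _, fun t ht => ?_⟩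
  have h := hC ⟨max t 0, le_max_right _ _, max_le_max ht le_rfl⟩
  refine le_trans ?_ (h.trans (le_max_left _ _))
  simp [ext]

lemma C0Semigroup.continuous_ext_uncurry (S : C0Semigroup 𝕜 X) :
    Continuous fun p : ℝ × X => S.ext p.1 p.2 := by
  rw [continuous_iff_continuousAt]
  rintro ⟨t, x⟩
  obtain ⟨K, hK1, hK⟩ := S.exists_bound (t + 1)
  rw [ContinuousAt, tendsto_iff_norm_sub_tendsto_zero]
  have h1 : Tendsto (fun p : ℝ × X => K * ‖p.2 - x‖ + ‖S.ext p.1 x - S.ext t x‖)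
      (𝓝 (t, x)) (𝓝 0) := by
    have hc : Continuous fun p : ℝ × X => K * ‖p.2 - x‖ + ‖S.ext p.1 x - S.ext t x‖ := by
      have := (S.continuous_ext_const x).comp (continuous_fst (X := ℝ) (Y := X))
      fun_prop
    simpa using hc.tendsto (t, x)
  refine squeeze_zero' (Eventually.of_forall fun _ => norm_nonneg _) ?_ h1
  have hev : ∀ᶠ p : ℝ × X in 𝓝 (t, x), p.1 ≤ t + 1 :=
    (continuous_fst.tendsto (t, x)).eventually (eventually_le_nhds (by simp))
  filter_upwards [hev] with p hp
  calc ‖S.ext p.1 p.2 - S.ext t x‖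
      = ‖S.ext p.1 (p.2 - x) + (S.ext p.1 x - S.ext t x)‖ := by rw [map_sub]; abel_nf
    _ ≤ ‖S.ext p.1 (p.2 - x)‖ + ‖S.ext p.1 x - S.ext t x‖ := norm_add_le _ _
    _ ≤ _ := by
      gcongr
      exact (S.ext p.1).le_of_opNorm_le (hK _ hp) _

lemma C0Semigroup.continuous_ext_apply (S : C0Semigroup 𝕜 X) {Z : Type*} [TopologicalSpace Z]
    {a : Z → ℝ} {b : Z → X} (ha : Continuous a) (hb : Continuous b) :
    Continuous fun z => S.ext (a z) (b z) :=
  S.continuous_ext_uncurry.comp (ha.prodMk hb)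

/-- A strongly continuous semigroup is continuous in time uniformly on compact sets. -/
lemma C0Semigroup.eventually_forall_mem_compact (S : C0Semigroup 𝕜 X) {C : Set X}
    (hC : IsCompact C) (t₀ : ℝ) {ε : ℝ} (hε : 0 < ε) :
    ∀ᶠ t in 𝓝 t₀, ∀ x ∈ C, ‖S.ext t x - S.ext t₀ x‖ < ε := by
  refine hC.eventually_forall_of_forall_eventually fun x _ => ?_
  have hc : Continuous fun p : ℝ × X => ‖S.ext p.1 p.2 - S.ext t₀ p.2‖ :=
    ((S.continuous_ext_apply continuous_fst continuous_snd).sub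
      ((S.ext t₀).continuous.comp continuous_snd)).norm
  exact (hc.tendsto (t₀, x)).eventually_lt_const (by simpa using hε)

/-- A compact semigroup is continuous in operator norm at positive times. -/
lemma C0Semigroup.continuousAt_ext_of_pos {S : C0Semigroup 𝕜 X} (hS : S.IsCompactSemigroup)
    {t₀ : ℝ} (ht₀ : 0 < t₀) : ContinuousAt S.ext t₀ := by
  set δ := t₀ / 2 with hδdef
  have hδ : 0 < δ := by positivity
  have hC : IsCompact (closure (S.ext δ '' Metric.closedBall (0 : X) 1)) := by
    have h := hS δ hδ
    rw [← S.ext_of_nonneg hδ.le] at h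
    exact h.isCompact_closure_image_closedBall (f := (S.ext δ : X →ₗ[𝕜] X)) 1
  rw [Metric.continuousAt_iff']
  intro ε hε
  have h1 := S.eventually_forall_mem_compact hC (t₀ - δ) (half_pos hε)
  have h2 : Tendsto (fun t : ℝ => t - δ) (𝓝 t₀) (𝓝 (t₀ - δ)) :=
    (continuous_id.sub continuous_const).tendsto t₀
  filter_upwards [h2.eventually h1, eventually_ge_nhds (show δ < t₀ by linarith)] with t ht htδ
  rw [dist_eq_norm]
  refine lt_of_le_of_lt ?_ (half_lt_self hε)
  refine ContinuousLinearMap.opNorm_le_of_unit_norm (𝕜 := 𝕜) (by positivity) fun x hx => ?_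
  -- Factoring out S(δ) turns strong continuity, uniform on the compact closure of S(δ)(ball), into
  -- norm continuity.
  have e : ∀ r, δ ≤ r → S.ext r x = S.ext (r - δ) (S.ext δ x) := fun r hr => by
    rw [← S.ext_add_apply (sub_nonneg.2 hr) hδ.le, sub_add_cancel]
  rw [sub_apply, e t htδ, e t₀ (by linarith)]
  exact (ht _ (subset_closure (mem_image_of_mem _ (by simp [hx])))).le

/-- The adjoint of a compact operator is compact. -/
lemma isCompactOperator_adjoint {A : X →L[𝕜] X} (hA : IsCompactOperator A) :
    IsCompactOperator (ContinuousLinearMap.adjoint A) := by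
  refine (isCompactOperator_iff_isCompact_closure_image_closedBall
    (ContinuousLinearMap.adjoint A : X →ₗ[𝕜] X) one_pos).2 ?_
  refine TotallyBounded.isCompact_of_isClosed (TotallyBounded.closure ?_) isClosed_closure
  -- From ‖A*z‖² = ⟨AA*z, z⟩ ≤ ‖AA*z‖ ‖z‖ with z = x - y of norm at most 2, a net of mesh ε²/2 for
  -- the image of the ball under AA* gives a net of mesh ε for its image under A*.
  have hcomp : TotallyBounded ((A ∘L ContinuousLinearMap.adjoint A) '' Metric.closedBall 0 1) := by
    have h := (hA.comp_clm (ContinuousLinearMap.adjoint A)).isCompact_closure_image_closedBall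
      (f := ((A ∘L ContinuousLinearMap.adjoint A : X →L[𝕜] X) : X →ₗ[𝕜] X)) 1
    exact h.totallyBounded.subset subset_closure
  rw [Metric.totallyBounded_iff]
  intro ε hε
  obtain ⟨t, hts, htf, ht⟩ := exists_subset_image_finite_and.1
    (Metric.finite_approx_of_totallyBounded hcomp (ε ^ 2 / 2) (by positivity))
  refine ⟨ContinuousLinearMap.adjoint A '' t, htf.image _, ?_⟩
  rintro _ ⟨x, hx, rfl⟩
  obtain ⟨_, ⟨y, hy, rfl⟩, hxy⟩ := mem_iUnion₂.1 (ht (mem_image_of_mem _ hx))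
  refine mem_iUnion₂.2 ⟨_, mem_image_of_mem _ hy, ?_⟩
  rw [Metric.mem_ball, dist_eq_norm, ContinuousLinearMap.comp_apply, ContinuousLinearMap.comp_apply,
    ← map_sub, ← map_sub] at hxy
  rw [Metric.mem_ball, dist_eq_norm]
  have hyb := hts hy
  rw [mem_closedBall_zero_iff] at hx hyb
  have h2 : ‖x - y‖ ≤ 2 := (norm_sub_le x y).trans (by linarith)
  have h3 : ‖ContinuousLinearMap.adjoint A (x - y)‖ ^ 2 < ε ^ 2 := by
    calc ‖ContinuousLinearMap.adjoint A (x - y)‖ ^ 2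
        = RCLike.re (inner 𝕜 (A (ContinuousLinearMap.adjoint A (x - y))) (x - y)) := by
          rw [← ContinuousLinearMap.adjoint_inner_right, inner_self_eq_norm_sq]
      _ ≤ ‖A (ContinuousLinearMap.adjoint A (x - y))‖ * ‖x - y‖ := re_inner_le_norm _ _
      _ ≤ ‖A (ContinuousLinearMap.adjoint A (x - y))‖ * 2 := by gcongr
      _ < ε ^ 2 / 2 * 2 := by gcongr
      _ = ε ^ 2 := by ring
  have e : (ContinuousLinearMap.adjoint A : X →ₗ[𝕜] X) x - ContinuousLinearMap.adjoint A y
      = ContinuousLinearMap.adjoint A (x - y) := by rw [map_sub]; rfl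
  rw [e]
  exact lt_of_pow_lt_pow_left₀ 2 hε.le h3

lemma adjoint_id_eq : ContinuousLinearMap.adjoint (ContinuousLinearMap.id 𝕜 X)
    = ContinuousLinearMap.id 𝕜 X :=
  ((ContinuousLinearMap.eq_adjoint_iff _ _).2 fun _ _ => rfl).symm

section Adjoint

variable [NormedSpace ℝ X] [IsScalarTower ℝ 𝕜 X] {S : C0Semigroup 𝕜 X}

lemma C0Semigroup.continuousOn_adjoint_ext (hS : S.IsCompactSemigroup) (x : X) :
    ContinuousOn (fun t => ContinuousLinearMap.adjoint (S.ext t) x) (Ioi 0) := fun t ht => by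
  have h1 : ContinuousAt (fun t => ContinuousLinearMap.adjoint (S.ext t)) t :=
    (ContinuousLinearMap.adjoint (𝕜 := 𝕜) (E := X) (F := X)).continuous.continuousAt.comp
      (S.continuousAt_ext_of_pos hS ht)
  exact (h1.clm_apply continuousAt_const).continuousWithinAt

/-- Compactness makes t ↦ S(t)* norm continuous for t > 0, which supplies measurability before
strong continuity at 0 is known. -/
lemma C0Semigroup.intervalIntegrable_adjoint_ext (hS : S.IsCompactSemigroup) (x : X) (a b : ℝ) :
    IntervalIntegrable (fun t => ContinuousLinearMap.adjoint (S.ext t) x) volume a b := by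
  obtain ⟨K, -, hK⟩ := S.exists_bound (max a b)
  have hm : AEStronglyMeasurable (fun t => ContinuousLinearMap.adjoint (S.ext t) x)
      (volume : Measure ℝ) := by
    have h1 : AEStronglyMeasurable (fun t => ContinuousLinearMap.adjoint (S.ext t) x)
        (volume.restrict (Ioi (0 : ℝ))) :=
      (S.continuousOn_adjoint_ext hS x).aestronglyMeasurable measurableSet_Ioi
    have h2 : AEStronglyMeasurable (fun t => ContinuousLinearMap.adjoint (S.ext t) x)
        (volume.restrict (Iic (0 : ℝ))) := by
      refine AEStronglyMeasurable.congr (aestronglyMeasurable_const (b := x)) ?_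
      filter_upwards [ae_restrict_mem measurableSet_Iic] with t ht
      rw [ext, max_eq_right ht, S.op_zero, adjoint_id_eq]
      rfl
    have h3 := aestronglyMeasurable_union_iff.2 ⟨h2, h1⟩
    rwa [Iic_union_Ioi, Measure.restrict_univ] at h3
  refine (intervalIntegrable_const (c := K * ‖x‖)).mono_fun hm.restrict ?_
  filter_upwards [ae_restrict_mem measurableSet_uIoc] with t ht
  have h0 : ‖ContinuousLinearMap.adjoint (S.ext t) x‖ ≤ K * ‖x‖ := by
    refine ContinuousLinearMap.le_of_opNorm_le _ ?_ x
    rw [LinearIsometryEquiv.norm_map]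
    exact hK t (by simpa using ht.2)
  exact h0.trans (le_abs_self _)

/-- Convergence holds on a subspace containing all averages ∫₀^δ S(s)*y ds, because S(t)* merely
shifts the interval of integration. A vector y orthogonal to this subspace is orthogonal to its own
averages, and differentiating ∫₀^δ ⟨S(s)y, y⟩ ds = 0 at 0 gives y = 0. Hence the subspace is dense,
and uniform boundedness near 0 extends convergence to all of X. -/
lemma C0Semigroup.tendsto_adjoint_ext_zero (hS : S.IsCompactSemigroup) (x : X) :
    Tendsto (fun t => ContinuousLinearMap.adjoint (S.ext t) x) (𝓝[>] 0) (𝓝 x) := by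
  obtain ⟨K, hK1, hK⟩ := S.exists_bound 1
  have hKadj : ∀ t ≤ 1, ‖ContinuousLinearMap.adjoint (S.ext t)‖ ≤ K := fun t ht => by
    rw [LinearIsometryEquiv.norm_map]; exact hK t ht
  let D : Submodule 𝕜 X :=
    { carrier := {x | Tendsto (fun t => ContinuousLinearMap.adjoint (S.ext t) x) (𝓝[>] 0) (𝓝 x)}
      add_mem' := fun {a b} ha hb => by
        simpa only [mem_ofPred_eq, map_add] using Tendsto.add ha hb
      zero_mem' := by simp
      smul_mem' := fun c a ha => by
        simpa only [mem_ofPred_eq, map_smul] using Tendsto.const_smul ha c }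
  have hDdense : D.topologicalClosure = ⊤ := by
    rw [Submodule.topologicalClosure_eq_top_iff, Submodule.eq_bot_iff]
    intro y hy
    have hmem : ∀ δ : ℝ, 0 < δ →
        (∫ s in (0 : ℝ)..δ, ContinuousLinearMap.adjoint (S.ext s) y) ∈ D := by
      intro δ hδ
      set a : ℝ → X := fun s => ContinuousLinearMap.adjoint (S.ext s) y with ha
      have hai : ∀ c d, IntervalIntegrable a volume c d :=
        S.intervalIntegrable_adjoint_ext hS y
      have hcont : Continuous fun t => ∫ s in t..(t + δ), a s := by
        have hp := intervalIntegral.continuous_primitive hai 0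
        have e : (fun t => ∫ s in t..(t + δ), a s)
            = fun t => (∫ s in (0 : ℝ)..(t + δ), a s) - ∫ s in (0 : ℝ)..t, a s := by
          funext t
          rw [intervalIntegral.integral_interval_sub_left (hai _ _) (hai _ _)]
        rw [e]
        exact (hp.comp (by fun_prop)).sub hp
      have hlim : Tendsto (fun t => ∫ s in t..(t + δ), a s) (𝓝[>] 0)
          (𝓝 (∫ s in (0 : ℝ)..δ, a s)) := by
        simpa using (hcont.tendsto 0).mono_left nhdsWithin_le_nhds
      refine hlim.congr' ?_
      filter_upwards [self_mem_nhdsWithin] with t ht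
      rw [← ContinuousLinearMap.intervalIntegral_comp_comm _ (hai _ _)]
      have e2 : ∫ s in t..(t + δ), a s = ∫ s in (0 : ℝ)..δ, a (s + t) := by
        rw [intervalIntegral.integral_comp_add_right]; simp [add_comm]
      rw [e2]
      refine intervalIntegral.integral_congr fun s hs => ?_
      rw [uIcc_of_le hδ.le] at hs
      have e3 : S.ext (s + t) = S.ext s ∘L S.ext t := by
        ext z; exact S.ext_add_apply hs.1 (le_of_lt ht) z
      simp only [ha, e3, ContinuousLinearMap.adjoint_comp]
      rfl
    have hzero : ∀ δ : ℝ, 0 < δ → ∫ s in (0 : ℝ)..δ, inner 𝕜 (S.ext s y) y = 0 := by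
      intro δ hδ
      have h1 := (Submodule.mem_orthogonal' D y).1 hy _ (hmem δ hδ)
      rw [intervalIntegral.integral_of_le hδ.le, ← integral_inner
        (S.intervalIntegrable_adjoint_ext hS y 0 δ).1, ← intervalIntegral.integral_of_le hδ.le] at h1
      simpa only [ContinuousLinearMap.adjoint_inner_right] using h1
    have hc : Continuous fun s => inner 𝕜 (S.ext s y) y :=
      (S.continuous_ext_const y).inner continuous_const
    -- The integral is known to vanish only for δ > 0, so the derivative is taken within the right
    -- half-line.
    have hd := (hc.integral_hasStrictDerivAt 0 0).hasDerivAt.hasDerivWithinAt (s := Ici 0)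
    have hd0 : HasDerivWithinAt (fun u => ∫ s in (0 : ℝ)..u, inner 𝕜 (S.ext s y) y) 0 (Ici 0) 0 := by
      refine (hasDerivWithinAt_const (0 : ℝ) (Ici 0) (0 : 𝕜)).congr (fun u hu => ?_) (by simp)
      rcases (show (0 : ℝ) ≤ u from hu).eq_or_lt with h | h
      · simp [← h]
      · exact hzero u h
    have := (uniqueDiffOn_Ici (0 : ℝ) 0 (by simp)).eq_deriv _ hd hd0
    simpa using this
  rw [Metric.tendsto_nhds]
  intro ε hε
  have hx : x ∈ D.topologicalClosure := by rw [hDdense]; trivial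
  obtain ⟨y, hy, hxy⟩ := Metric.mem_closure_iff.1 hx (ε / (2 * (K + 1))) (by positivity)
  have hy' : Tendsto (fun t => ContinuousLinearMap.adjoint (S.ext t) y) (𝓝[>] 0) (𝓝 y) := hy
  have h1 : ∀ᶠ t : ℝ in 𝓝[>] 0, t ≤ 1 :=
    mem_nhdsWithin_of_mem_nhds (Iic_mem_nhds one_pos)
  filter_upwards [(Metric.tendsto_nhds.1 hy') (ε / 2) (by positivity), h1] with t ht ht1
  rw [dist_eq_norm] at *
  calc ‖ContinuousLinearMap.adjoint (S.ext t) x - x‖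
      = ‖ContinuousLinearMap.adjoint (S.ext t) (x - y)
          + (ContinuousLinearMap.adjoint (S.ext t) y - y) - (x - y)‖ := by
        rw [map_sub]; abel_nf
    _ ≤ ‖ContinuousLinearMap.adjoint (S.ext t) (x - y)‖
          + ‖ContinuousLinearMap.adjoint (S.ext t) y - y‖ + ‖x - y‖ :=
        (norm_sub_le _ _).trans (by gcongr; exact norm_add_le _ _)
    _ ≤ K * ‖x - y‖ + ‖ContinuousLinearMap.adjoint (S.ext t) y - y‖ + ‖x - y‖ := by
        gcongr
        exact ContinuousLinearMap.le_of_opNorm_le _ (hKadj t ht1) _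
    _ = (K + 1) * ‖x - y‖ + ‖ContinuousLinearMap.adjoint (S.ext t) y - y‖ := by ring
    _ < (K + 1) * (ε / (2 * (K + 1))) + ε / 2 := by gcongr
    _ = ε := by field_simp; ring

/-- The adjoint of a compact semigroup is a strongly continuous semigroup. -/
def C0Semigroup.adj (S : C0Semigroup 𝕜 X) (hS : S.IsCompactSemigroup) : C0Semigroup 𝕜 X where
  op t := ContinuousLinearMap.adjoint (S.op t)
  op_zero := by rw [S.op_zero, adjoint_id_eq]
  op_add s t hs ht := by
    rw [add_comm, S.op_add t s ht hs, ContinuousLinearMap.adjoint_comp]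
  continuousOn_op x := by
    have h0 : EqOn (fun t => ContinuousLinearMap.adjoint (S.op t) x)
        (fun t => ContinuousLinearMap.adjoint (S.ext t) x) (Ici 0) := fun t ht => by
      simp only [S.ext_of_nonneg ht]
    refine ContinuousOn.congr (fun t ht => ?_) h0
    rcases (show (0 : ℝ) ≤ t from ht).eq_or_lt with h | h
    · subst h
      rw [← continuousWithinAt_Ioi_iff_Ici]
      simpa [ContinuousWithinAt, adjoint_id_eq] using S.tendsto_adjoint_ext_zero hS x
    · exact ((S.continuousOn_adjoint_ext hS x).continuousAt (Ioi_mem_nhds h)).continuousWithinAt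

lemma C0Semigroup.adj_isCompactSemigroup (hS : S.IsCompactSemigroup) :
    (S.adj hS).IsCompactSemigroup := fun t ht => isCompactOperator_adjoint (hS t ht)

end Adjoint

end Semigroup

/-! ### Evolution operators through a weighted Volterra equation -/

section Volterra

set_option linter.unusedSectionVars false

variable {𝕜 X : Type*} [RCLike 𝕜]
  [NormedAddCommGroup X] [InnerProductSpace 𝕜 X] [CompleteSpace X]
  [NormedSpace ℝ X] [IsScalarTower ℝ 𝕜 X]

/-- An operator norm bound for the semigroup on `[0, T]`. -/
def C0Semigroup.growthBound (S : C0Semigroup 𝕜 X) (T : ℝ) : ℝ := (S.exists_bound T).choose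

lemma C0Semigroup.one_le_growthBound (S : C0Semigroup 𝕜 X) (T : ℝ) : 1 ≤ S.growthBound T :=
  (S.exists_bound T).choose_spec.1

lemma C0Semigroup.growthBound_pos (S : C0Semigroup 𝕜 X) (T : ℝ) : 0 < S.growthBound T :=
  one_pos.trans_le (S.one_le_growthBound T)

lemma C0Semigroup.norm_ext_le (S : C0Semigroup 𝕜 X) {t T : ℝ} (ht : t ≤ T) :
    ‖S.ext t‖ ≤ S.growthBound T :=
  (S.exists_bound T).choose_spec.2 t ht

lemma C0Semigroup.norm_ext_apply_le (S : C0Semigroup 𝕜 X) {t T : ℝ} (ht : t ≤ T) (x : X) :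
    ‖S.ext t x‖ ≤ S.growthBound T * ‖x‖ :=
  (S.ext t).le_of_opNorm_le (S.norm_ext_le ht) x

/-- The semigroup `exp(-lam t) S(t)`. -/
def C0Semigroup.scale (S : C0Semigroup 𝕜 X) (lam : ℝ) : C0Semigroup 𝕜 X where
  op t := Real.exp (-lam * t) • S.op t
  op_zero := by simp [S.op_zero]
  op_add s t hs ht := by
    ext x
    simp only [S.op_add s t hs ht, smul_apply, ContinuousLinearMap.comp_apply,
      ContinuousLinearMap.map_smul_of_tower, smul_smul, ← Real.exp_add]
    ring_nf
  continuousOn_op x := by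
    simp only [smul_apply]
    exact ContinuousOn.smul (by fun_prop) (S.continuousOn_op x)

lemma C0Semigroup.scale_ext_of_nonneg (S : C0Semigroup 𝕜 X) (lam : ℝ) {t : ℝ} (ht : 0 ≤ t) (x : X) :
    (S.scale lam).ext t x = Real.exp (-lam * t) • S.ext t x := by
  rw [ext_of_nonneg _ ht, ext_of_nonneg _ ht]; rfl

variable {T : ℝ}

/-- The integrand of the Volterra operator. -/
def volterraIntegrand (R : C0Semigroup 𝕜 X) (hT : 0 ≤ T) (G : C(Icc (0 : ℝ) T, X →L[𝕜] X))
    (e : C(Icc (0 : ℝ) T × Icc (0 : ℝ) T, X)) (p : Icc (0 : ℝ) T × Icc (0 : ℝ) T) (r : ℝ) : X :=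
  R.ext (p.1 - r) (G (projIcc 0 T hT r) (e (projIcc 0 T hT r, p.2)))

lemma continuous_volterraIntegrand (R : C0Semigroup 𝕜 X) (hT : 0 ≤ T)
    (G : C(Icc (0 : ℝ) T, X →L[𝕜] X)) (e : C(Icc (0 : ℝ) T × Icc (0 : ℝ) T, X)) :
    Continuous (Function.uncurry (volterraIntegrand R hT G e)) := by
  have hp : Continuous fun q : (Icc (0 : ℝ) T × Icc (0 : ℝ) T) × ℝ => projIcc 0 T hT q.2 :=
    continuous_projIcc.comp continuous_snd
  refine R.continuous_ext_apply (by fun_prop) ?_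
  exact (G.continuous.comp hp).clm_apply
    (e.continuous.comp (hp.prodMk (continuous_snd.comp continuous_fst)))

lemma intervalIntegrable_volterraIntegrand (R : C0Semigroup 𝕜 X) (hT : 0 ≤ T)
    (G : C(Icc (0 : ℝ) T, X →L[𝕜] X)) (e : C(Icc (0 : ℝ) T × Icc (0 : ℝ) T, X))
    (p : Icc (0 : ℝ) T × Icc (0 : ℝ) T) (a b : ℝ) :
    IntervalIntegrable (volterraIntegrand R hT G e p) volume a b :=
  ((continuous_volterraIntegrand R hT G e).comp (Continuous.prodMk_right p)).intervalIntegrable a b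

/-- The function `(t, s) ↦ ∫ₛᵗ R(t - r) G(r) e(r, s) dr`, extended by zero to `t < s`. -/
def volterraFun (R : C0Semigroup 𝕜 X) (hT : 0 ≤ T) (G : C(Icc (0 : ℝ) T, X →L[𝕜] X))
    (e : C(Icc (0 : ℝ) T × Icc (0 : ℝ) T, X)) : C(Icc (0 : ℝ) T × Icc (0 : ℝ) T, X) where
  toFun p := ∫ r in (p.2 : ℝ)..max p.2 p.1, volterraIntegrand R hT G e p r
  continuous_toFun := by
    have h := intervalIntegrable_volterraIntegrand R hT G e
    have e1 : (fun p : Icc (0 : ℝ) T × Icc (0 : ℝ) T =>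
        ∫ r in (p.2 : ℝ)..max p.2 p.1, volterraIntegrand R hT G e p r)
        = fun p => (∫ r in (0 : ℝ)..max p.2 p.1, volterraIntegrand R hT G e p r)
          - ∫ r in (0 : ℝ)..p.2, volterraIntegrand R hT G e p r := by
      funext p
      rw [intervalIntegral.integral_interval_sub_left (h _ _ _) (h _ _ _)]
    rw [e1]
    have hc := continuous_volterraIntegrand R hT G e
    exact (intervalIntegral.continuous_parametric_intervalIntegral_of_continuous hc
      (by fun_prop)).sub
      (intervalIntegral.continuous_parametric_intervalIntegral_of_continuous hc (by fun_prop))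

lemma volterraFun_apply (R : C0Semigroup 𝕜 X) (hT : 0 ≤ T) (G : C(Icc (0 : ℝ) T, X →L[𝕜] X))
    (e : C(Icc (0 : ℝ) T × Icc (0 : ℝ) T, X)) (p : Icc (0 : ℝ) T × Icc (0 : ℝ) T) :
    volterraFun R hT G e p = ∫ r in (p.2 : ℝ)..max p.2 p.1, volterraIntegrand R hT G e p r := rfl

lemma norm_volterraIntegrand_le (R : C0Semigroup 𝕜 X) (hT : 0 ≤ T)
    (G : C(Icc (0 : ℝ) T, X →L[𝕜] X)) (e : C(Icc (0 : ℝ) T × Icc (0 : ℝ) T, X))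
    (p : Icc (0 : ℝ) T × Icc (0 : ℝ) T) (r : ℝ) :
    ‖volterraIntegrand R hT G e p r‖ ≤ ‖R.ext (p.1 - r)‖ * (‖G‖ * ‖e‖) := by
  refine (ContinuousLinearMap.le_opNorm _ _).trans ?_
  gcongr
  refine (ContinuousLinearMap.le_opNorm _ _).trans ?_
  gcongr
  · exact G.norm_coe_le_norm _
  · exact e.norm_coe_le_norm _

lemma norm_volterraFun_le (R : C0Semigroup 𝕜 X) (hT : 0 ≤ T) (G : C(Icc (0 : ℝ) T, X →L[𝕜] X))
    (e : C(Icc (0 : ℝ) T × Icc (0 : ℝ) T, X)) :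
    ‖volterraFun R hT G e‖ ≤ R.growthBound T * T * ‖G‖ * ‖e‖ := by
  have hK := R.growthBound_pos T
  rw [ContinuousMap.norm_le _ (by positivity)]
  rintro ⟨t, s⟩
  rw [volterraFun_apply]
  refine (intervalIntegral.norm_integral_le_of_norm_le_const
    (C := R.growthBound T * (‖G‖ * ‖e‖)) fun r hr => ?_).trans ?_
  · refine (norm_volterraIntegrand_le R hT G e _ r).trans ?_
    gcongr
    refine R.norm_ext_le ?_
    rw [uIoc_of_le (le_max_left _ _)] at hr
    have := hr.1
    have := s.2.1
    have := t.2.2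
    dsimp only at *
    linarith
  · have h1 : |max (s : ℝ) t - s| ≤ T := by
      rw [abs_of_nonneg (sub_nonneg.2 (le_max_left _ _))]
      have := max_le s.2.2 t.2.2
      have := s.2.1
      linarith
    calc R.growthBound T * (‖G‖ * ‖e‖) * |max (s : ℝ) t - s|
        ≤ R.growthBound T * (‖G‖ * ‖e‖) * T := by gcongr
      _ = _ := by ring

/-- The Volterra operator, as a bounded bilinear map. -/
def volterra (R : C0Semigroup 𝕜 X) (hT : 0 ≤ T) : C(Icc (0 : ℝ) T, X →L[𝕜] X) →L[𝕜]
    C(Icc (0 : ℝ) T × Icc (0 : ℝ) T, X) →L[𝕜] C(Icc (0 : ℝ) T × Icc (0 : ℝ) T, X) :=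
  LinearMap.mkContinuous₂
    (LinearMap.mk₂ 𝕜 (volterraFun R hT)
      (fun G₁ G₂ e => by
        ext p
        simp only [ContinuousMap.add_apply, volterraFun_apply]
        rw [← intervalIntegral.integral_add (intervalIntegrable_volterraIntegrand ..)
          (intervalIntegrable_volterraIntegrand ..)]
        simp [volterraIntegrand])
      (fun c G e => by
        ext p
        simp only [ContinuousMap.smul_apply, volterraFun_apply]
        rw [← intervalIntegral.integral_smul]
        simp [volterraIntegrand])
      (fun G e₁ e₂ => by
        ext p
        simp only [ContinuousMap.add_apply, volterraFun_apply]
        rw [← intervalIntegral.integral_add (intervalIntegrable_volterraIntegrand ..)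
          (intervalIntegrable_volterraIntegrand ..)]
        simp [volterraIntegrand])
      (fun c G e => by
        ext p
        simp only [ContinuousMap.smul_apply, volterraFun_apply]
        rw [← intervalIntegral.integral_smul]
        simp [volterraIntegrand]))
    (R.growthBound T * T) (fun G e => norm_volterraFun_le R hT G e)

lemma volterra_apply (R : C0Semigroup 𝕜 X) (hT : 0 ≤ T) (G : C(Icc (0 : ℝ) T, X →L[𝕜] X))
    (e : C(Icc (0 : ℝ) T × Icc (0 : ℝ) T, X)) (p : Icc (0 : ℝ) T × Icc (0 : ℝ) T) :
    volterra R hT G e p = ∫ r in (p.2 : ℝ)..max p.2 p.1, volterraIntegrand R hT G e p r := rfl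

/-- The map `x ↦ ((t, s) ↦ R(t - s) x)`. -/
def propagator (R : C0Semigroup 𝕜 X) (T : ℝ) :
    X →L[𝕜] C(Icc (0 : ℝ) T × Icc (0 : ℝ) T, X) :=
  LinearMap.mkContinuous
    { toFun := fun x => ⟨fun p => R.ext (p.1 - p.2) x,
        R.continuous_ext_apply (by fun_prop) continuous_const⟩
      map_add' := fun x y => by ext; simp
      map_smul' := fun c x => by ext; simp }
    (R.growthBound T) fun x => by
      have := R.growthBound_pos T
      refine (ContinuousMap.norm_le _ (by positivity)).2 fun p => ?_
      refine R.norm_ext_apply_le ?_ x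
      have := p.1.2.2
      have := p.2.2.1
      linarith

lemma propagator_apply (R : C0Semigroup 𝕜 X) (x : X) (p : Icc (0 : ℝ) T × Icc (0 : ℝ) T) :
    propagator R T x p = R.ext (p.1 - p.2) x := rfl

/-- An exponential rate for which the weighted Volterra operators of all `G` with `‖G‖ ≤ L` are
contractions. -/
def C0Semigroup.rate (S : C0Semigroup 𝕜 X) (T L : ℝ) : ℝ := 2 * S.growthBound T * |L| + 1

lemma C0Semigroup.rate_pos (S : C0Semigroup 𝕜 X) (T L : ℝ) : 0 < S.rate T L := by
  have := S.growthBound_pos T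
  unfold rate
  positivity

lemma integral_exp_neg_mul_sub_le {lam : ℝ} (hlam : 0 < lam) (s t : ℝ) :
    ∫ r in s..t, Real.exp (-lam * (t - r)) ≤ 1 / lam := by
  have hd : ∀ r ∈ uIcc s t, HasDerivAt (fun r => Real.exp (-lam * (t - r)) / lam)
      (Real.exp (-lam * (t - r))) r := by
    intro r _
    have h1 : HasDerivAt (fun r => -lam * (t - r)) lam r := by
      simpa using ((hasDerivAt_id r).const_sub t).const_mul (-lam)
    have h2 := h1.exp.div_const lam
    rwa [mul_div_cancel_right₀ _ hlam.ne'] at h2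
  rw [intervalIntegral.integral_eq_sub_of_hasDerivAt hd
    (Continuous.intervalIntegrable (by fun_prop) _ _)]
  have : 0 < Real.exp (-lam * (t - s)) / lam := by positivity
  rw [sub_self, mul_zero, Real.exp_zero]
  linarith

/-- Integrating the weight gives the factor 1/λ, so the norm is at most K L/λ, with K the growth
bound; the rate λ = 2K|L| + 1 makes this at most 1/2, and the summand 1 keeps λ positive when L = 0.
-/
lemma norm_volterra_scale_le (S : C0Semigroup 𝕜 X) (hT : 0 ≤ T) {L : ℝ}
    {G : C(Icc (0 : ℝ) T, X →L[𝕜] X)} (hG : ‖G‖ ≤ L) :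
    ‖volterra (S.scale (S.rate T L)) hT G‖ ≤ 1 / 2 := by
  have hK := S.growthBound_pos T
  have hlam := S.rate_pos T L
  have hL : |L| = L := abs_of_nonneg ((norm_nonneg G).trans hG)
  set lam := S.rate T L with hlamdef
  refine ContinuousLinearMap.opNorm_le_bound _ (by norm_num) fun e => ?_
  rw [ContinuousMap.norm_le _ (by positivity)]
  rintro ⟨t, s⟩
  rw [volterra_apply]
  dsimp only
  rcases le_total (t : ℝ) s with h | h
  · rw [max_eq_left h]
    simp
  rw [max_eq_right h]
  have hb : ∀ r ∈ Ioc (s : ℝ) t, ‖volterraIntegrand (S.scale lam) hT G e (t, s) r‖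
      ≤ Real.exp (-lam * (t - r)) * (S.growthBound T * (L * ‖e‖)) := by
    intro r hr
    refine (norm_volterraIntegrand_le _ hT G e _ r).trans ?_
    have h0 : (0 : ℝ) ≤ t - r := sub_nonneg.2 hr.2
    have h1 : ‖(S.scale lam).ext (t - r)‖ ≤ Real.exp (-lam * (t - r)) * S.growthBound T := by
      refine ContinuousLinearMap.opNorm_le_bound _ (by positivity) fun x => ?_
      rw [S.scale_ext_of_nonneg lam h0, norm_smul, Real.norm_of_nonneg (Real.exp_nonneg _),
        mul_assoc]
      gcongr
      refine S.norm_ext_apply_le ?_ x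
      have := t.2.2
      have := s.2.1
      linarith [hr.1]
    calc ‖(S.scale lam).ext (t - r)‖ * (‖G‖ * ‖e‖)
        ≤ (Real.exp (-lam * (t - r)) * S.growthBound T) * (L * ‖e‖) := by gcongr
      _ = _ := by ring
  refine (intervalIntegral.norm_integral_le_of_norm_le h
    (Eventually.of_forall hb) (Continuous.intervalIntegrable (by fun_prop) _ _)).trans ?_
  have hL0 : 0 ≤ L := (norm_nonneg G).trans hG
  rw [intervalIntegral.integral_mul_const]
  calc (∫ r in (s : ℝ)..t, Real.exp (-lam * (t - r))) * (S.growthBound T * (L * ‖e‖))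
      ≤ 1 / lam * (S.growthBound T * (L * ‖e‖)) := by
        gcongr
        exact integral_exp_neg_mul_sub_le hlam s t
    _ = (S.growthBound T * L / lam) * ‖e‖ := by ring
    _ ≤ 1 / 2 * ‖e‖ := by
        refine mul_le_mul_of_nonneg_right ?_ (norm_nonneg e)
        rw [div_le_iff₀ hlam, hlamdef, C0Semigroup.rate, hL]
        linarith

section Inverse

variable {F : Type*} [NormedAddCommGroup F] [NormedSpace 𝕜 F]

lemma clm_unit_inv_apply (u : (F →L[𝕜] F)ˣ) (a : F) :
    (↑u⁻¹ : F →L[𝕜] F) ((u : F →L[𝕜] F) a) = a := by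
  change ((↑u⁻¹ : F →L[𝕜] F) * (u : F →L[𝕜] F)) a = a
  rw [u.inv_mul]; rfl

lemma clm_unit_apply_inv (u : (F →L[𝕜] F)ˣ) (a : F) :
    (u : F →L[𝕜] F) ((↑u⁻¹ : F →L[𝕜] F) a) = a :=
  clm_unit_inv_apply u⁻¹ a

variable [CompleteSpace F]

lemma isUnit_one_sub_clm {V : F →L[𝕜] F} (h : ‖V‖ < 1) : IsUnit (1 - V) :=
  isUnit_one_sub_of_norm_lt_one h

lemma continuous_inverse_clm {Z : Type*} [TopologicalSpace Z] {V : Z → F →L[𝕜] F}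
    (hV : Continuous V) (hu : ∀ z, IsUnit (V z)) : Continuous fun z => Ring.inverse (V z) := by
  rw [continuous_iff_continuousAt]
  intro z
  obtain ⟨u, hu⟩ := hu z
  have h2 : ContinuousAt Ring.inverse (V z) := by
    rw [← hu]; exact NormedRing.inverse_continuousAt u
  exact ContinuousAt.comp (f := V) h2 hV.continuousAt

end Inverse

/-- The weighted solution `(t, s) ↦ exp(-lam (t - s)) 𝔗(t, s) x` of the variation of constants
equation. -/
def weightedEvolution (S : C0Semigroup 𝕜 X) (hT : 0 ≤ T) (lam : ℝ)
    (G : C(Icc (0 : ℝ) T, X →L[𝕜] X)) : X →L[𝕜] C(Icc (0 : ℝ) T × Icc (0 : ℝ) T, X) :=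
  (Ring.inverse (1 - volterra (S.scale lam) hT G)) ∘L propagator (S.scale lam) T

lemma isUnit_one_sub_volterra (S : C0Semigroup 𝕜 X) (hT : 0 ≤ T) {L : ℝ}
    {G : C(Icc (0 : ℝ) T, X →L[𝕜] X)} (hG : ‖G‖ ≤ L) :
    IsUnit (1 - volterra (S.scale (S.rate T L)) hT G) :=
  isUnit_one_sub_clm ((norm_volterra_scale_le S hT hG).trans_lt one_half_lt_one)

/-- Both existence and uniqueness for the integral equation are contained in the invertibility of `1
- volterra`. The equation lives on the full square: below the diagonal, t < s, the Volterra term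
vanishes and the solution is constantly x. -/
lemma eq_weightedEvolution_iff (S : C0Semigroup 𝕜 X) (hT : 0 ≤ T) {L : ℝ}
    {G : C(Icc (0 : ℝ) T, X →L[𝕜] X)} (hG : ‖G‖ ≤ L) (x : X)
    (e : C(Icc (0 : ℝ) T × Icc (0 : ℝ) T, X)) :
    e = weightedEvolution S hT (S.rate T L) G x ↔
      e = propagator (S.scale (S.rate T L)) T x
        + volterra (S.scale (S.rate T L)) hT G e := by
  obtain ⟨u, hu⟩ := isUnit_one_sub_volterra S hT hG
  have hinv : weightedEvolution S hT (S.rate T L) G x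
      = (↑u⁻¹ : C(Icc (0 : ℝ) T × Icc (0 : ℝ) T, X) →L[𝕜] _)
        (propagator (S.scale (S.rate T L)) T x) := by
    rw [weightedEvolution, ← hu, Ring.inverse_unit]; rfl
  have h1 : ∀ a, (↑u⁻¹ : C(Icc (0 : ℝ) T × Icc (0 : ℝ) T, X) →L[𝕜] _)
      ((u : C(Icc (0 : ℝ) T × Icc (0 : ℝ) T, X) →L[𝕜] _) a) = a := fun a => by
    exact clm_unit_inv_apply u a
  have h2 : ∀ a, (u : C(Icc (0 : ℝ) T × Icc (0 : ℝ) T, X) →L[𝕜] _)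
      ((↑u⁻¹ : C(Icc (0 : ℝ) T × Icc (0 : ℝ) T, X) →L[𝕜] _) a) = a := fun a => by
    exact clm_unit_apply_inv u a
  have h3 : ∀ a, (u : C(Icc (0 : ℝ) T × Icc (0 : ℝ) T, X) →L[𝕜] _) a
      = a - volterra (S.scale (S.rate T L)) hT G a := fun a => by rw [hu]; rfl
  rw [hinv, ← sub_eq_iff_eq_add, ← h3]
  constructor
  · rintro rfl; exact h2 _
  · intro h; rw [← h, h1]

lemma norm_weightedEvolution_le (S : C0Semigroup 𝕜 X) (hT : 0 ≤ T) {L : ℝ}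
    {G : C(Icc (0 : ℝ) T, X →L[𝕜] X)} (hG : ‖G‖ ≤ L) (x : X) :
    ‖weightedEvolution S hT (S.rate T L) G x‖
      ≤ 2 * ((S.scale (S.rate T L)).growthBound T * ‖x‖) := by
  set e := weightedEvolution S hT (S.rate T L) G x with he
  have h := (eq_weightedEvolution_iff S hT hG x e).1 rfl
  have h1 : ‖e‖ ≤ (S.scale (S.rate T L)).growthBound T * ‖x‖ + 1 / 2 * ‖e‖ := by
    calc ‖e‖ ≤ ‖propagator (S.scale (S.rate T L)) T x‖
          + ‖volterra (S.scale (S.rate T L)) hT G e‖ := by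
            conv_lhs => rw [h]
            exact norm_add_le _ _
      _ ≤ _ := by
        gcongr
        · have hK := (S.scale (S.rate T L)).growthBound_pos T
          refine (ContinuousMap.norm_le _ (by positivity)).2 fun p => ?_
          refine C0Semigroup.norm_ext_apply_le _ ?_ x
          linarith [p.1.2.2, p.2.2.1]
        · exact ContinuousLinearMap.le_of_opNorm_le _ (norm_volterra_scale_le S hT hG) e
  linarith

/-- One rate serves every G with ‖G‖ ≤ L, so dependence on G is that of an inverse on a linear
expression in G, and inversion is norm continuous at units. -/
lemma continuous_weightedEvolution (S : C0Semigroup 𝕜 X) (hT : 0 ≤ T) {L : ℝ} {Z : Type*}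
    [TopologicalSpace Z] {G : Z → C(Icc (0 : ℝ) T, X →L[𝕜] X)} (hGc : Continuous G)
    (hG : ∀ z, ‖G z‖ ≤ L) :
    Continuous fun z => weightedEvolution S hT (S.rate T L) (G z) := by
  have h0 : Continuous fun z => volterra (S.scale (S.rate T L)) hT (G z) :=
    (volterra (S.scale (S.rate T L)) hT).continuous.comp hGc
  have h1 := continuous_inverse_clm (continuous_const.sub h0)
    fun z => isUnit_one_sub_volterra S hT (hG z)
  exact h1.clm_comp continuous_const

/-- The evolution operator generated by `A + G(·)` for continuous `G` with `‖G‖ ≤ L`. -/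
def evolution (S : C0Semigroup 𝕜 X) (hT : 0 ≤ T) (L : ℝ)
    (G : C(Icc (0 : ℝ) T, X →L[𝕜] X)) (t s : ℝ) : X →L[𝕜] X :=
  Real.exp (S.rate T L * (t - s)) •
    (ContinuousMap.evalCLM 𝕜 (projIcc 0 T hT t, projIcc 0 T hT s) ∘L
      weightedEvolution S hT (S.rate T L) G)

lemma evolution_apply (S : C0Semigroup 𝕜 X) (hT : 0 ≤ T) (L : ℝ)
    (G : C(Icc (0 : ℝ) T, X →L[𝕜] X)) (t s : ℝ) (x : X) :
    evolution S hT L G t s x = Real.exp (S.rate T L * (t - s)) •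
      weightedEvolution S hT (S.rate T L) G x (projIcc 0 T hT t, projIcc 0 T hT s) := rfl

lemma continuous_evolution_apply (S : C0Semigroup 𝕜 X) (hT : 0 ≤ T) {L : ℝ} {Z : Type*}
    [TopologicalSpace Z] {G : Z → C(Icc (0 : ℝ) T, X →L[𝕜] X)} (hGc : Continuous G)
    (hG : ∀ z, ‖G z‖ ≤ L) {t s : Z → ℝ} (ht : Continuous t) (hs : Continuous s) {x : Z → X}
    (hx : Continuous x) : Continuous fun z => evolution S hT L (G z) (t z) (s z) (x z) := by
  simp only [evolution_apply]
  refine Continuous.smul (by fun_prop) ?_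
  exact ((continuous_weightedEvolution S hT hGc hG).clm_apply hx).eval
    ((continuous_projIcc.comp ht).prodMk (continuous_projIcc.comp hs))

/-- An operator norm bound for the evolution operators of all `G` with `‖G‖ ≤ L`. -/
def evolutionBound (S : C0Semigroup 𝕜 X) (T L : ℝ) : ℝ :=
  Real.exp (S.rate T L * T) * (2 * (S.scale (S.rate T L)).growthBound T)

lemma evolutionBound_nonneg (S : C0Semigroup 𝕜 X) (T L : ℝ) : 0 ≤ evolutionBound S T L := by
  have := (S.scale (S.rate T L)).growthBound_pos T
  unfold evolutionBound
  positivity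

lemma norm_evolution_apply_le (S : C0Semigroup 𝕜 X) (hT : 0 ≤ T) {L : ℝ}
    {G : C(Icc (0 : ℝ) T, X →L[𝕜] X)} (hG : ‖G‖ ≤ L) {t s : ℝ} (hs : 0 ≤ s) (ht : t ≤ T) (x : X) :
    ‖evolution S hT L G t s x‖ ≤ evolutionBound S T L * ‖x‖ := by
  have hl := S.rate_pos T L
  rw [evolution_apply, norm_smul, Real.norm_of_nonneg (Real.exp_nonneg _), evolutionBound, mul_assoc]
  gcongr
  · linarith
  · rw [mul_assoc]
    exact ((weightedEvolution S hT (S.rate T L) G x).norm_coe_le_norm _).trans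
      (norm_weightedEvolution_le S hT hG x)

lemma evolution_eq_integral (S : C0Semigroup 𝕜 X) (hT : 0 ≤ T) {L : ℝ}
    {G : C(Icc (0 : ℝ) T, X →L[𝕜] X)} (hG : ‖G‖ ≤ L) (x : X) {s t : ℝ} (hs : 0 ≤ s) (hst : s ≤ t)
    (ht : t ≤ T) : evolution S hT L G t s x = S.ext (t - s) x
      + ∫ r in s..t, S.ext (t - r) (G (projIcc 0 T hT r) (evolution S hT L G r s x)) := by
  set lam := S.rate T L with hlam
  have hsI : s ∈ Icc 0 T := ⟨hs, hst.trans ht⟩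
  have htI : t ∈ Icc 0 T := ⟨hs.trans hst, ht⟩
  have h := (eq_weightedEvolution_iff S hT hG x _).1 rfl
  rw [← hlam] at h
  set e := weightedEvolution S hT lam G x with he
  have h1 := congrArg (fun f => f (⟨t, htI⟩, ⟨s, hsI⟩)) h
  simp only [ContinuousMap.add_apply, propagator_apply, volterra_apply, max_eq_right hst] at h1
  rw [evolution_apply, projIcc_of_mem hT htI, projIcc_of_mem hT hsI, ← he, ← hlam, h1, smul_add,
    S.scale_ext_of_nonneg lam (sub_nonneg.2 hst), smul_smul, ← Real.exp_add,
    ← intervalIntegral.integral_smul]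
  congr 1
  · simp
  · refine intervalIntegral.integral_congr fun r hr => ?_
    rw [uIcc_of_le hst] at hr
    have h2 : 0 ≤ t - r := sub_nonneg.2 hr.2
    simp only [volterraIntegrand]
    rw [S.scale_ext_of_nonneg lam h2, smul_smul, ← Real.exp_add, evolution_apply,
      projIcc_of_mem hT hsI, ← he, ← hlam, ContinuousLinearMap.map_smul_of_tower, ContinuousLinearMap.map_smul_of_tower]
    congr 2
    ring

lemma isEvolutionOperator_evolution (S : C0Semigroup 𝕜 X) (hT : 0 ≤ T) {L : ℝ}
    {G : C(Icc (0 : ℝ) T, X →L[𝕜] X)} (hG : ‖G‖ ≤ L) {G' : ℝ → X →L[𝕜] X}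
    (hG' : ∀ t (ht : t ∈ Icc 0 T), G' t = G ⟨t, ht⟩) :
    IsEvolutionOperator S T G' (evolution S hT L G) where
  continuousOn x := (continuous_evolution_apply S hT (Z := ℝ × ℝ) (G := fun _ => G)
    continuous_const (fun _ => hG) continuous_fst continuous_snd
    (continuous_const (y := x))).continuousOn
  eq_integral x s t hs hst ht := by
    rw [evolution_eq_integral S hT hG x hs hst ht, S.ext_of_nonneg (sub_nonneg.2 hst)]
    congr 1
    refine intervalIntegral.integral_congr fun r hr => ?_
    rw [uIcc_of_le hst] at hr
    have hrI : r ∈ Icc 0 T := ⟨hs.trans hr.1, hr.2.trans ht⟩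
    simp only [hG' r hrI, projIcc_of_mem hT hrI, S.ext_of_nonneg (sub_nonneg.2 hr.2)]

/-- After weighting and extension to the square, any evolution operator solves the same fixed point
equation, whose solution is unique. -/
lemma IsEvolutionOperator.eq_evolution {S : C0Semigroup 𝕜 X} (hT : 0 ≤ T) {L : ℝ}
    {G : C(Icc (0 : ℝ) T, X →L[𝕜] X)} (hG : ‖G‖ ≤ L) {G' : ℝ → X →L[𝕜] X}
    (hG' : ∀ t (ht : t ∈ Icc 0 T), G' t = G ⟨t, ht⟩) {E : ℝ → ℝ → X →L[𝕜] X}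
    (hE : IsEvolutionOperator S T G' E) {s t : ℝ} (hs : 0 ≤ s) (hst : s ≤ t) (ht : t ≤ T) :
    E t s = evolution S hT L G t s := by
  ext x
  set lam := S.rate T L with hlam
  have hmem : ∀ p : Icc (0 : ℝ) T × Icc (0 : ℝ) T,
      (max (p.1 : ℝ) p.2, (p.2 : ℝ)) ∈ {p : ℝ × ℝ | 0 ≤ p.2 ∧ p.2 ≤ p.1 ∧ p.1 ≤ T} :=
    fun p => ⟨p.2.2.1, le_max_right _ _, max_le p.1.2.2 p.2.2.2⟩
  -- Replacing t by max t s extends E below the diagonal by E(s,s)x = x, in agreement with the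
  -- propagator there.
  let e : C(Icc (0 : ℝ) T × Icc (0 : ℝ) T, X) :=
    ⟨fun p => Real.exp (-lam * (max (p.1 : ℝ) p.2 - p.2)) • E (max (p.1 : ℝ) p.2) p.2 x, by
      refine Continuous.smul (by fun_prop) ?_
      exact (hE.continuousOn x).comp_continuous (f := fun p : Icc (0 : ℝ) T × Icc (0 : ℝ) T =>
        (max (p.1 : ℝ) p.2, (p.2 : ℝ))) (by fun_prop) hmem⟩
  have he : e = weightedEvolution S hT lam G x := by
    rw [eq_weightedEvolution_iff S hT hG x, ← hlam]
    ext ⟨t, s⟩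
    rw [ContinuousMap.add_apply, propagator_apply, volterra_apply]
    change Real.exp (-lam * (max (t : ℝ) s - s)) • E (max (t : ℝ) s) s x = _
    dsimp only
    rcases le_total (t : ℝ) s with h | h
    · rw [max_eq_right h, max_eq_left h, hE.eq_integral x s s s.2.1 le_rfl s.2.2,
        C0Semigroup.ext, max_eq_right (sub_nonpos.2 h)]
      simp [C0Semigroup.op_zero]
    · rw [max_eq_left h, max_eq_right h, hE.eq_integral x s t s.2.1 h t.2.2, smul_add,
        S.scale_ext_of_nonneg lam (sub_nonneg.2 h), ← S.ext_of_nonneg (sub_nonneg.2 h),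
        ← intervalIntegral.integral_smul]
      congr 1
      refine intervalIntegral.integral_congr fun r hr => ?_
      rw [uIcc_of_le h] at hr
      have hrI : r ∈ Icc 0 T := ⟨s.2.1.trans hr.1, hr.2.trans t.2.2⟩
      simp only [volterraIntegrand]
      rw [S.scale_ext_of_nonneg lam (sub_nonneg.2 hr.2), projIcc_of_mem hT hrI, hG' r hrI,
        ← S.ext_of_nonneg (sub_nonneg.2 hr.2)]
      change _ = _ • S.ext (t - r) (G ⟨r, hrI⟩
        (Real.exp (-lam * (max r (s : ℝ) - s)) • E (max r (s : ℝ)) s x))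
      rw [max_eq_left hr.1, ContinuousLinearMap.map_smul_of_tower, ContinuousLinearMap.map_smul_of_tower, smul_smul, ← Real.exp_add]
      congr 2
      ring
  have hsI : s ∈ Icc 0 T := ⟨hs, hst.trans ht⟩
  have htI : t ∈ Icc 0 T := ⟨hs.trans hst, ht⟩
  rw [evolution_apply, ← hlam, ← he, projIcc_of_mem hT htI, projIcc_of_mem hT hsI]
  change _ = _ • Real.exp (-lam * (max t s - s)) • E (max t s) s x
  rw [max_eq_left hst, smul_smul, ← Real.exp_add]
  simp

/-- The choice made by `Classical.epsilon` is meaningful once one evolution operator has been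
constructed. -/
lemma isEvolutionOperator_evolutionOperator (S : C0Semigroup 𝕜 X) (hT : 0 ≤ T)
    {G : C(Icc (0 : ℝ) T, X →L[𝕜] X)} {G' : ℝ → X →L[𝕜] X}
    (hG' : ∀ t (ht : t ∈ Icc 0 T), G' t = G ⟨t, ht⟩) :
    IsEvolutionOperator S T G' (evolutionOperator S T G') :=
  Classical.epsilon_spec ⟨_, isEvolutionOperator_evolution S hT le_rfl hG'⟩

end Volterra

/-! ### Fubini on a triangle, duality and variation of constants -/

/-- The Fubini theorem on a triangle. -/
lemma intervalIntegral_triangle_swap {F : Type*} [NormedAddCommGroup F] [NormedSpace ℝ F]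
    {a b : ℝ} (hab : a ≤ b) {H : ℝ → ℝ → F}
    (hH : Integrable (Function.uncurry H)
      ((volume.restrict (Ioc a b)).prod (volume.restrict (Ioc a b)))) :
    IntervalIntegrable (fun r => ∫ s in a..r, H r s) volume a b ∧
      IntervalIntegrable (fun s => ∫ r in s..b, H r s) volume a b ∧
      ∫ r in a..b, ∫ s in a..r, H r s = ∫ s in a..b, ∫ r in s..b, H r s := by
  have hΔ : MeasurableSet {p : ℝ × ℝ | p.2 ≤ p.1} := measurableSet_le measurable_snd measurable_fst
  have hswap := integral_integral_swap
    (f := fun r s => {p : ℝ × ℝ | p.2 ≤ p.1}.indicator (Function.uncurry H) (r, s))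
    (hH.indicator hΔ)
  have hl := (hH.indicator hΔ).integral_prod_left
  have hr := (hH.indicator hΔ).integral_prod_right
  rw [intervalIntegral.integral_of_le hab, intervalIntegral.integral_of_le hab,
    intervalIntegrable_iff_integrableOn_Ioc_of_le hab,
    intervalIntegrable_iff_integrableOn_Ioc_of_le hab]
  have e1 : ∀ r ∈ Ioc a b, ∫ s in a..r, H r s
      = ∫ s in Ioc a b, {p : ℝ × ℝ | p.2 ≤ p.1}.indicator (Function.uncurry H) (r, s) := by
    intro r hr
    have e : (fun s => {p : ℝ × ℝ | p.2 ≤ p.1}.indicator (Function.uncurry H) (r, s))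
        = (Iic r).indicator (H r) := rfl
    rw [e, setIntegral_indicator measurableSet_Iic, intervalIntegral.integral_of_le hr.1.le,
      Ioc_inter_Iic, min_eq_right hr.2]
  have e2 : ∀ s ∈ Ioc a b, ∫ r in s..b, H r s
      = ∫ r in Ioc a b, {p : ℝ × ℝ | p.2 ≤ p.1}.indicator (Function.uncurry H) (r, s) := by
    intro s hs
    have e : (fun r => {p : ℝ × ℝ | p.2 ≤ p.1}.indicator (Function.uncurry H) (r, s))
        = (Ici s).indicator (fun r => H r s) := rfl
    have e3 : Ioc a b ∩ Ici s = Icc s b := by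
      ext r
      simp only [mem_inter_iff, mem_Ioc, mem_Ici, mem_Icc]
      constructor
      · rintro ⟨⟨_, h⟩, h'⟩; exact ⟨h', h⟩
      · rintro ⟨h, h'⟩; exact ⟨⟨hs.1.trans_le h, h'⟩, h⟩
    rw [e, setIntegral_indicator measurableSet_Ici, e3, integral_Icc_eq_integral_Ioc,
      intervalIntegral.integral_of_le hs.2]
  refine ⟨(integrableOn_congr_fun e1 measurableSet_Ioc).2 hl,
    (integrableOn_congr_fun e2 measurableSet_Ioc).2 hr, ?_⟩
  rw [setIntegral_congr_fun measurableSet_Ioc e1, setIntegral_congr_fun measurableSet_Ioc e2, hswap]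

lemma integrable_prod_of_continuous {F : Type*} [NormedAddCommGroup F] {H : ℝ × ℝ → F}
    (hH : Continuous H) (a b : ℝ) :
    Integrable H ((volume.restrict (Ioc a b)).prod (volume.restrict (Ioc a b))) := by
  rw [Measure.prod_restrict]
  have h : IntegrableOn H (Icc a b ×ˢ Icc a b) (volume.prod volume) :=
    hH.continuousOn.integrableOn_compact (isCompact_Icc.prod isCompact_Icc)
  exact h.mono_set (prod_mono Ioc_subset_Icc_self Ioc_subset_Icc_self)

section Duality

set_option linter.unusedSectionVars false

variable {𝕜 X : Type*} [RCLike 𝕜]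
  [NormedAddCommGroup X] [InnerProductSpace 𝕜 X] [CompleteSpace X]
  [NormedSpace ℝ X] [IsScalarTower ℝ 𝕜 X]

lemma inner_intervalIntegral_right {f : ℝ → X} {a b : ℝ} (hf : IntervalIntegrable f volume a b)
    (c : X) : inner 𝕜 c (∫ s in a..b, f s) = ∫ s in a..b, inner 𝕜 c (f s) :=
  ((innerSL 𝕜 c).intervalIntegral_comp_comm hf).symm

lemma inner_intervalIntegral_left {f : ℝ → X} {a b : ℝ} (hf : IntervalIntegrable f volume a b)
    (c : X) : inner 𝕜 (∫ s in a..b, f s) c = ∫ s in a..b, inner 𝕜 (f s) c := by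
  rw [← inner_conj_symm, inner_intervalIntegral_right hf, intervalIntegral.intervalIntegral_eq_integral_uIoc,
    intervalIntegral.intervalIntegral_eq_integral_uIoc]
  simp only [RCLike.real_smul_eq_coe_mul, map_mul, RCLike.conj_ofReal, ← integral_conj,
    inner_conj_symm]

lemma C0Semigroup.aestronglyMeasurable_ext_apply (S : C0Semigroup 𝕜 X) {α : Type*}
    [MeasurableSpace α] {μ : Measure α} {a : α → ℝ} {w : α → X} (ha : AEStronglyMeasurable a μ)
    (hw : AEStronglyMeasurable w μ) : AEStronglyMeasurable (fun z => S.ext (a z) (w z)) μ :=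
  S.continuous_ext_uncurry.comp_aestronglyMeasurable (ha.prodMk hw)

lemma C0Semigroup.intervalIntegrable_ext_sub (S : C0Semigroup 𝕜 X) {w : ℝ → X} {a b : ℝ}
    (hw : IntervalIntegrable w volume a b) (t : ℝ) :
    IntervalIntegrable (fun r => S.ext (t - r) (w r)) volume a b := by
  rw [intervalIntegrable_iff] at hw ⊢
  refine (hw.norm.const_mul (S.growthBound (t - min a b))).mono'
    (S.aestronglyMeasurable_ext_apply (by fun_prop) hw.aestronglyMeasurable) ?_
  filter_upwards [ae_restrict_mem measurableSet_uIoc] with r hr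
  exact S.norm_ext_apply_le (by have := hr.1; linarith) _

lemma C0Semigroup.intervalIntegrable_ext_sub' (S : C0Semigroup 𝕜 X) {w : ℝ → X} {a b : ℝ}
    (hw : IntervalIntegrable w volume a b) (t : ℝ) :
    IntervalIntegrable (fun r => S.ext (r - t) (w r)) volume a b := by
  rw [intervalIntegrable_iff] at hw ⊢
  refine (hw.norm.const_mul (S.growthBound (max a b - t))).mono'
    (S.aestronglyMeasurable_ext_apply (by fun_prop) hw.aestronglyMeasurable) ?_
  filter_upwards [ae_restrict_mem measurableSet_uIoc] with r hr
  exact S.norm_ext_apply_le (by have := hr.2; linarith) _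

lemma intervalIntegrable_inner_of_bound {f g : ℝ → X} {a b C : ℝ}
    (hf : IntervalIntegrable f volume a b)
    (hg : AEStronglyMeasurable g (volume.restrict (uIoc a b)))
    (hC : ∀ r ∈ uIoc a b, ‖g r‖ ≤ C) :
    IntervalIntegrable (fun r => inner 𝕜 (f r) (g r)) volume a b := by
  rw [intervalIntegrable_iff] at hf ⊢
  refine (hf.norm.mul_const C).mono' (hf.aestronglyMeasurable.inner hg) ?_
  filter_upwards [ae_restrict_mem measurableSet_uIoc] with r hr
  exact (norm_inner_le_norm _ _).trans (by gcongr; exact hC r hr)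

/-- Integration by parts between a mild solution and a mild solution of the adjoint equation. -/
theorem mild_duality {S : C0Semigroup 𝕜 X} (hS : S.IsCompactSemigroup) {a b : ℝ} (hab : a ≤ b)
    {w Q y P : ℝ → X} {v x : X} (hw : IntervalIntegrable w volume a b)
    (hQ : IntervalIntegrable Q volume a b)
    (hy : ∀ r ∈ Icc a b, y r = S.ext (r - a) v + ∫ q in a..r, S.ext (r - q) (w q))
    (hP : ∀ r ∈ Icc a b, P r = (S.adj hS).ext (b - r) x
      + ∫ q in r..b, (S.adj hS).ext (q - r) (Q q)) :
    inner 𝕜 x (y b) + ∫ r in a..b, inner 𝕜 (Q r) (y r)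
      = inner 𝕜 (P a) v + ∫ r in a..b, inner 𝕜 (P r) (w r) := by
  have hadj : ∀ (t : ℝ) (p q : X), inner 𝕜 ((S.adj hS).ext t p) q = inner 𝕜 p (S.ext t q) :=
    fun t p q => ContinuousLinearMap.adjoint_inner_left (S.ext t) q p
  have hwm := (intervalIntegrable_iff_integrableOn_Ioc_of_le hab).1 hw
  have hQm := (intervalIntegrable_iff_integrableOn_Ioc_of_le hab).1 hQ
  have hHint : Integrable (Function.uncurry fun r s => inner 𝕜 (Q r) (S.ext (r - s) (w s)))
      ((volume.restrict (Ioc a b)).prod (volume.restrict (Ioc a b))) := by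
    refine ((hQm.norm.mul_prod hwm.norm).const_mul (S.growthBound (b - a))).mono' ?_ ?_
    · exact hQm.aestronglyMeasurable.comp_fst.inner
        (S.aestronglyMeasurable_ext_apply (by fun_prop) hwm.aestronglyMeasurable.comp_snd)
    · rw [Measure.prod_restrict]
      filter_upwards [ae_restrict_mem (measurableSet_Ioc.prod measurableSet_Ioc)] with p hp
      calc ‖inner 𝕜 (Q p.1) (S.ext (p.1 - p.2) (w p.2))‖
          ≤ ‖Q p.1‖ * ‖S.ext (p.1 - p.2) (w p.2)‖ := norm_inner_le_norm _ _
        _ ≤ ‖Q p.1‖ * (S.growthBound (b - a) * ‖w p.2‖) := by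
          gcongr
          refine S.norm_ext_apply_le ?_ _
          linarith [hp.1.2, hp.2.1]
        _ = _ := by ring
  have hsub : ∀ {c d : ℝ}, a ≤ c → c ≤ d → d ≤ b → uIcc c d ⊆ uIcc a b := fun h1 h2 h3 => by
    rw [uIcc_of_le h2, uIcc_of_le hab]; exact Icc_subset_Icc h1 h3
  have hSv : Continuous fun r => S.ext (r - a) v :=
    S.continuous_ext_apply (by fun_prop) continuous_const
  have hSx : Continuous fun r => (S.adj hS).ext (b - r) x :=
    (S.adj hS).continuous_ext_apply (by fun_prop) continuous_const
  have i1 : IntervalIntegrable (fun r => inner 𝕜 (Q r) (S.ext (r - a) v)) volume a b := by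
    refine intervalIntegrable_inner_of_bound (C := S.growthBound (b - a) * ‖v‖) hQ
      hSv.aestronglyMeasurable fun r hr => ?_
    rw [uIoc_of_le hab] at hr
    exact S.norm_ext_apply_le (by linarith [hr.2]) _
  have i2 : IntervalIntegrable (fun r => inner 𝕜 ((S.adj hS).ext (b - r) x) (w r)) volume a b := by
    simp only [hadj]
    have := S.intervalIntegrable_ext_sub hw b
    rw [intervalIntegrable_iff] at this ⊢
    exact (innerSL 𝕜 x).integrable_comp this
  -- After inserting both mild formulas, the terms in v and x match by adjointness of the
  -- semigroups, and the remaining double integrals agree by exchanging the order on the triangle.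
  -- No differentiability is used, only integrability of w and Q.
  obtain ⟨i3, i4, hswap⟩ := intervalIntegral_triangle_swap hab hHint
  have eQ : ∫ r in a..b, inner 𝕜 (Q r) (y r) = (∫ r in a..b, inner 𝕜 (Q r) (S.ext (r - a) v))
      + ∫ r in a..b, ∫ s in a..r, inner 𝕜 (Q r) (S.ext (r - s) (w s)) := by
    rw [← intervalIntegral.integral_add i1 i3]
    refine intervalIntegral.integral_congr fun r hr => ?_
    rw [uIcc_of_le hab] at hr
    rw [hy r hr, inner_add_right, inner_intervalIntegral_right
      (S.intervalIntegrable_ext_sub (hw.mono_set (hsub le_rfl hr.1 hr.2)) r)]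
  have eP : ∫ r in a..b, inner 𝕜 (P r) (w r)
      = (∫ r in a..b, inner 𝕜 ((S.adj hS).ext (b - r) x) (w r))
        + ∫ s in a..b, ∫ r in s..b, inner 𝕜 (Q r) (S.ext (r - s) (w s)) := by
    rw [← intervalIntegral.integral_add i2 i4]
    refine intervalIntegral.integral_congr fun r hr => ?_
    rw [uIcc_of_le hab] at hr
    rw [hP r hr, inner_add_left, inner_intervalIntegral_left
      ((S.adj hS).intervalIntegrable_ext_sub' (hQ.mono_set (hsub hr.1 hr.2 le_rfl)) r)]
    simp only [hadj]
  have ey : inner 𝕜 x (y b) = inner 𝕜 x (S.ext (b - a) v)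
      + ∫ r in a..b, inner 𝕜 ((S.adj hS).ext (b - r) x) (w r) := by
    rw [hy b (right_mem_Icc.2 hab), inner_add_right,
      inner_intervalIntegral_right (S.intervalIntegrable_ext_sub hw b)]
    simp only [hadj]
  have eP0 : inner 𝕜 (P a) v = inner 𝕜 x (S.ext (b - a) v)
      + ∫ r in a..b, inner 𝕜 (Q r) (S.ext (r - a) v) := by
    rw [hP a (left_mem_Icc.2 hab), inner_add_left,
      inner_intervalIntegral_left ((S.adj hS).intervalIntegrable_ext_sub' hQ a)]
    simp only [hadj]
  rw [eQ, eP, ey, eP0, hswap]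
  ring

variable {T : ℝ}

/-- The reflection `τ ↦ T - τ` of `[0, T]`. -/
def reflect (τ : Icc (0 : ℝ) T) : Icc (0 : ℝ) T :=
  ⟨T - τ, sub_nonneg.2 τ.2.2, sub_le_self _ τ.2.1⟩

lemma continuous_reflect : Continuous (reflect : Icc (0 : ℝ) T → Icc (0 : ℝ) T) := by
  unfold reflect
  fun_prop

/-- The family `τ ↦ G(T - τ)*`. -/
def adjointReversed (G : C(Icc (0 : ℝ) T, X →L[𝕜] X)) : C(Icc (0 : ℝ) T, X →L[𝕜] X) where
  toFun τ := ContinuousLinearMap.adjoint (G (reflect τ))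
  continuous_toFun := (ContinuousLinearMap.adjoint (𝕜 := 𝕜) (E := X) (F := X)).continuous.comp
    (G.continuous.comp continuous_reflect)

lemma adjointReversed_apply (G : C(Icc (0 : ℝ) T, X →L[𝕜] X)) (τ : Icc (0 : ℝ) T) :
    adjointReversed G τ = ContinuousLinearMap.adjoint (G (reflect τ)) := rfl

lemma norm_adjointReversed_le {G : C(Icc (0 : ℝ) T, X →L[𝕜] X)} {L : ℝ} (hG : ‖G‖ ≤ L) :
    ‖adjointReversed G‖ ≤ L := by
  refine (ContinuousMap.norm_le _ ((norm_nonneg G).trans hG)).2 fun τ => ?_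
  rw [adjointReversed_apply, LinearIsometryEquiv.norm_map]
  exact (G.norm_coe_le_norm _).trans hG

lemma continuous_adjointReversed {Z : Type*} [TopologicalSpace Z]
    {G : Z → C(Icc (0 : ℝ) T, X →L[𝕜] X)} (hG : Continuous G) :
    Continuous fun z => adjointReversed (G z) := by
  refine ContinuousMap.continuous_of_continuous_uncurry _ ?_
  refine (ContinuousLinearMap.adjoint (𝕜 := 𝕜) (E := X) (F := X)).continuous.comp ?_
  exact (hG.comp continuous_fst).eval (continuous_reflect.comp continuous_snd)

/-- The adjoint of the evolution operator is an evolution operator of the adjoint semigroup in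
reversed time. -/
theorem adjoint_evolution {S : C0Semigroup 𝕜 X} (hS : S.IsCompactSemigroup) (hT : 0 ≤ T) {L : ℝ}
    {G : C(Icc (0 : ℝ) T, X →L[𝕜] X)} (hG : ‖G‖ ≤ L) {s t : ℝ} (hs : 0 ≤ s) (hst : s ≤ t)
    (ht : t ≤ T) (x : X) :
    ContinuousLinearMap.adjoint (evolution S hT L G t s) x
      = evolution (S.adj hS) hT L (adjointReversed G) (T - s) (T - t) x := by
  refine ext_inner_right 𝕜 fun v => ?_
  rw [ContinuousLinearMap.adjoint_inner_left]
  set y : ℝ → X := fun r => evolution S hT L G r s v with hy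
  set P : ℝ → X := fun r => evolution (S.adj hS) hT L (adjointReversed G) (T - r) (T - t) x with hP
  have hyc : Continuous y := continuous_evolution_apply S hT continuous_const (fun _ => hG)
    continuous_id continuous_const continuous_const
  have hPc : Continuous P := continuous_evolution_apply (S.adj hS) hT continuous_const
    (fun _ => norm_adjointReversed_le hG) (by fun_prop) continuous_const continuous_const
  have hGc : Continuous fun r => G (projIcc 0 T hT r) := G.continuous.comp continuous_projIcc
  have hw : Continuous fun r => G (projIcc 0 T hT r) (y r) := hGc.clm_apply hyc
  have hQ : Continuous fun r => ContinuousLinearMap.adjoint (G (projIcc 0 T hT r)) (P r) :=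
    ((ContinuousLinearMap.adjoint (𝕜 := 𝕜) (E := X) (F := X)).continuous.comp hGc).clm_apply hPc
  -- With w = G y and Q = G*P the two integral terms of the duality identity coincide and cancel,
  -- leaving exactly the adjoint relation.
  have key := mild_duality hS hst (hw.intervalIntegrable s t) (hQ.intervalIntegrable s t)
    (y := y) (P := P) (v := v) (x := x)
    (fun r hr => evolution_eq_integral S hT hG v hs hr.1 (hr.2.trans ht))
    (fun r hr => by
      have h := evolution_eq_integral (S.adj hS) hT (norm_adjointReversed_le hG) x
        (s := T - t) (t := T - r) (by linarith) (by linarith [hr.2]) (by linarith [hr.1])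
      simp only [hP]
      rw [h, show T - r - (T - t) = t - r by ring, ← intervalIntegral.integral_comp_sub_left]
      congr 1
      refine intervalIntegral.integral_congr fun q hq => ?_
      rw [uIcc_of_le hr.2] at hq
      have hqI : q ∈ Icc 0 T := ⟨hs.trans (hr.1.trans hq.1), hq.2.trans ht⟩
      have hqI' : T - q ∈ Icc 0 T := ⟨sub_nonneg.2 hqI.2, sub_le_self _ hqI.1⟩
      have e1 : reflect ⟨T - q, hqI'⟩ = ⟨q, hqI⟩ := Subtype.ext (sub_sub_cancel T q)
      rw [projIcc_of_mem hT hqI, projIcc_of_mem hT hqI', adjointReversed_apply, e1,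
        show T - r - (T - q) = q - r by ring])
  simp only [ContinuousLinearMap.adjoint_inner_left] at key
  exact add_right_cancel key

/-- Variation of constants: the solution formula in terms of the evolution operator yields a mild
solution. -/
theorem evolution_mild_equation (S : C0Semigroup 𝕜 X) (hT : 0 ≤ T) {L : ℝ}
    {G : C(Icc (0 : ℝ) T, X →L[𝕜] X)} (hG : ‖G‖ ≤ L) (x₀ : X) {w : ℝ → X} (hw : Continuous w)
    {y : ℝ → X} (hy : ∀ t ∈ Icc 0 T, y t = evolution S hT L G t 0 x₀
      + ∫ s in (0 : ℝ)..t, evolution S hT L G t s (w s)) {t : ℝ} (ht : t ∈ Icc 0 T) :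
    y t = S.ext t x₀ + ∫ r in (0 : ℝ)..t, S.ext (t - r) (w r + G (projIcc 0 T hT r) (y r)) := by
  have hGc : Continuous fun r => G (projIcc 0 T hT r) := G.continuous.comp continuous_projIcc
  have hEc : Continuous fun p : ℝ × ℝ => evolution S hT L G p.1 p.2 (w p.2) :=
    continuous_evolution_apply S hT continuous_const (fun _ => hG) continuous_fst continuous_snd
      (hw.comp continuous_snd)
  have hE0c : Continuous fun r => evolution S hT L G r 0 x₀ :=
    continuous_evolution_apply S hT continuous_const (fun _ => hG) continuous_id continuous_const
      continuous_const
  set H : ℝ → ℝ → X := fun r s =>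
    S.ext (t - r) (G (projIcc 0 T hT r) (evolution S hT L G r s (w s))) with hH
  have hHc : Continuous (Function.uncurry H) :=
    S.continuous_ext_apply (by fun_prop) ((hGc.comp continuous_fst).clm_apply hEc)
  obtain ⟨i3, -, hswap⟩ := intervalIntegral_triangle_swap ht.1
    (integrable_prod_of_continuous hHc 0 t)
  have hwi : Continuous fun r => S.ext (t - r) (w r) := S.continuous_ext_apply (by fun_prop) hw
  have h0i : Continuous fun r => S.ext (t - r) (G (projIcc 0 T hT r) (evolution S hT L G r 0 x₀)) :=
    S.continuous_ext_apply (by fun_prop) (hGc.clm_apply hE0c)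
  have e1 : ∀ r ∈ uIcc 0 t, S.ext (t - r) (w r + G (projIcc 0 T hT r) (y r))
      = S.ext (t - r) (w r) + (S.ext (t - r) (G (projIcc 0 T hT r) (evolution S hT L G r 0 x₀))
        + ∫ s in (0 : ℝ)..r, H r s) := by
    intro r hr
    rw [uIcc_of_le ht.1] at hr
    have hInt : IntervalIntegrable (fun s => evolution S hT L G r s (w s)) volume 0 r :=
      (hEc.comp (Continuous.prodMk_right r)).intervalIntegrable 0 r
    have e : ∫ s in (0 : ℝ)..r, H r s = S.ext (t - r) (G (projIcc 0 T hT r)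
        (∫ s in (0 : ℝ)..r, evolution S hT L G r s (w s))) := by
      rw [← ContinuousLinearMap.comp_apply, ← ContinuousLinearMap.intervalIntegral_comp_comm _ hInt]
      rfl
    rw [e, hy r ⟨hr.1, hr.2.trans ht.2⟩]
    simp only [map_add]
  -- After exchanging the integrals, the inner one is the integral term in the equation of
  -- 𝔗(t,s)w(s); subtracting S(t-s)w(s) cancels the direct contribution of w.
  have e2 : ∀ s ∈ uIcc 0 t, ∫ r in s..t, H r s
      = evolution S hT L G t s (w s) - S.ext (t - s) (w s) := by
    intro s hs
    rw [uIcc_of_le ht.1] at hs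
    rw [evolution_eq_integral S hT hG (w s) hs.1 hs.2 ht.2, add_sub_cancel_left]
  have e3 := evolution_eq_integral S hT hG x₀ le_rfl ht.1 ht.2
  rw [sub_zero] at e3
  have hEi : IntervalIntegrable (fun s => evolution S hT L G t s (w s)) volume 0 t :=
    (hEc.comp (Continuous.prodMk_right t)).intervalIntegrable 0 t
  rw [intervalIntegral.integral_congr e1, intervalIntegral.integral_add (hwi.intervalIntegrable 0 t)
    ((h0i.intervalIntegrable 0 t).add i3), intervalIntegral.integral_add (h0i.intervalIntegrable 0 t)
    i3, hswap, intervalIntegral.integral_congr e2, intervalIntegral.integral_sub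
    hEi (hwi.intervalIntegrable 0 t), hy t ht, e3]
  abel

end Duality

/-! ### Compactness of the Duhamel map -/

section Compactness

set_option linter.unusedSectionVars false

variable {𝕜 X : Type*} [RCLike 𝕜]
  [NormedAddCommGroup X] [InnerProductSpace 𝕜 X] [CompleteSpace X]
  [NormedSpace ℝ X] [IsScalarTower ℝ 𝕜 X]

/-- The mild solution `∫₀ᵗ S(t - s) w(s) ds` of the inhomogeneous equation with zero initial
value. -/
def duhamel (S : C0Semigroup 𝕜 X) (w : ℝ → X) (t : ℝ) : X :=
  ∫ s in (0 : ℝ)..t, S.ext (t - s) (w s)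

lemma continuous_duhamel (S : C0Semigroup 𝕜 X) {w : ℝ → X} (hw : Continuous w) :
    Continuous (duhamel S w) :=
  intervalIntegral.continuous_parametric_intervalIntegral_of_continuous
    (f := fun t s => S.ext (t - s) (w s))
    (S.continuous_ext_apply (by fun_prop) (hw.comp continuous_snd)) continuous_id

lemma duhamel_split (S : C0Semigroup 𝕜 X) {w : ℝ → X} (hw : Continuous w) {t' t : ℝ}
    (h0 : 0 ≤ t') (h : t' ≤ t) : duhamel S w t
      = S.ext (t - t') (duhamel S w t') + ∫ s in t'..t, S.ext (t - s) (w s) := by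
  have hc : ∀ t, Continuous fun s => S.ext (t - s) (w s) := fun t =>
    S.continuous_ext_apply (by fun_prop) hw
  rw [duhamel, ← intervalIntegral.integral_add_adjacent_intervals
    ((hc t).intervalIntegrable 0 t') ((hc t).intervalIntegrable t' t), duhamel,
    ← ContinuousLinearMap.intervalIntegral_comp_comm _ ((hc t').intervalIntegrable 0 t')]
  congr 1
  refine intervalIntegral.integral_congr fun s hs => ?_
  rw [uIcc_of_le h0] at hs
  rw [← S.ext_add_apply (sub_nonneg.2 h) (sub_nonneg.2 hs.2), sub_add_sub_cancel]

lemma norm_integral_ext_le (S : C0Semigroup 𝕜 X) {w : ℝ → X} {T R a t : ℝ}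
    (hw : ∀ s ∈ Icc 0 T, ‖w s‖ ≤ R) (ha : 0 ≤ a) (hat : a ≤ t) (ht : t ≤ T) :
    ‖∫ s in a..t, S.ext (t - s) (w s)‖ ≤ S.growthBound T * R * (t - a) := by
  have hK := S.growthBound_pos T
  have h := intervalIntegral.norm_integral_le_of_norm_le_const (a := a) (b := t)
    (f := fun s => S.ext (t - s) (w s)) (C := S.growthBound T * R) fun s hs => by
      rw [uIoc_of_le hat] at hs
      refine (S.norm_ext_apply_le (T := T) (by linarith [hs.1]) _).trans ?_
      gcongr
      exact hw s ⟨ha.trans hs.1.le, hs.2.trans ht⟩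
  rwa [abs_of_nonneg (sub_nonneg.2 hat)] at h

/-- Up to the last time interval of length δ, whose contribution is at most K R δ, the value at t is
S(δ) applied to a vector of norm at most K R T, and S(δ) is compact. When t ≤ δ the whole value is
small. -/
lemma totallyBounded_duhamel {S : C0Semigroup 𝕜 X} (hS : S.IsCompactSemigroup) {T R : ℝ}
    (hT : 0 ≤ T) (hR : 0 ≤ R) :
    TotallyBounded {v : X | ∃ w : ℝ → X, Continuous w ∧ (∀ s ∈ Icc 0 T, ‖w s‖ ≤ R) ∧
      ∃ t ∈ Icc 0 T, v = duhamel S w t} := by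
  have hK := S.growthBound_pos T
  set K := S.growthBound T with hKdef
  rw [Metric.totallyBounded_iff]
  intro ε hε
  obtain ⟨δ, hδ, hδε⟩ : ∃ δ > 0, K * R * δ < ε / 2 := by
    refine ⟨ε / 2 / (K * R + 1), by positivity, ?_⟩
    rw [← mul_div_assoc, div_lt_iff₀ (by positivity)]
    nlinarith [mul_nonneg hK.le hR]
  have hC : TotallyBounded (S.ext δ '' Metric.closedBall (0 : X) (K * R * T)) := by
    have h := hS δ hδ
    rw [← S.ext_of_nonneg hδ.le] at h
    exact (h.isCompact_closure_image_closedBall (f := (S.ext δ : X →ₗ[𝕜] X))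
      (K * R * T)).totallyBounded.subset subset_closure
  obtain ⟨N, hN, hcov⟩ := Metric.totallyBounded_iff.1 hC (ε / 2) (by positivity)
  refine ⟨N, hN, ?_⟩
  rintro _ ⟨w, hw, hwR, t, ht, rfl⟩
  obtain ⟨b, hb, hbt⟩ : ∃ b ∈ Metric.closedBall (0 : X) (K * R * T),
      ‖duhamel S w t - S.ext δ b‖ < ε / 2 := by
    rcases le_total t δ with h | h
    · refine ⟨0, by simp; positivity, ?_⟩
      have h1 := norm_integral_ext_le S hwR le_rfl ht.1 ht.2
      rw [map_zero, sub_zero, duhamel]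
      refine h1.trans_lt (lt_of_le_of_lt ?_ hδε)
      rw [← hKdef, sub_zero]
      gcongr
    · have h0 : 0 ≤ t - δ := sub_nonneg.2 h
      have hle : t - δ ≤ T := by linarith [ht.2]
      refine ⟨duhamel S w (t - δ), ?_, ?_⟩
      · rw [mem_closedBall_zero_iff]
        refine (norm_integral_ext_le S hwR le_rfl h0 hle).trans ?_
        rw [← hKdef, sub_zero]
        gcongr
      · rw [duhamel_split S hw h0 (by linarith : t - δ ≤ t), sub_sub_cancel, add_sub_cancel_left]
        refine (norm_integral_ext_le S hwR h0 (by linarith) ht.2).trans_lt ?_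
        rwa [sub_sub_cancel]
  obtain ⟨c, hc, hbc⟩ := mem_iUnion₂.1 (hcov (mem_image_of_mem _ hb))
  refine mem_iUnion₂.2 ⟨c, hc, ?_⟩
  rw [Metric.mem_ball, dist_eq_norm] at hbc ⊢
  calc ‖duhamel S w t - c‖ ≤ ‖duhamel S w t - S.ext δ b‖ + ‖S.ext δ b - c‖ :=
        norm_sub_le_norm_sub_add_norm_sub _ _ _
    _ < ε / 2 + ε / 2 := add_lt_add hbt hbc
    _ = ε := add_halves ε

/-- Mild solutions with uniformly bounded inhomogeneities form a relatively compact set. -/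
theorem exists_compact_duhamel {S : C0Semigroup 𝕜 X} (hS : S.IsCompactSemigroup) {T R : ℝ}
    (hT : 0 ≤ T) (hR : 0 ≤ R) :
    ∃ C : Set C(Icc (0 : ℝ) T, X), IsCompact C ∧
      ∀ w : ℝ → X, ∀ hw : Continuous w, (∀ s ∈ Icc 0 T, ‖w s‖ ≤ R) →
        (⟨fun t => duhamel S w t, (continuous_duhamel S hw).comp continuous_subtype_val⟩ :
          C(Icc (0 : ℝ) T, X)) ∈ C := by
  have hK := S.growthBound_pos T
  set V := {v : X | ∃ w : ℝ → X, Continuous w ∧ (∀ s ∈ Icc 0 T, ‖w s‖ ≤ R) ∧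
      ∃ t ∈ Icc 0 T, v = duhamel S w t} with hV
  have hVc : IsCompact (closure V) :=
    (totallyBounded_duhamel hS hT hR).closure.isCompact_of_isClosed isClosed_closure
  let A : Set (BoundedContinuousFunction (Icc (0 : ℝ) T) X) :=
    {φ | ∃ w : ℝ → X, Continuous w ∧ (∀ s ∈ Icc 0 T, ‖w s‖ ≤ R) ∧ ∀ t, φ t = duhamel S w t}
  -- Common modulus of continuity: the increment is S(t-t')v - v, uniformly small as v ranges over
  -- the compact set `closure V`, plus an integral over [t',t] bounded by a constant times t - t'.
  have hmod : ∀ ε > 0, ∃ η > 0, ∀ w : ℝ → X, Continuous w → (∀ s ∈ Icc 0 T, ‖w s‖ ≤ R) →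
      ∀ t' t : Icc (0 : ℝ) T, (t' : ℝ) ≤ t → (t : ℝ) - t' < η →
        ‖duhamel S w t - duhamel S w t'‖ < ε := by
    intro ε hε
    obtain ⟨η₁, hη₁, h1⟩ := Metric.eventually_nhds_iff.1
      (S.eventually_forall_mem_compact hVc 0 (half_pos hε))
    set η₂ := ε / 2 / (S.growthBound T * R + 1) with hη₂
    have hη₂0 : 0 < η₂ := by positivity
    refine ⟨min η₁ η₂, lt_min hη₁ hη₂0, fun w hw hwR t' t htt hlt => ?_⟩
    rw [duhamel_split S hw t'.2.1 htt]
    have h2 : ‖S.ext (t - t') (duhamel S w t') - duhamel S w t'‖ < ε / 2 := by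
      have h3 := h1 (y := (t : ℝ) - t') (by
        rw [dist_zero_right, Real.norm_of_nonneg (sub_nonneg.2 htt)]
        exact hlt.trans_le (min_le_left _ _)) (duhamel S w t')
        (subset_closure ⟨w, hw, hwR, t', t'.2, rfl⟩)
      simpa using h3
    have h3 : ‖∫ s in (t' : ℝ)..t, S.ext (t - s) (w s)‖ < ε / 2 := by
      refine (norm_integral_ext_le S hwR t'.2.1 htt t.2.2).trans_lt ?_
      have h4 : (t : ℝ) - t' < η₂ := hlt.trans_le (min_le_right _ _)
      calc S.growthBound T * R * (t - t') ≤ S.growthBound T * R * η₂ := by gcongr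
        _ < (S.growthBound T * R + 1) * η₂ := by nlinarith
        _ = ε / 2 := by rw [hη₂]; field_simp
    calc _ = ‖(S.ext (t - t') (duhamel S w t') - duhamel S w t')
          + ∫ s in (t' : ℝ)..t, S.ext (t - s) (w s)‖ := by congr 1; abel
      _ < ε / 2 + ε / 2 := (norm_add_le _ _).trans_lt (add_lt_add h2 h3)
      _ = ε := add_halves ε
  have hA : IsCompact (closure A) := by
    refine BoundedContinuousFunction.arzela_ascoli (closure V) hVc A ?_ ?_
    · rintro φ t ⟨w, hw, hwR, hφ⟩
      exact subset_closure ⟨w, hw, hwR, t, t.2, hφ t⟩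
    · refine UniformEquicontinuous.equicontinuous ?_
      rw [Metric.uniformEquicontinuous_iff]
      intro ε hε
      obtain ⟨η, hη, h⟩ := hmod ε hε
      refine ⟨η, hη, ?_⟩
      rintro t t' htt ⟨φ, w, hw, hwR, hφ⟩
      rw [Subtype.dist_eq, Real.dist_eq] at htt
      change dist (φ t) (φ t') < ε
      rw [hφ, hφ]
      rcases le_total (t' : ℝ) t with hle | hle
      · rw [dist_eq_norm]
        exact h w hw hwR t' t hle ((le_abs_self _).trans_lt htt)
      · rw [dist_comm, dist_eq_norm]
        exact h w hw hwR t t' hle ((le_abs_self _).trans_lt (by rwa [abs_sub_comm]))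
  refine ⟨(ContinuousMap.isometryEquivBoundedOfCompact (Icc (0 : ℝ) T) X).symm '' closure A,
    hA.image (IsometryEquiv.continuous _), fun w hw hwR => ?_⟩
  refine ⟨BoundedContinuousFunction.mkOfCompact ⟨fun t => duhamel S w t,
    (continuous_duhamel S hw).comp continuous_subtype_val⟩, subset_closure ?_, rfl⟩
  exact ⟨w, hw, hwR, fun t => rfl⟩

end Compactness

/-- Limits along one ultrafilter replace subsequences: this works in weak-* compact sets without
metrizability, and successive limits are taken along the same filter without further extraction. -/
lemma exists_tendsto_hyperfilter {α : Type*} [TopologicalSpace α] {K : Set α} (hK : IsCompact K)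
    {u : ℕ → α} (hu : ∀ n, u n ∈ K) : ∃ x ∈ K, Tendsto u (hyperfilter ℕ) (𝓝 x) :=
  hK.ultrafilter_le_nhds ((hyperfilter ℕ).map u)
    (le_principal_iff.2 (mem_map.2 (Eventually.of_forall hu)))

/-- Bounded sequences in a Hilbert space converge weakly along an ultrafilter. -/
lemma exists_weak_limit {𝕜 H : Type*} [RCLike 𝕜] [NormedAddCommGroup H] [InnerProductSpace 𝕜 H]
    [CompleteSpace H] {u : ℕ → H} {C : ℝ} (hu : ∀ n, ‖u n‖ ≤ C) :
    ∃ q : H, ∀ φ : H, Tendsto (fun n => inner 𝕜 (u n) φ) (hyperfilter ℕ) (𝓝 (inner 𝕜 q φ)) := by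
  obtain ⟨l, -, hl⟩ := exists_tendsto_hyperfilter
    (WeakDual.isCompact_closedBall (𝕜 := 𝕜) (E := H) 0 C)
    (u := fun n => StrongDual.toWeakDual (InnerProductSpace.toDual 𝕜 H (u n))) (fun n => by
      rw [mem_preimage, mem_closedBall_zero_iff]
      exact ((InnerProductSpace.toDual 𝕜 H).norm_map (u n)).trans_le (hu n))
  refine ⟨(InnerProductSpace.toDual 𝕜 H).symm (WeakDual.toStrongDual l), fun φ => ?_⟩
  rw [InnerProductSpace.toDual_symm_apply]
  exact ((WeakDual.eval_continuous φ).tendsto l).comp hl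

/-! ### Uniform coercivity of the regularized Gramian -/

section Coercivity

set_option linter.unusedSectionVars false

variable {𝕜 X W : Type*} [RCLike 𝕜]
  [NormedAddCommGroup X] [InnerProductSpace 𝕜 X] [CompleteSpace X]
  [NormedSpace ℝ X] [IsScalarTower ℝ 𝕜 X]
  [NormedAddCommGroup W] [InnerProductSpace 𝕜 W] [CompleteSpace W] {T : ℝ}

/-- A uniform bound on a finite interval is an L² bound, so the weak limit exists in the Hilbert
space L². The representative q is chosen strongly measurable, so that sets defined by its values are
measurable. -/
lemma exists_weak_limit_L2 (hT : 0 ≤ T) {Q : ℕ → ℝ → X} {R : ℝ} (hR : 0 ≤ R)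
    (hQ : ∀ n, Continuous (Q n)) (hQR : ∀ n, ∀ s ∈ Icc 0 T, ‖Q n s‖ ≤ R) :
    ∃ q : ℝ → X, StronglyMeasurable q ∧ MemLp q 2 (volume.restrict (Ioc 0 T)) ∧
      ∀ φ : ℝ → X, MemLp φ 2 (volume.restrict (Ioc 0 T)) →
        Tendsto (fun n => ∫ s in (0 : ℝ)..T, inner 𝕜 (Q n s) (φ s)) (hyperfilter ℕ)
          (𝓝 (∫ s in (0 : ℝ)..T, inner 𝕜 (q s) (φ s))) := by
  set μ := (volume : Measure ℝ).restrict (Ioc 0 T) with hμ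
  have hae : ∀ n, ∀ᵐ s ∂μ, ‖Q n s‖ ≤ R := fun n => by
    filter_upwards [ae_restrict_mem measurableSet_Ioc] with s hs
    exact hQR n s (Ioc_subset_Icc_self hs)
  have hQL : ∀ n, MemLp (Q n) 2 μ := fun n =>
    MemLp.of_bound (hQ n).aestronglyMeasurable R (hae n)
  have hbound : ∀ n, ‖(hQL n).toLp (Q n)‖ ≤ (measureUnivNNReal μ : ℝ) ^ (2 : ENNReal).toReal⁻¹ * R := by
    intro n
    refine Lp.norm_le_of_ae_bound hR ?_
    filter_upwards [(hQL n).coeFn_toLp, hae n] with s h1 h2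
    rwa [h1]
  obtain ⟨q, hq⟩ := exists_weak_limit (𝕜 := 𝕜) hbound
  refine ⟨q, Lp.stronglyMeasurable q, Lp.memLp q, fun φ hφ => ?_⟩
  have h := hq (hφ.toLp φ)
  simp only [L2.inner_def] at h
  rw [intervalIntegral.integral_of_le hT]
  have e2 : ∫ s, inner 𝕜 ((q : ℝ → X) s) ((hφ.toLp φ : ℝ → X) s) ∂μ
      = ∫ s, inner 𝕜 ((q : ℝ → X) s) (φ s) ∂μ := by
    refine integral_congr_ae ?_
    filter_upwards [hφ.coeFn_toLp] with s h1
    rw [h1]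
  rw [e2] at h
  refine h.congr fun n => ?_
  rw [intervalIntegral.integral_of_le hT]
  refine integral_congr_ae ?_
  filter_upwards [hφ.coeFn_toLp, (hQL n).coeFn_toLp] with s h1 h2
  rw [h1, h2]

/-- Pointwise bounds pass to weak limits when the bounding functions converge uniformly. -/
lemma ae_norm_le_of_weak_limit (hT : 0 ≤ T) {Q P : ℕ → ℝ → X} {q p : ℝ → X} {L : ℝ} (hL : 0 ≤ L)
    (hQP : ∀ n, ∀ s ∈ Icc 0 T, ‖Q n s‖ ≤ L * ‖P n s‖)
    (hp : Continuous p) {d : ℕ → ℝ} (hd : Tendsto d (hyperfilter ℕ) (𝓝 0))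
    (hPp : ∀ n, ∀ s ∈ Icc 0 T, ‖P n s‖ ≤ ‖p s‖ + d n)
    (hqm : StronglyMeasurable q) (hq : MemLp q 2 (volume.restrict (Ioc 0 T)))
    (hlim : ∀ φ : ℝ → X, MemLp φ 2 (volume.restrict (Ioc 0 T)) →
        Tendsto (fun n => ∫ s in (0 : ℝ)..T, inner 𝕜 (Q n s) (φ s)) (hyperfilter ℕ)
          (𝓝 (∫ s in (0 : ℝ)..T, inner 𝕜 (q s) (φ s)))) :
    ∀ᵐ s ∂(volume.restrict (Ioc 0 T)), ‖q s‖ ≤ L * ‖p s‖ := by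
  set μ := (volume : Measure ℝ).restrict (Ioc 0 T) with hμ
  -- Testing the weak limit against q restricted to the set where the bound fails gives ∫_A ‖q‖² ≤ L
  -- ∫_A ‖p‖ ‖q‖, although ‖q‖ > L‖p‖ on A. Hence A is null.
  set A : Set ℝ := {s | L * ‖p s‖ < ‖q s‖} with hA
  have hAm : MeasurableSet A :=
    measurableSet_lt (hp.norm.measurable.const_mul L) hqm.norm.measurable
  have hφ : MemLp (A.indicator q) 2 μ := hq.indicator hAm
  have hφ1 : Integrable (A.indicator q) μ := hφ.integrable one_le_two
  obtain ⟨C, hC⟩ := (isCompact_Icc (a := (0 : ℝ)) (b := T)).exists_bound_of_continuousOn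
    hp.continuousOn
  have hpφ : Integrable (fun s => ‖p s‖ * ‖A.indicator q s‖) μ := by
    refine hφ1.norm.bdd_mul (c := C) hp.norm.aestronglyMeasurable ?_
    filter_upwards [ae_restrict_mem measurableSet_Ioc] with s hs
    simpa using hC s (Ioc_subset_Icc_self hs)
  have hn : ∀ n, ‖∫ s in (0 : ℝ)..T, inner 𝕜 (Q n s) (A.indicator q s)‖
      ≤ L * (∫ s, ‖p s‖ * ‖A.indicator q s‖ ∂μ) + L * d n * ∫ s, ‖A.indicator q s‖ ∂μ := by
    intro n
    rw [intervalIntegral.integral_of_le hT, ← integral_const_mul, ← integral_const_mul,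
      ← integral_add (hpφ.const_mul _) (hφ1.norm.const_mul _)]
    refine norm_integral_le_of_norm_le ((hpφ.const_mul _).add (hφ1.norm.const_mul _)) ?_
    filter_upwards [ae_restrict_mem measurableSet_Ioc] with s hs
    have hsI := Ioc_subset_Icc_self hs
    calc ‖inner 𝕜 (Q n s) (A.indicator q s)‖ ≤ ‖Q n s‖ * ‖A.indicator q s‖ :=
          norm_inner_le_norm _ _
      _ ≤ (L * (‖p s‖ + d n)) * ‖A.indicator q s‖ := by
        gcongr
        exact (hQP n s hsI).trans (by gcongr; exact hPp n s hsI)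
      _ = _ := by ring
  have hle : ‖∫ s in (0 : ℝ)..T, inner 𝕜 (q s) (A.indicator q s)‖
      ≤ L * ∫ s, ‖p s‖ * ‖A.indicator q s‖ ∂μ := by
    have hr : Tendsto (fun n => L * (∫ s, ‖p s‖ * ‖A.indicator q s‖ ∂μ)
        + L * d n * ∫ s, ‖A.indicator q s‖ ∂μ) (hyperfilter ℕ)
        (𝓝 (L * ∫ s, ‖p s‖ * ‖A.indicator q s‖ ∂μ)) := by
      simpa using ((hd.const_mul L).mul_const (∫ s, ‖A.indicator q s‖ ∂μ)).const_add
        (L * ∫ s, ‖p s‖ * ‖A.indicator q s‖ ∂μ)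
    exact le_of_tendsto_of_tendsto (hlim _ hφ).norm hr (Eventually.of_forall hn)
  have hsq : Integrable (fun s => ‖A.indicator q s‖ ^ 2) μ := hφ.integrable_norm_pow two_ne_zero
  have e1 : ∫ s in (0 : ℝ)..T, inner 𝕜 (q s) (A.indicator q s)
      = ((∫ s, ‖A.indicator q s‖ ^ 2 ∂μ : ℝ) : 𝕜) := by
    rw [intervalIntegral.integral_of_le hT, ← integral_ofReal]
    refine integral_congr_ae (Eventually.of_forall fun s => ?_)
    by_cases h : s ∈ A
    · simp [h, inner_self_eq_norm_sq_to_K]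
    · simp [h]
  rw [e1, RCLike.norm_ofReal, abs_of_nonneg (integral_nonneg fun _ => by positivity)] at hle
  set k : ℝ → ℝ := fun s => ‖A.indicator q s‖ ^ 2 - L * (‖p s‖ * ‖A.indicator q s‖) with hk
  have hk0 : ∀ s, 0 ≤ k s := by
    intro s
    by_cases h : s ∈ A
    · have h' : L * ‖p s‖ < ‖q s‖ := h
      simp only [hk, indicator_of_mem h]
      nlinarith [norm_nonneg (q s)]
    · simp [hk, h]
  have hki : Integrable k μ := hsq.sub (hpφ.const_mul L)
  have hkz : ∫ s, k s ∂μ = 0 := by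
    refine le_antisymm ?_ (integral_nonneg hk0)
    rw [hk, integral_sub hsq (hpφ.const_mul L), integral_const_mul]
    linarith
  filter_upwards [(integral_eq_zero_iff_of_nonneg hk0 hki).1 hkz] with s hs
  by_contra hcon
  push Not at hcon
  have hsA : s ∈ A := hcon
  simp only [hk, indicator_of_mem hsA, Pi.zero_apply] at hs
  have h0 : 0 < ‖q s‖ := (mul_nonneg hL (norm_nonneg _)).trans_lt hcon
  nlinarith

lemma aestronglyMeasurable_clm_apply {α : Type*} [MeasurableSpace α] {μ : Measure α}
    {A : α → X →L[𝕜] X} {z : α → X} (hA : AEStronglyMeasurable A μ)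
    (hz : AEStronglyMeasurable z μ) : AEStronglyMeasurable (fun s => A s (z s)) μ :=
  Continuous.comp_aestronglyMeasurable (g := fun r : (X →L[𝕜] X) × X => r.1 r.2)
    (by fun_prop) (hA.prodMk hz)

lemma aestronglyMeasurable_smulRight_inner {α : Type*} [MeasurableSpace α] {μ : Measure α}
    {p q : α → X} (hp : AEStronglyMeasurable p μ) (hq : AEStronglyMeasurable q μ) :
    AEStronglyMeasurable (fun s => (innerSL 𝕜 (q s)).smulRight (p s)) μ := by
  have hc : Continuous fun r : X × X => (innerSL 𝕜 r.2).smulRight r.1 := by fun_prop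
  exact Continuous.comp_aestronglyMeasurable
    (g := fun r : X × X => (innerSL 𝕜 r.2).smulRight r.1) hc (hp.prodMk hq)

/-- Unobservable adjoint states vanish at the final time. The perturbation of the adjoint equation
only has to be bounded along the given solution. -/
theorem eq_zero_of_unobservable {S : C0Semigroup 𝕜 X} (hS : S.IsCompactSemigroup) (hT : 0 ≤ T)
    {B : W →L[𝕜] X}
    (hAC : ∀ G : ℝ → X →L[𝕜] X, MemLp G 2 (volume.restrict (Icc 0 T)) →
      IsApproxControllable S B T G)
    {p q : ℝ → X} {x : X} {L : ℝ} (hp : Continuous p)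
    (hqm : StronglyMeasurable q) (hq : MemLp q 2 (volume.restrict (Ioc 0 T)))
    (hpq : ∀ r ∈ Icc 0 T, p r = (S.adj hS).ext (T - r) x
      + ∫ s in r..T, (S.adj hS).ext (s - r) (q s))
    (hle : ∀ᵐ s ∂(volume.restrict (Ioc 0 T)), ‖q s‖ ≤ L * ‖p s‖)
    (hB : ∀ᵐ s ∂(volume.restrict (Ioc 0 T)), ContinuousLinearMap.adjoint B (p s) = 0) : x = 0 := by
  by_contra hx
  have hIcc : (volume : Measure ℝ).restrict (Icc 0 T) = volume.restrict (Ioc 0 T) :=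
    Measure.restrict_congr_set Ioc_ae_eq_Icc.symm
  set μ := (volume : Measure ℝ).restrict (Ioc 0 T) with hμ
  -- The rank-one choice gives G(s)*p(s) = q(s) with ‖G(s)‖ ≤ |L|. Where p = 0 the inverse is 0 by
  -- convention, and q = 0 there almost everywhere by the bound. Measurability is inherited from p
  -- and q.
  set G : ℝ → X →L[𝕜] X := fun s =>
    ((‖p s‖ ^ 2)⁻¹ : ℝ) • (innerSL 𝕜 (q s)).smulRight (p s) with hG
  have hGapply : ∀ s z, G s z = ((‖p s‖ ^ 2)⁻¹ : ℝ) • (inner 𝕜 (q s) z • p s) := fun s z => rfl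
  have hGm : AEStronglyMeasurable G μ := by
    have h1 : AEStronglyMeasurable (fun s => (‖p s‖ ^ 2)⁻¹) μ :=
      (hp.norm.pow 2).measurable.inv.aestronglyMeasurable
    exact h1.smul (aestronglyMeasurable_smulRight_inner hp.aestronglyMeasurable hqm.aestronglyMeasurable)
  have hGb : ∀ᵐ s ∂μ, ‖G s‖ ≤ |L| := by
    filter_upwards [hle] with s hs
    refine ContinuousLinearMap.opNorm_le_bound _ (abs_nonneg L) fun z => ?_
    rw [hGapply, norm_smul, norm_smul, Real.norm_of_nonneg (by positivity)]
    rcases eq_or_ne (p s) 0 with h | h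
    · simp [h]; positivity
    · have h0 : 0 < ‖p s‖ := norm_pos_iff.2 h
      rw [inv_mul_le_iff₀ (by positivity)]
      calc ‖inner 𝕜 (q s) z‖ * ‖p s‖ ≤ (‖q s‖ * ‖z‖) * ‖p s‖ := by
            gcongr; exact norm_inner_le_norm _ _
        _ ≤ ((|L| * ‖p s‖) * ‖z‖) * ‖p s‖ := by
            gcongr
            exact hs.trans (by gcongr; exact le_abs_self L)
        _ = _ := by ring
  have hGp : ∀ᵐ s ∂μ, ∀ z, inner 𝕜 (p s) (G s z) = inner 𝕜 (q s) z := by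
    filter_upwards [hle] with s hs z
    rcases eq_or_ne (p s) 0 with h | h
    · have : q s = 0 := by simpa [h] using hs
      simp [h, this]
    · have h0 : (‖p s‖ : 𝕜) ≠ 0 := by simpa using h
      rw [hGapply, RCLike.real_smul_eq_coe_smul (K := 𝕜), inner_smul_right, inner_smul_right,
        inner_self_eq_norm_sq_to_K]
      push_cast
      field_simp
  have hGL : MemLp G 2 (volume.restrict (Icc 0 T)) := by
    rw [hIcc]
    exact MemLp.of_bound hGm _ hGb
  -- Starting from 0, the target x is approached within less than ‖x‖. Duality will give ⟨x, y T⟩ =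
  -- 0, hence ‖y T - x‖ ≥ ‖x‖.
  obtain ⟨u, hu, y, ⟨hyc, hy⟩, hyx⟩ := hAC G hGL 0 x ‖x‖ (norm_pos_iff.2 hx)
  rw [hIcc] at hu
  set w : ℝ → X := fun s => B (u s) + G s (y s) with hw
  have hBu : Integrable (fun s => B (u s)) μ := B.integrable_comp (hu.integrable one_le_two)
  have hym : AEStronglyMeasurable y μ := by
    rw [← hIcc]; exact hyc.aestronglyMeasurable measurableSet_Icc
  obtain ⟨C, hC⟩ := (isCompact_Icc (a := (0 : ℝ)) (b := T)).exists_bound_of_continuousOn hyc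
  have hGy : Integrable (fun s => G s (y s)) μ := by
    refine Integrable.of_bound (aestronglyMeasurable_clm_apply hGm hym) (|L| * C) ?_
    filter_upwards [hGb, ae_restrict_mem measurableSet_Ioc] with s hs hsI
    exact (G s).le_of_opNorm_le_of_le hs (hC s (Ioc_subset_Icc_self hsI))
  have hwi : IntervalIntegrable w volume 0 T :=
    (intervalIntegrable_iff_integrableOn_Ioc_of_le hT).2 (hBu.add hGy)
  have hqi : IntervalIntegrable q volume 0 T :=
    (intervalIntegrable_iff_integrableOn_Ioc_of_le hT).2 (hq.integrable one_le_two)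
  have key := mild_duality hS hT hwi hqi (y := y) (P := p) (v := 0) (x := x)
    (fun r hr => by
      rw [hy r hr]
      simp only [map_zero, zero_add]
      refine intervalIntegral.integral_congr fun s hs => ?_
      rw [uIcc_of_le hr.1] at hs
      simp only [hw, S.ext_of_nonneg (sub_nonneg.2 hs.2)]) hpq
  have heq : ∫ r in (0 : ℝ)..T, inner 𝕜 (p r) (w r) = ∫ r in (0 : ℝ)..T, inner 𝕜 (q r) (y r) := by
    rw [intervalIntegral.integral_of_le hT, intervalIntegral.integral_of_le hT]
    refine integral_congr_ae ?_
    filter_upwards [hGp, hB] with s h1 h2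
    rw [hw, inner_add_right, h1, ← ContinuousLinearMap.adjoint_inner_left, h2, inner_zero_left,
      zero_add]
  rw [heq, inner_zero_right, zero_add] at key
  have horth : inner 𝕜 x (y T) = 0 := by simpa using key
  have h1 : ‖x‖ ≤ ‖y T - x‖ := by
    have h2 : ‖x‖ * ‖x‖ ≤ ‖x‖ * ‖y T - x‖ := by
      calc ‖x‖ * ‖x‖ = ‖inner 𝕜 x (y T - x)‖ := by
            rw [inner_sub_right, horth, zero_sub, norm_neg, inner_self_eq_norm_sq_to_K,
              norm_pow, RCLike.norm_ofReal, abs_norm, sq]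
        _ ≤ _ := norm_inner_le_norm _ _
    exact le_of_mul_le_mul_left h2 (norm_pos_iff.2 hx)
  linarith

/-- The map `x ↦ (t ↦ S(t) x)`. -/
def orbit (S : C0Semigroup 𝕜 X) (T : ℝ) (x : X) : C(Icc (0 : ℝ) T, X) :=
  ⟨fun t => S.ext t x, S.continuous_ext_apply continuous_subtype_val continuous_const⟩

lemma continuous_orbit (S : C0Semigroup 𝕜 X) (T : ℝ) : Continuous (orbit S T) :=
  ContinuousMap.continuous_of_continuous_uncurry _
    (S.continuous_ext_apply (continuous_subtype_val.comp continuous_snd) continuous_fst)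

/-- The observation energy of the adjoint evolution. -/
def observation (S : C0Semigroup 𝕜 X) (hT : 0 ≤ T) (L : ℝ) (B : W →L[𝕜] X)
    (G : C(Icc (0 : ℝ) T, X →L[𝕜] X)) (x : X) : ℝ :=
  ∫ s in (0 : ℝ)..T, ‖ContinuousLinearMap.adjoint B (evolution S hT L G (T - s) 0 x)‖ ^ 2

lemma observation_smul (S : C0Semigroup 𝕜 X) (hT : 0 ≤ T) (L : ℝ) (B : W →L[𝕜] X)
    (G : C(Icc (0 : ℝ) T, X →L[𝕜] X)) (c : 𝕜) (x : X) :
    observation S hT L B G (c • x) = ‖c‖ ^ 2 * observation S hT L B G x := by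
  simp only [observation, map_smul, norm_smul, mul_pow, intervalIntegral.integral_const_mul]

/-- The projections lie in a compact ball of the finite-dimensional M, so they converge along the
ultrafilter, and the remainders tend to 0. Norm convergence keeps the limit a unit vector; this is
the role of the term ε(I - π_M). -/
lemma exists_tendsto_of_regularized_small {M : Submodule 𝕜 X} [FiniteDimensional 𝕜 M] {x : ℕ → X}
    (hx : ∀ n, ‖x n‖ = 1) (hxM : Tendsto (fun n => x n - M.starProjection (x n)) atTop (𝓝 0)) :
    ∃ y : X, ‖y‖ = 1 ∧ Tendsto x (hyperfilter ℕ) (𝓝 y) := by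
  have : ProperSpace M := FiniteDimensional.proper 𝕜 M
  obtain ⟨y, -, hy⟩ := exists_tendsto_hyperfilter
    ((isCompact_closedBall (0 : M) 1).image continuous_subtype_val)
    (u := fun n => M.starProjection (x n)) (fun n => by
      refine ⟨M.orthogonalProjectionOnto (x n), ?_, rfl⟩
      rw [mem_closedBall_zero_iff, ← hx n]
      exact M.norm_orthogonalProjectionOnto_apply_le (x n))
  have h : Tendsto x (hyperfilter ℕ) (𝓝 y) := by
    simpa using (hxM.mono_left (Nat.hyperfilter_le_atTop)).add hy
  refine ⟨y, ?_, h⟩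
  have h1 := h.norm
  simp only [hx] at h1
  exact (tendsto_nhds_unique h1 tendsto_const_nhds)

/-- The regularized Gramians are coercive, uniformly in the perturbation. -/
theorem exists_uniform_coercivity {S : C0Semigroup 𝕜 X} (hS : S.IsCompactSemigroup) (hT : 0 < T)
    {B : W →L[𝕜] X}
    (hAC : ∀ G : ℝ → X →L[𝕜] X, MemLp G 2 (volume.restrict (Icc 0 T)) →
      IsApproxControllable S B T G)
    (M : Submodule 𝕜 X) [FiniteDimensional 𝕜 M] {ε : ℝ} (hε : 0 < ε) {L : ℝ} (hL : 0 ≤ L) :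
    ∃ c > 0, ∀ G : C(Icc (0 : ℝ) T, X →L[𝕜] X), ‖G‖ ≤ L → ∀ x : X,
      c * ‖x‖ ^ 2 ≤ ε * ‖x - M.starProjection x‖ ^ 2 + observation (S.adj hS) hT.le L B G x := by
  by_contra! hcon
  have hseq : ∀ n : ℕ, ∃ G : C(Icc (0 : ℝ) T, X →L[𝕜] X), ‖G‖ ≤ L ∧ ∃ x : X, ‖x‖ = 1 ∧
      ε * ‖x - M.starProjection x‖ ^ 2 + observation (S.adj hS) hT.le L B G x
        < 1 / ((n : ℝ) + 1) := by
    intro n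
    obtain ⟨G, hG, x, hx⟩ := hcon (1 / ((n : ℝ) + 1)) (by positivity)
    have hx0 : x ≠ 0 := by
      rintro rfl
      simp [observation] at hx
    have hx1 : 0 < ‖x‖ := norm_pos_iff.2 hx0
    refine ⟨G, hG, (‖x‖⁻¹ : 𝕜) • x, ?_, ?_⟩
    · rw [norm_smul, norm_inv, RCLike.norm_ofReal, abs_norm, inv_mul_cancel₀ hx1.ne']
    · have e : ‖(‖x‖⁻¹ : 𝕜)‖ ^ 2 * ‖x‖ ^ 2 = 1 := by
        rw [norm_inv, RCLike.norm_ofReal, abs_norm, ← mul_pow, inv_mul_cancel₀ hx1.ne', one_pow]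
      rw [observation_smul, map_smul, ← smul_sub, norm_smul, mul_pow]
      have h0 : 0 < ‖(‖x‖⁻¹ : 𝕜)‖ ^ 2 := by
        have : (‖x‖⁻¹ : 𝕜) ≠ 0 := by simpa using hx0
        positivity
      calc _ = ‖(‖x‖⁻¹ : 𝕜)‖ ^ 2 * (ε * ‖x - M.starProjection x‖ ^ 2
            + observation (S.adj hS) hT.le L B G x) := by ring
        _ < ‖(‖x‖⁻¹ : 𝕜)‖ ^ 2 * (1 / ((n : ℝ) + 1) * ‖x‖ ^ 2) := by gcongr
        _ = 1 / ((n : ℝ) + 1) * (‖(‖x‖⁻¹ : 𝕜)‖ ^ 2 * ‖x‖ ^ 2) := by ring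
        _ = _ := by rw [e, mul_one]
  choose G hG x hx hsmall using hseq
  set S' := S.adj hS with hS'
  have hobs0 : ∀ n, 0 ≤ observation S' hT.le L B (G n) (x n) := fun n =>
    intervalIntegral.integral_nonneg hT.le fun _ _ => by positivity
  have h1n : Tendsto (fun n : ℕ => 1 / ((n : ℝ) + 1)) atTop (𝓝 0) :=
    tendsto_one_div_add_atTop_nhds_zero_nat
  have hobs : Tendsto (fun n => observation S' hT.le L B (G n) (x n)) atTop (𝓝 0) := by
    refine squeeze_zero hobs0 (fun n => ?_) h1n
    have : 0 ≤ ε * ‖x n - M.starProjection (x n)‖ ^ 2 := by positivity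
    linarith [hsmall n]
  have hxM : Tendsto (fun n => x n - M.starProjection (x n)) atTop (𝓝 0) := by
    have h2 : Tendsto (fun n => ‖x n - M.starProjection (x n)‖ ^ 2) atTop (𝓝 0) := by
      refine squeeze_zero (fun n => by positivity) (fun n => ?_) (g := fun n : ℕ => ε⁻¹ * (1 / ((n : ℝ) + 1)))
        (by simpa using h1n.const_mul ε⁻¹)
      rw [← div_eq_inv_mul, le_div_iff₀ hε]
      linarith [hsmall n, hobs0 n]
    rw [tendsto_zero_iff_norm_tendsto_zero]
    simpa [Real.sqrt_sq] using h2.sqrt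
  obtain ⟨xlim, hxlim, hxtend⟩ := exists_tendsto_of_regularized_small hx hxM
  set R := L * evolutionBound S' T L with hR
  have hR0 : 0 ≤ R := mul_nonneg hL (evolutionBound_nonneg _ _ _)
  -- forward-time adjoint states and their forcing terms
  set P : ℕ → ℝ → X := fun n τ => evolution S' hT.le L (G n) τ 0 (x n) with hP
  set F : ℕ → ℝ → X := fun n τ => G n (projIcc 0 T hT.le τ) (P n τ) with hF
  have hPc : ∀ n, Continuous (P n) := fun n => continuous_evolution_apply S' hT.le
    continuous_const (fun _ => hG n) continuous_id continuous_const continuous_const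
  have hFc : ∀ n, Continuous (F n) := fun n =>
    ((G n).continuous.comp continuous_projIcc).clm_apply (hPc n)
  have hFP : ∀ n τ, ‖F n τ‖ ≤ L * ‖P n τ‖ := fun n τ =>
    ContinuousLinearMap.le_of_opNorm_le _ (((G n).norm_coe_le_norm _).trans (hG n)) _
  have hFR : ∀ n, ∀ τ ∈ Icc 0 T, ‖F n τ‖ ≤ R := fun n τ hτ => by
    refine (hFP n τ).trans ?_
    have h2 := norm_evolution_apply_le S' hT.le (hG n) (s := 0) le_rfl hτ.2 (x n)
    rw [hx n, mul_one] at h2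
    rw [hR]
    gcongr
  have hPeq : ∀ n, ∀ τ ∈ Icc 0 T, P n τ = S'.ext τ (x n) + duhamel S' (F n) τ := by
    intro n τ hτ
    have h2 := evolution_eq_integral S' hT.le (hG n) (x n) le_rfl hτ.1 hτ.2
    rwa [sub_zero] at h2
  obtain ⟨C, hC, hmemC⟩ := exists_compact_duhamel (S.adj_isCompactSemigroup hS) hT.le hR0
  -- The Duhamel parts converge uniformly, and so do the orbits of x n; their sum gives the uniform
  -- limit of the adjoint states.
  obtain ⟨D, -, hD⟩ := exists_tendsto_hyperfilter hC fun n => hmemC (F n) (hFc n) (hFR n)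
  set Z : ℕ → C(Icc (0 : ℝ) T, X) := fun n => ⟨fun t => P n t,
    (hPc n).comp continuous_subtype_val⟩ with hZ
  set Zlim : C(Icc (0 : ℝ) T, X) := orbit S' T xlim + D with hZlim
  have hZtend : Tendsto Z (hyperfilter ℕ) (𝓝 Zlim) := by
    refine ((((continuous_orbit S' T).tendsto xlim).comp hxtend).add hD).congr fun n => ?_
    ext t
    exact (hPeq n t t.2).symm
  set p : ℝ → X := fun s => Zlim (projIcc 0 T hT.le (T - s)) with hp
  have hpc : Continuous p := Zlim.continuous.comp (continuous_projIcc.comp (by fun_prop))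
  have hrefl : ∀ {s : ℝ}, s ∈ Icc 0 T → T - s ∈ Icc 0 T := fun hs =>
    ⟨sub_nonneg.2 hs.2, sub_le_self _ hs.1⟩
  have hpapp : ∀ s (hs : s ∈ Icc 0 T), p s = Zlim ⟨T - s, hrefl hs⟩ := fun s hs => by
    simp only [hp, projIcc_of_mem hT.le (hrefl hs)]
  -- Only the products G n P n are passed to a limit, in reversed time; the operators G n need not
  -- converge.
  obtain ⟨q, hqm, hq, hqlim⟩ := exists_weak_limit_L2 (𝕜 := 𝕜) hT.le hR0
    (Q := fun n s => F n (T - s)) (fun n => (hFc n).comp (by fun_prop))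
    (fun n s hs => hFR n _ (hrefl hs))
  have hle : ∀ᵐ s ∂(volume.restrict (Ioc 0 T)), ‖q s‖ ≤ L * ‖p s‖ := by
    refine ae_norm_le_of_weak_limit (𝕜 := 𝕜) hT.le hL (P := fun n s => P n (T - s))
      (fun n s _ => hFP n _) hpc (d := fun n => ‖Z n - Zlim‖) ?_ ?_ hqm hq hqlim
    · exact tendsto_iff_norm_sub_tendsto_zero.1 hZtend
    · intro n s hs
      rw [hpapp s hs]
      have h2 := (Z n - Zlim).norm_coe_le_norm ⟨T - s, hrefl hs⟩
      have h3 : ‖P n (T - s)‖ ≤ ‖P n (T - s) - Zlim ⟨T - s, hrefl hs⟩‖ + ‖Zlim ⟨T - s, hrefl hs⟩‖ := by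
        simpa using norm_add_le (P n (T - s) - Zlim ⟨T - s, hrefl hs⟩) (Zlim ⟨T - s, hrefl hs⟩)
      have h4 : ‖P n (T - s) - Zlim ⟨T - s, hrefl hs⟩‖ ≤ ‖Z n - Zlim‖ := h2
      linarith
  have hqi : IntervalIntegrable q volume 0 T :=
    (intervalIntegrable_iff_integrableOn_Ioc_of_le hT.le).2 (hq.integrable one_le_two)
  have hpq : ∀ r ∈ Icc 0 T, p r = S'.ext (T - r) xlim + ∫ s in r..T, S'.ext (s - r) (q s) := by
    intro r hr
    -- The strong limit D and the weak limit q are linked by pairing with v, which moves the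
    -- semigroup onto an L² test function φ.
    have hDr : D ⟨T - r, hrefl hr⟩ = ∫ s in r..T, S'.ext (s - r) (q s) := by
      refine ext_inner_right 𝕜 fun v => ?_
      set φ : ℝ → X := (Ioc r T).indicator fun s => S.ext (s - r) v with hφ
      have hφL : MemLp φ 2 (volume.restrict (Ioc 0 T)) := by
        have hcv : Continuous fun s => S.ext (s - r) v :=
          S.continuous_ext_apply (by fun_prop) continuous_const
        refine MemLp.indicator measurableSet_Ioc ?_
        refine MemLp.of_bound hcv.aestronglyMeasurable (S.growthBound T * ‖v‖) ?_
        filter_upwards [ae_restrict_mem measurableSet_Ioc] with s hs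
        exact S.norm_ext_apply_le (by linarith [hs.2, hr.1]) v
      have hpair : ∀ k : ℝ → X, IntervalIntegrable k volume 0 T →
          ∫ s in (0 : ℝ)..T, inner 𝕜 (k s) (φ s)
            = inner 𝕜 (∫ s in r..T, S'.ext (s - r) (k s)) v := by
        intro k hk
        have hk' : IntervalIntegrable k volume r T := hk.mono_set (by
          rw [uIcc_of_le hr.2, uIcc_of_le hT.le]; exact Icc_subset_Icc hr.1 le_rfl)
        rw [inner_intervalIntegral_left (S'.intervalIntegrable_ext_sub' hk' r),
          intervalIntegral.integral_of_le hT.le, intervalIntegral.integral_of_le hr.2]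
        have e1 : (fun s => inner 𝕜 (k s) (φ s))
            = (Ioc r T).indicator fun s => inner 𝕜 (S'.ext (s - r) (k s)) v := by
          funext s
          by_cases hs : s ∈ Ioc r T
          · simp only [hφ, indicator_of_mem hs]
            exact (ContinuousLinearMap.adjoint_inner_left (S.ext (s - r)) v (k s)).symm
          · simp [hφ, hs]
        rw [e1, setIntegral_indicator measurableSet_Ioc,
          inter_eq_right.2 (Ioc_subset_Ioc hr.1 le_rfl)]
      have hl := hqlim φ hφL
      rw [hpair q hqi] at hl
      have hl2 : Tendsto (fun n => inner 𝕜 (duhamel S' (F n) (T - r)) v) (hyperfilter ℕ)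
          (𝓝 (inner 𝕜 (D ⟨T - r, hrefl hr⟩) v)) :=
        Tendsto.inner (((continuous_eval_const (F := C(Icc (0 : ℝ) T, X))
          (⟨T - r, hrefl hr⟩ : Icc (0 : ℝ) T)).tendsto D).comp hD) tendsto_const_nhds
      refine tendsto_nhds_unique hl2 (hl.congr fun n => ?_)
      have hFr : Continuous fun s => F n (T - s) := (hFc n).comp (by fun_prop)
      rw [hpair _ (hFr.intervalIntegrable 0 T), duhamel]
      congr 1
      have e := intervalIntegral.integral_comp_sub_left
        (f := fun σ => S'.ext (T - r - σ) (F n σ)) (a := r) (b := T) T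
      rw [sub_self] at e
      rw [← e]
      refine intervalIntegral.integral_congr fun s _ => ?_
      rw [show T - r - (T - s) = s - r by ring]
    rw [hpapp r hr, ← hDr]
    rfl
  have hB : ∀ᵐ s ∂(volume.restrict (Ioc 0 T)), ContinuousLinearMap.adjoint B (p s) = 0 := by
    -- The observation energy is a continuous functional of the trajectory, so it vanishes at the
    -- uniform limit.
    let J : C(Icc (0 : ℝ) T, X) → ℝ := fun z => ∫ s in (0 : ℝ)..T,
      ‖ContinuousLinearMap.adjoint B (z (projIcc 0 T hT.le (T - s)))‖ ^ 2
    have hJc : Continuous J := by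
      refine intervalIntegral.continuous_parametric_intervalIntegral_of_continuous'
        (f := fun (z : C(Icc (0 : ℝ) T, X)) s =>
          ‖ContinuousLinearMap.adjoint B (z (projIcc 0 T hT.le (T - s)))‖ ^ 2) ?_ 0 T
      refine (((ContinuousLinearMap.adjoint B).continuous.comp ?_).norm).pow 2
      exact continuous_fst.eval (continuous_projIcc.comp (by fun_prop))
    have hJ0 : J Zlim = 0 := by
      refine tendsto_nhds_unique ((hJc.tendsto Zlim).comp hZtend)
        ((hobs.mono_left Nat.hyperfilter_le_atTop).congr fun n => ?_)
      refine intervalIntegral.integral_congr fun s hs => ?_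
      rw [uIcc_of_le hT.le] at hs
      rw [projIcc_of_mem hT.le (hrefl hs)]
      rfl
    have hcont : Continuous fun s => ‖ContinuousLinearMap.adjoint B (p s)‖ ^ 2 :=
      ((ContinuousLinearMap.adjoint B).continuous.comp hpc).norm.pow 2
    have h0 := (intervalIntegral.integral_eq_zero_iff_of_le_of_nonneg_ae hT.le
      (Eventually.of_forall fun s => by positivity) (hcont.intervalIntegrable 0 T)).1 hJ0
    filter_upwards [h0] with s hs
    simpa using hs
  have hzero := eq_zero_of_unobservable hS hT.le hAC hpc hqm hq hpq hle hB
  rw [hzero, norm_zero] at hxlim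
  exact zero_ne_one hxlim

end Coercivity

/-! ### Invertibility of the regularized Gramian -/

section Gramian

set_option linter.unusedSectionVars false

variable {𝕜 X W : Type*} [RCLike 𝕜]
  [NormedAddCommGroup X] [InnerProductSpace 𝕜 X] [CompleteSpace X]
  [NormedSpace ℝ X] [IsScalarTower ℝ 𝕜 X]
  [NormedAddCommGroup W] [InnerProductSpace 𝕜 W] [CompleteSpace W] {T : ℝ}
  {S : C0Semigroup 𝕜 X} (hS : S.IsCompactSemigroup) (hT : 0 ≤ T) (L : ℝ) (B : W →L[𝕜] X)

/-- The control `s ↦ B B* 𝔗(T, s; G)* v`, through the adjoint evolution. -/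
def adjointControl (G : C(Icc (0 : ℝ) T, X →L[𝕜] X)) (v : X) (s : ℝ) : X :=
  B (ContinuousLinearMap.adjoint B (evolution (S.adj hS) hT L (adjointReversed G) (T - s) 0 v))

/-- The controllability Gramian for continuous `G`. -/
def gramianOf (G : C(Icc (0 : ℝ) T, X →L[𝕜] X)) (v : X) : X :=
  ∫ s in (0 : ℝ)..T, evolution S hT L G T s (adjointControl hS hT L B G v s)

variable {L}

lemma continuous_adjointControl {Z : Type*} [TopologicalSpace Z]
    {G : Z → C(Icc (0 : ℝ) T, X →L[𝕜] X)} (hGc : Continuous G) (hG : ∀ z, ‖G z‖ ≤ L)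
    {v : Z → X} (hv : Continuous v) {s : Z → ℝ} (hs : Continuous s) :
    Continuous fun z => adjointControl hS hT L B (G z) (v z) (s z) :=
  B.continuous.comp ((ContinuousLinearMap.adjoint B).continuous.comp
    (continuous_evolution_apply (S.adj hS) hT (continuous_adjointReversed hGc)
      (fun z => norm_adjointReversed_le (hG z)) (by fun_prop) continuous_const hv))

lemma continuous_gramianOf {Z : Type*} [TopologicalSpace Z]
    {G : Z → C(Icc (0 : ℝ) T, X →L[𝕜] X)} (hGc : Continuous G) (hG : ∀ z, ‖G z‖ ≤ L)
    {v : Z → X} (hv : Continuous v) : Continuous fun z => gramianOf hS hT L B (G z) (v z) := by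
  refine intervalIntegral.continuous_parametric_intervalIntegral_of_continuous'
    (f := fun z s => evolution S hT L (G z) T s (adjointControl hS hT L B (G z) (v z) s)) ?_ 0 T
  exact continuous_evolution_apply S hT (hGc.comp continuous_fst) (fun z => hG z.1)
    continuous_const continuous_snd (continuous_adjointControl hS hT B (hGc.comp continuous_fst)
      (fun z => hG z.1) (hv.comp continuous_fst) continuous_snd)

lemma intervalIntegrable_gramianOf {G : C(Icc (0 : ℝ) T, X →L[𝕜] X)} (hG : ‖G‖ ≤ L) (v : X)
    (a b : ℝ) : IntervalIntegrable
      (fun s => evolution S hT L G T s (adjointControl hS hT L B G v s)) volume a b :=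
  (continuous_evolution_apply S hT continuous_const (fun _ => hG) continuous_const continuous_id
    (continuous_adjointControl hS hT B continuous_const (fun _ => hG) continuous_const
      continuous_id)).intervalIntegrable a b

/-- The operator `ε (I - π_M) + Γ₀ᵀ(G)`. -/
def regGramian (M : Submodule 𝕜 X) [M.HasOrthogonalProjection] (ε : ℝ)
    {G : C(Icc (0 : ℝ) T, X →L[𝕜] X)} (hG : ‖G‖ ≤ L) : X →L[𝕜] X where
  toFun x := ε • (x - M.starProjection x) + gramianOf hS hT L B G x
  map_add' x y := by
    have h : gramianOf hS hT L B G (x + y) = gramianOf hS hT L B G x + gramianOf hS hT L B G y := by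
      rw [gramianOf, gramianOf, gramianOf, ← intervalIntegral.integral_add
        (intervalIntegrable_gramianOf hS hT B hG x 0 T)
        (intervalIntegrable_gramianOf hS hT B hG y 0 T)]
      simp only [adjointControl, map_add]
    rw [h, map_add, add_sub_add_comm, smul_add]
    abel
  map_smul' c x := by
    have h : gramianOf hS hT L B G (c • x) = c • gramianOf hS hT L B G x := by
      rw [gramianOf, gramianOf, ← intervalIntegral.integral_smul]
      simp only [adjointControl, map_smul]
    rw [h, map_smul, ← smul_sub, smul_comm, RingHom.id_apply, smul_add]
  cont := by
    refine Continuous.add (by fun_prop) ?_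
    exact continuous_gramianOf hS hT B continuous_const (fun _ => hG) continuous_id

variable (M : Submodule 𝕜 X) [M.HasOrthogonalProjection] (ε : ℝ)

lemma regGramian_apply {G : C(Icc (0 : ℝ) T, X →L[𝕜] X)} (hG : ‖G‖ ≤ L) (x : X) :
    regGramian hS hT B M ε hG x
      = ε • (x - M.starProjection x) + gramianOf hS hT L B G x := rfl

/-- Moving each factor of the Gramian across the inner product turns it into the energy of the
adjoint evolution. The reversed adjoint family has the same norm bound, so the uniform coercivity
applies to it. -/
lemma inner_regGramian {G : C(Icc (0 : ℝ) T, X →L[𝕜] X)} (hG : ‖G‖ ≤ L) (x : X) :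
    inner 𝕜 x (regGramian hS hT B M ε hG x)
      = ((ε * ‖x - M.starProjection x‖ ^ 2
        + observation (S.adj hS) hT L B (adjointReversed G) x : ℝ) : 𝕜) := by
  have h1 : inner 𝕜 x (x - M.starProjection x) = ((‖x - M.starProjection x‖ ^ 2 : ℝ) : 𝕜) := by
    have h2 : inner 𝕜 (M.starProjection x) (x - M.starProjection x) = 0 :=
      Submodule.inner_right_of_mem_orthogonal (M.starProjection_apply_mem x)
        (M.sub_starProjection_mem_orthogonal x)
    have h3 : inner 𝕜 x (x - M.starProjection x)
        = inner 𝕜 (x - M.starProjection x) (x - M.starProjection x) := by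
      rw [inner_sub_left, h2, sub_zero]
    rw [h3, inner_self_eq_norm_sq_to_K]
    push_cast
    rfl
  have h4 : inner 𝕜 x (gramianOf hS hT L B G x)
      = ((observation (S.adj hS) hT L B (adjointReversed G) x : ℝ) : 𝕜) := by
    rw [gramianOf, inner_intervalIntegral_right (intervalIntegrable_gramianOf hS hT B hG x 0 T),
      observation, intervalIntegral.integral_of_le hT, intervalIntegral.integral_of_le hT,
      ← integral_ofReal]
    refine setIntegral_congr_fun measurableSet_Ioc fun s hs => ?_
    have h5 := adjoint_evolution hS hT hG hs.1.le hs.2 le_rfl x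
    rw [sub_self] at h5
    simp only [adjointControl]
    rw [← ContinuousLinearMap.adjoint_inner_left, h5, ← ContinuousLinearMap.adjoint_inner_left,
      inner_self_eq_norm_sq_to_K]
    push_cast
    rfl
  rw [regGramian_apply, inner_add_right, RCLike.real_smul_eq_coe_smul (K := 𝕜), inner_smul_right,
    h1, h4]
  push_cast
  rfl

variable {M ε}

/-- The uniform coercivity of the regularized Gramians, as a hypothesis on the constant `c`. -/
lemma mul_norm_le_regGramian {c : ℝ}
    (hc : ∀ G : C(Icc (0 : ℝ) T, X →L[𝕜] X), ‖G‖ ≤ L → ∀ x : X,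
      c * ‖x‖ ^ 2 ≤ ε * ‖x - M.starProjection x‖ ^ 2 + observation (S.adj hS) hT L B G x)
    {G : C(Icc (0 : ℝ) T, X →L[𝕜] X)} (hG : ‖G‖ ≤ L) (x : X) :
    c * ‖x‖ ^ 2 ≤ ‖inner 𝕜 x (regGramian hS hT B M ε hG x)‖ := by
  rw [inner_regGramian, RCLike.norm_ofReal]
  exact (hc _ (norm_adjointReversed_le hG) x).trans (le_abs_self _)

lemma mul_norm_le_norm_regGramian {c : ℝ}
    (hc : ∀ G : C(Icc (0 : ℝ) T, X →L[𝕜] X), ‖G‖ ≤ L → ∀ x : X,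
      c * ‖x‖ ^ 2 ≤ ε * ‖x - M.starProjection x‖ ^ 2 + observation (S.adj hS) hT L B G x)
    {G : C(Icc (0 : ℝ) T, X →L[𝕜] X)} (hG : ‖G‖ ≤ L) (x : X) :
    c * ‖x‖ ≤ ‖regGramian hS hT B M ε hG x‖ := by
  rcases eq_or_ne x 0 with rfl | hx
  · simp
  have h0 : 0 < ‖x‖ := norm_pos_iff.2 hx
  have h1 := (mul_norm_le_regGramian hS hT B hc hG x).trans (norm_inner_le_norm _ _)
  refine le_of_mul_le_mul_left ?_ h0
  calc ‖x‖ * (c * ‖x‖) = c * ‖x‖ ^ 2 := by ring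
    _ ≤ _ := h1

/-- This is the Lax–Milgram principle for the coercive form. -/
lemma isUnit_regGramian {c : ℝ} (hc0 : 0 < c)
    (hc : ∀ G : C(Icc (0 : ℝ) T, X →L[𝕜] X), ‖G‖ ≤ L → ∀ x : X,
      c * ‖x‖ ^ 2 ≤ ε * ‖x - M.starProjection x‖ ^ 2 + observation (S.adj hS) hT L B G x)
    {G : C(Icc (0 : ℝ) T, X →L[𝕜] X)} (hG : ‖G‖ ≤ L) :
    IsUnit (regGramian hS hT B M ε hG) := by
  refine ContinuousLinearMap.isUnit_of_forall_le_norm_inner_map _ (c := ⟨c, hc0.le⟩) hc0 fun x => ?_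
  rw [norm_inner_symm]
  have := mul_norm_le_regGramian hS hT B hc hG x
  rw [mul_comm]
  exact this

end Gramian

/-! ### Schauder's theorem applied to the solution map -/

section FixedPoint

set_option linter.unusedSectionVars false

variable {𝕜 X W : Type*} [RCLike 𝕜]
  [NormedAddCommGroup X] [InnerProductSpace 𝕜 X] [CompleteSpace X]
  [NormedSpace ℝ X] [IsScalarTower ℝ 𝕜 X]
  [NormedAddCommGroup W] [InnerProductSpace 𝕜 W] [CompleteSpace W] {T : ℝ}
  {S : C0Semigroup 𝕜 X}

/-- The residual target `h - 𝔗(T, 0) x₀ - ∫₀ᵀ 𝔗(T, s) γ(s) ds`. -/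
def targetResidual (S : C0Semigroup 𝕜 X) (hT : 0 ≤ T) (L : ℝ) (G : C(Icc (0 : ℝ) T, X →L[𝕜] X))
    (γ : ℝ → X) (x₀ h : X) : X :=
  h - evolution S hT L G T 0 x₀ - ∫ s in (0 : ℝ)..T, evolution S hT L G T s (γ s)

/-- The state `𝔗(t, 0) x₀ + ∫₀ᵗ 𝔗(t, s) w(s) ds`. -/
def stateOf (S : C0Semigroup 𝕜 X) (hT : 0 ≤ T) (L : ℝ) (G : C(Icc (0 : ℝ) T, X →L[𝕜] X))
    (w : ℝ → X) (x₀ : X) (t : ℝ) : X :=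
  evolution S hT L G t 0 x₀ + ∫ s in (0 : ℝ)..t, evolution S hT L G t s (w s)

lemma continuous_targetResidual (hT : 0 ≤ T) {L : ℝ} {Z : Type*} [TopologicalSpace Z]
    {G : Z → C(Icc (0 : ℝ) T, X →L[𝕜] X)} (hGc : Continuous G) (hG : ∀ z, ‖G z‖ ≤ L)
    {γ : Z → ℝ → X} (hγ : Continuous (Function.uncurry γ)) (x₀ h : X) :
    Continuous fun z => targetResidual S hT L (G z) (γ z) x₀ h := by
  refine (continuous_const.sub (continuous_evolution_apply S hT hGc hG continuous_const
    continuous_const continuous_const)).sub ?_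
  refine intervalIntegral.continuous_parametric_intervalIntegral_of_continuous'
    (f := fun z s => evolution S hT L (G z) T s (γ z s)) ?_ 0 T
  exact continuous_evolution_apply S hT (hGc.comp continuous_fst) (fun z => hG z.1)
    continuous_const continuous_snd hγ

lemma continuous_stateOf (hT : 0 ≤ T) {L : ℝ} {Z : Type*} [TopologicalSpace Z]
    {G : Z → C(Icc (0 : ℝ) T, X →L[𝕜] X)} (hGc : Continuous G) (hG : ∀ z, ‖G z‖ ≤ L)
    {w : Z → ℝ → X} (hw : Continuous (Function.uncurry w)) (x₀ : X) :
    Continuous fun p : Z × ℝ => stateOf S hT L (G p.1) (w p.1) x₀ p.2 := by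
  refine (continuous_evolution_apply S hT (hGc.comp continuous_fst) (fun z => hG z.1)
    continuous_snd continuous_const continuous_const).add ?_
  refine intervalIntegral.continuous_parametric_intervalIntegral_of_continuous
    (f := fun (p : Z × ℝ) s => evolution S hT L (G p.1) p.2 s (w p.1 s)) ?_ continuous_snd
  exact continuous_evolution_apply S hT (hGc.comp (continuous_fst.comp continuous_fst))
    (fun z => hG z.1.1) (continuous_snd.comp continuous_fst) continuous_snd
    (hw.comp ((continuous_fst.comp continuous_fst).prodMk continuous_snd))

lemma norm_integral_evolution_le (hT : 0 ≤ T) {L : ℝ} {G : C(Icc (0 : ℝ) T, X →L[𝕜] X)}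
    (hG : ‖G‖ ≤ L) {w : ℝ → X} {R t : ℝ} (hw : ∀ s ∈ Icc 0 T, ‖w s‖ ≤ R) (ht : t ∈ Icc 0 T) :
    ‖∫ s in (0 : ℝ)..t, evolution S hT L G t s (w s)‖ ≤ evolutionBound S T L * R * T := by
  have hb := evolutionBound_nonneg S T L
  have hR : 0 ≤ R := (norm_nonneg _).trans (hw 0 ⟨le_rfl, hT⟩)
  have h := intervalIntegral.norm_integral_le_of_norm_le_const (a := 0) (b := t)
    (f := fun s => evolution S hT L G t s (w s)) (C := evolutionBound S T L * R) fun s hs => by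
      rw [uIoc_of_le ht.1] at hs
      refine (norm_evolution_apply_le S hT hG hs.1.le ht.2 _).trans ?_
      gcongr
      exact hw s ⟨hs.1.le, hs.2.trans ht.2⟩
  rw [sub_zero, abs_of_nonneg ht.1] at h
  exact h.trans (by gcongr; exact ht.2)

/-- If `G` and `w` depend continuously on `z` and are uniformly bounded, then the solution map
`z ↦ stateOf` has a fixed point. -/
theorem exists_fixedPoint_stateOf (hS : S.IsCompactSemigroup) (hT : 0 ≤ T) {L : ℝ} (hL : 0 ≤ L)
    {G : C(Icc (0 : ℝ) T, X) → C(Icc (0 : ℝ) T, X →L[𝕜] X)} (hGc : Continuous G)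
    (hG : ∀ z, ‖G z‖ ≤ L) {w : C(Icc (0 : ℝ) T, X) → ℝ → X}
    (hw : Continuous (Function.uncurry w)) {R : ℝ} (hwR : ∀ z, ∀ s ∈ Icc 0 T, ‖w z s‖ ≤ R)
    (x₀ : X) :
    ∃ Θ : C(Icc (0 : ℝ) T, X) → C(Icc (0 : ℝ) T, X),
      (∀ z t, Θ z t = stateOf S hT L (G z) (w z) x₀ t) ∧ ∃ y, Function.IsFixedPt Θ y := by
  have hc := continuous_stateOf (S := S) hT hGc hG hw x₀
  let Θ : C(Icc (0 : ℝ) T, X) → C(Icc (0 : ℝ) T, X) := fun z =>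
    ⟨fun t => stateOf S hT L (G z) (w z) x₀ t,
      hc.comp ((Continuous.prodMk_right z).comp continuous_subtype_val)⟩
  refine ⟨Θ, fun _ _ => rfl, ?_⟩
  have hΘc : Continuous Θ := ContinuousMap.continuous_of_continuous_uncurry _
    (hc.comp (continuous_fst.prodMk (continuous_subtype_val.comp continuous_snd)))
  have hR : 0 ≤ R := (norm_nonneg _).trans (hwR 0 0 ⟨le_rfl, hT⟩)
  have hb := evolutionBound_nonneg S T L
  -- Y is an a priori bound for every state, independent of z; the forcing w + G y of the mild
  -- equation is then bounded by R + L Y.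
  set Y := evolutionBound S T L * ‖x₀‖ + evolutionBound S T L * R * T with hY
  have hY0 : 0 ≤ Y := by positivity
  obtain ⟨C, hC, hmem⟩ := exists_compact_duhamel hS hT (R := R + L * Y) (by positivity)
  obtain ⟨y, hy⟩ := exists_fixedPoint_of_range_subset_compact hΘc
    (hC.image (f := fun φ => orbit S T x₀ + φ) (by fun_prop)) fun z => by
      set y : ℝ → X := fun t => stateOf S hT L (G z) (w z) x₀ t with hydef
      have hyc : Continuous y := hc.comp (Continuous.prodMk_right z)
      have hwc : Continuous (w z) := hw.comp (Continuous.prodMk_right z)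
      have hyY : ∀ t ∈ Icc 0 T, ‖y t‖ ≤ Y := fun t ht =>
        (norm_add_le _ _).trans (add_le_add
          (norm_evolution_apply_le S hT (hG z) le_rfl ht.2 x₀)
          (norm_integral_evolution_le hT (hG z) (hwR z) ht))
      have hFc : Continuous fun r => w z r + G z (projIcc 0 T hT r) (y r) :=
        hwc.add (((G z).continuous.comp continuous_projIcc).clm_apply hyc)
      refine ⟨_, hmem _ hFc fun s hs => ?_, ?_⟩
      · refine (norm_add_le _ _).trans (add_le_add (hwR z s hs) ?_)
        exact ContinuousLinearMap.le_of_opNorm_le_of_le _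
          (((G z).norm_coe_le_norm _).trans (hG z)) (hyY s hs)
      · ext t
        -- Compactness is available for S rather than for 𝔗, so the state is rewritten as the orbit
        -- of x₀ plus a Duhamel integral in which G y counts as forcing.
        exact (evolution_mild_equation S hT (hG z) x₀ hwc (fun t _ => rfl) t.2).symm
  exact ⟨y, hy⟩

end FixedPoint

/-! ### The nonlinear coefficients, and passage to the stated operators -/

section Linearization

set_option linter.unusedSectionVars false

variable {𝕜 X W : Type*} [RCLike 𝕜]
  [NormedAddCommGroup X] [InnerProductSpace 𝕜 X] [CompleteSpace X]
  [NormedSpace ℝ X] [IsScalarTower ℝ 𝕜 X]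
  [NormedAddCommGroup W] [InnerProductSpace 𝕜 W] [CompleteSpace W] {T : ℝ}

/-- The linearization along `z` is continuous in time and depends continuously on `z`. -/
lemma exists_continuous_linearization (hT : 0 ≤ T) {f : ℝ → X → X} {L : ℝ} (hL : 0 ≤ L)
    (hf_cont : ContinuousOn (fun p : ℝ × X => fderiv 𝕜 (f p.1) p.2) (Icc 0 T ×ˢ univ))
    (hf_bound : ∀ t ∈ Icc (0 : ℝ) T, ∀ z : X, ‖fderiv 𝕜 (f t) z‖ ≤ L) :
    ∃ G : C(Icc (0 : ℝ) T, X) → C(Icc (0 : ℝ) T, X →L[𝕜] X), Continuous G ∧ (∀ z, ‖G z‖ ≤ L) ∧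
      ∀ (z : C(Icc (0 : ℝ) T, X)) (t : ℝ) (ht : t ∈ Icc (0 : ℝ) T),
        linearization f (IccExtend hT z) t = G z ⟨t, ht⟩ := by
  have hF : Continuous fun p : Icc (0 : ℝ) T × X => (meanDerivative f p.1 p.2 : X →L[𝕜] X) := by
    refine intervalIntegral.continuous_parametric_intervalIntegral_of_continuous'
      (f := fun (p : Icc (0 : ℝ) T × X) r => fderiv 𝕜 (f p.1) (r • p.2)) ?_ 0 1
    exact hf_cont.comp_continuous
      (f := fun q : (Icc (0 : ℝ) T × X) × ℝ => ((q.1.1 : ℝ), q.2 • q.1.2)) (by fun_prop)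
      fun q => ⟨q.1.1.2, trivial⟩
  -- Joint continuity in z and t suffices: currying gives continuity into the compact-open topology,
  -- which on a compact interval is that of the sup norm.
  have hjoint : Continuous fun q : C(Icc (0 : ℝ) T, X) × Icc (0 : ℝ) T =>
      (meanDerivative f q.2 (q.1 q.2) : X →L[𝕜] X) :=
    hF.comp (continuous_snd.prodMk (continuous_fst.eval continuous_snd))
  refine ⟨fun z => ⟨fun t => meanDerivative f t (z t), hjoint.comp (Continuous.prodMk_right z)⟩,
    ContinuousMap.continuous_of_continuous_uncurry _ hjoint, fun z => ?_, fun z t ht => ?_⟩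
  · refine (ContinuousMap.norm_le _ hL).2 fun t => ?_
    refine (intervalIntegral.norm_integral_le_of_norm_le_const (C := L)
      fun r _ => hf_bound t t.2 _).trans ?_
    simp
  · simp only [linearization, IccExtend_of_mem hT _ ht]
    rfl

/-- Freezing time outside [0,T] yields a function jointly continuous on all of C([0,T],X) × ℝ, as
the parametric integrals require. -/
lemma exists_continuous_superposition (hT : 0 ≤ T) {g : ℝ → X → X}
    (hg : ContinuousOn (Function.uncurry g) (Icc 0 T ×ˢ univ)) {m : ℝ → ℝ}
    (hm : ContinuousOn m (Icc 0 T)) (hg_bound : ∀ t ∈ Icc (0 : ℝ) T, ∀ z : X, ‖g t z‖ ≤ m t) :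
    ∃ (γ : C(Icc (0 : ℝ) T, X) → ℝ → X) (R : ℝ), Continuous (Function.uncurry γ) ∧
      (∀ z, ∀ s ∈ Icc 0 T, ‖γ z s‖ ≤ R) ∧ ∀ z, ∀ s ∈ Icc 0 T, γ z s = g s (IccExtend hT z s) := by
  obtain ⟨R, hR⟩ := (isCompact_Icc (a := (0 : ℝ)) (b := T)).exists_bound_of_continuousOn hm
  refine ⟨fun z s => g (projIcc 0 T hT s) (z (projIcc 0 T hT s)), R, ?_, fun z s hs => ?_,
    fun z s hs => ?_⟩
  · have hp : Continuous fun q : C(Icc (0 : ℝ) T, X) × ℝ => projIcc 0 T hT q.2 :=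
      continuous_projIcc.comp continuous_snd
    exact hg.comp_continuous (f := fun q : C(Icc (0 : ℝ) T, X) × ℝ =>
      ((projIcc 0 T hT q.2 : ℝ), q.1 (projIcc 0 T hT q.2)))
      ((continuous_subtype_val.comp hp).prodMk (continuous_fst.eval hp))
      fun q => ⟨(projIcc 0 T hT q.2).2, trivial⟩
  · exact (hg_bound _ (projIcc 0 T hT s).2 _).trans
      ((le_abs_self _).trans (hR _ (projIcc 0 T hT s).2))
  · simp only [projIcc_of_mem hT hs, IccExtend_of_mem hT _ hs]

variable {S : C0Semigroup 𝕜 X}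

lemma evolutionOperator_eq (hT : 0 ≤ T) {L : ℝ} {G : C(Icc (0 : ℝ) T, X →L[𝕜] X)} (hG : ‖G‖ ≤ L)
    {G' : ℝ → X →L[𝕜] X} (hG' : ∀ t (ht : t ∈ Icc 0 T), G' t = G ⟨t, ht⟩) {s t : ℝ} (hs : 0 ≤ s)
    (hst : s ≤ t) (ht : t ≤ T) : evolutionOperator S T G' t s = evolution S hT L G t s :=
  (isEvolutionOperator_evolutionOperator S hT hG').eq_evolution hT hG hG' hs hst ht

lemma adjoint_evolutionOperator_eq (hS : S.IsCompactSemigroup) (hT : 0 ≤ T) {L : ℝ}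
    {G : C(Icc (0 : ℝ) T, X →L[𝕜] X)} (hG : ‖G‖ ≤ L) {G' : ℝ → X →L[𝕜] X}
    (hG' : ∀ t (ht : t ∈ Icc 0 T), G' t = G ⟨t, ht⟩) {s : ℝ} (hs : s ∈ Icc 0 T) (x : X) :
    ContinuousLinearMap.adjoint (evolutionOperator S T G' T s) x
      = evolution (S.adj hS) hT L (adjointReversed G) (T - s) 0 x := by
  have h := adjoint_evolution hS hT hG hs.1 hs.2 le_rfl x
  rwa [sub_self, ← evolutionOperator_eq hT hG hG' hs.1 hs.2 le_rfl] at h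

lemma regularizedGramian_eq (hS : S.IsCompactSemigroup) (hT : 0 ≤ T) (B : W →L[𝕜] X)
    (M : Submodule 𝕜 X) [M.HasOrthogonalProjection] (ε : ℝ) {L : ℝ}
    {G : C(Icc (0 : ℝ) T, X →L[𝕜] X)} (hG : ‖G‖ ≤ L) {G' : ℝ → X →L[𝕜] X}
    (hG' : ∀ t (ht : t ∈ Icc 0 T), G' t = G ⟨t, ht⟩) :
    regularizedGramian S B T M ε G' = regGramian hS hT B M ε hG := by
  funext x
  rw [regGramian_apply, regularizedGramian, gramian, gramianOf]
  congr 1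
  refine intervalIntegral.integral_congr fun s hs => ?_
  rw [uIcc_of_le hT] at hs
  simp only [adjointControl]
  rw [adjoint_evolutionOperator_eq hS hT hG hG' hs, evolutionOperator_eq hT hG hG' hs.1 hs.2 le_rfl]

end Linearization

end EvolutionControl

end

/-! ### The main theorem -/

open EvolutionControl in
theorem mainTheorem3
    {𝕜 X W : Type*} [RCLike 𝕜]
    [NormedAddCommGroup X] [InnerProductSpace 𝕜 X] [NormedSpace ℝ X] [IsScalarTower ℝ 𝕜 X]
    [CompleteSpace X] [TopologicalSpace.SeparableSpace X]
    [NormedAddCommGroup W] [InnerProductSpace 𝕜 W] [CompleteSpace W]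
    [TopologicalSpace.SeparableSpace W]
    (T : ℝ) (hT : 0 < T)
    -- (S): `A` generates a compact `C₀`-semigroup and `B` is bounded
    (A : X →ₗ.[𝕜] X) (S : C0Semigroup 𝕜 X) (_hA : S.IsGenerator A)
    (hS : S.IsCompactSemigroup) (B : W →L[𝕜] X)
    -- (F)
    (f : ℝ → X → X)
    (hf : ContinuousOn (Function.uncurry f) (Icc 0 T ×ˢ univ))
    (hf_diff : ∀ t ∈ Icc (0 : ℝ) T, Differentiable 𝕜 (f t))
    (hf_cont : ContinuousOn (fun p : ℝ × X => fderiv 𝕜 (f p.1) p.2) (Icc 0 T ×ˢ univ))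
    (L : ℝ) (hf_bound : ∀ t ∈ Icc (0 : ℝ) T, ∀ z : X, ‖fderiv 𝕜 (f t) z‖ ≤ L)
    -- (G)
    (g : ℝ → X → X)
    (hg : ContinuousOn (Function.uncurry g) (Icc 0 T ×ˢ univ))
    (m : ℝ → ℝ) (hm : ContinuousOn m (Icc 0 T))
    (hg_bound : ∀ t ∈ Icc (0 : ℝ) T, ∀ z : X, ‖g t z‖ ≤ m t)
    -- (AC)
    (hAC : ∀ G : ℝ → X →L[𝕜] X, MemLp G 2 (volume.restrict (Icc 0 T)) →
      IsApproxControllable S B T G)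
    -- the finite-dimensional subspace, the initial state, the target and the parameter
    (M : Submodule 𝕜 X) [FiniteDimensional 𝕜 M] (x₀ h : X) (ε : ℝ) (hε : 0 < ε) :
    -- the objects entering `Θ_ε z` are well defined for every `z`
    (∀ z : C(Icc (0 : ℝ) T, X),
      IsEvolutionOperator S T (linearization f (IccExtend hT.le z))
        (evolutionOperator S T (linearization f (IccExtend hT.le z)) : ℝ → ℝ → X →L[𝕜] X) ∧
      ∃ R : X ≃L[𝕜] X, ∀ x : X,
        R x = regularizedGramian S B T M ε (linearization f (IccExtend hT.le z)) x) ∧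
    -- `Θ_ε` maps `C([0,T], X)` into itself and has a fixed point
    ∃ Θ : C(Icc (0 : ℝ) T, X) → C(Icc (0 : ℝ) T, X),
      (∀ (z : C(Icc (0 : ℝ) T, X)) (t : Icc (0 : ℝ) T),
        Θ z t = thetaFun S B T f g M x₀ h ε (IccExtend hT.le z) t) ∧
      ∃ y : C(Icc (0 : ℝ) T, X), Function.IsFixedPt Θ y := by
  have hT0 := hT.le
  have hL : 0 ≤ L := (norm_nonneg _).trans (hf_bound 0 ⟨le_rfl, hT0⟩ 0)
  obtain ⟨G, hGc, hG, hGlin⟩ := exists_continuous_linearization (𝕜 := 𝕜) hT0 hL hf_cont hf_bound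
  obtain ⟨γ, R, hγc, hγR, hγ⟩ := exists_continuous_superposition hT0 hg hm hg_bound
  obtain ⟨c, hc0, hc⟩ := exists_uniform_coercivity hS hT hAC M hε hL
  have hunit : ∀ z, IsUnit (regGramian hS hT0 B M ε (hG z)) := fun z =>
    isUnit_regGramian hS hT0 B hc0 hc (hG z)
  have hreg : ∀ z : C(Icc (0 : ℝ) T, X),
      regularizedGramian S B T M ε (linearization f (IccExtend hT.le z))
        = regGramian hS hT0 B M ε (hG z) := fun z =>
    regularizedGramian_eq hS hT0 B M ε (hG z) (hGlin z)
  refine ⟨fun z => ⟨isEvolutionOperator_evolutionOperator S hT0 (hGlin z), ?_⟩, ?_⟩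
  · obtain ⟨u, hu⟩ := hunit z
    refine ⟨ContinuousLinearEquiv.unitsEquiv 𝕜 X u, fun x => ?_⟩
    rw [hreg z, ← hu]
    rfl
  -- the vector `(ε (I - π_M) + Γ₀ᵀ(F(z)))⁻¹ (h - 𝔗(T,0) x₀ - ∫ 𝔗(T,s) g(s,z(s)) ds)`
  let v : C(Icc (0 : ℝ) T, X) → X := fun z =>
    Ring.inverse (regGramian hS hT0 B M ε (hG z)) (targetResidual S hT0 L (G z) (γ z) x₀ h)
  have hv : ∀ z, regGramian hS hT0 B M ε (hG z) (v z) = targetResidual S hT0 L (G z) (γ z) x₀ h := by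
    intro z
    obtain ⟨u, hu⟩ := hunit z
    simp only [v, ← hu, Ring.inverse_unit]
    exact clm_unit_apply_inv u _
  have hresc : Continuous fun z => targetResidual S hT0 L (G z) (γ z) x₀ h :=
    continuous_targetResidual hT0 hGc hG hγc x₀ h
  have hvc : Continuous v := by
    rw [continuous_iff_continuousAt]
    intro z₀
    rw [ContinuousAt, tendsto_iff_norm_sub_tendsto_zero]
    -- By coercivity, c‖v z - v z₀‖ is at most the norm of the regularized Gramian at z applied to
    -- the difference. Hence strong continuity of the Gramian in z, at the single vector v z₀, is
    -- enough.
    have h1 : Continuous fun z => c⁻¹ * ‖targetResidual S hT0 L (G z) (γ z) x₀ h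
        - regGramian hS hT0 B M ε (hG z) (v z₀)‖ := by
      refine continuous_const.mul (hresc.sub ?_).norm
      simp only [regGramian_apply]
      exact continuous_const.add (continuous_gramianOf hS hT0 B hGc hG continuous_const)
    have h2 := h1.tendsto z₀
    simp only [hv z₀, sub_self, norm_zero, mul_zero] at h2
    refine squeeze_zero (fun _ => norm_nonneg _) (fun z => ?_) h2
    rw [← div_eq_inv_mul, le_div_iff₀ hc0, mul_comm, ← hv z, ← map_sub]
    exact mul_norm_le_norm_regGramian hS hT0 B hc (hG z) _
  have hbE := evolutionBound_nonneg S T L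
  have hbE' := evolutionBound_nonneg (S.adj hS) T L
  have hR0 : 0 ≤ R := (norm_nonneg _).trans (hγR 0 0 ⟨le_rfl, hT0⟩)
  set N := ‖h‖ + evolutionBound S T L * ‖x₀‖ + evolutionBound S T L * R * T with hN
  have hvb : ∀ z, ‖v z‖ ≤ c⁻¹ * N := by
    intro z
    rw [← div_eq_inv_mul, le_div_iff₀ hc0, mul_comm]
    refine (mul_norm_le_norm_regGramian hS hT0 B hc (hG z) _).trans ?_
    rw [hv z]
    refine (norm_sub_le _ _).trans (add_le_add ((norm_sub_le _ _).trans ?_) ?_)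
    · gcongr
      exact norm_evolution_apply_le S hT0 (hG z) le_rfl le_rfl x₀
    · exact norm_integral_evolution_le hT0 (hG z) (hγR z) ⟨hT0, le_rfl⟩
  obtain ⟨Θ, hΘ, hfix⟩ := exists_fixedPoint_stateOf hS hT0 hL hGc hG
    (w := fun z s => adjointControl hS hT0 L B (G z) (v z) s + γ z s)
    ((continuous_adjointControl hS hT0 B (hGc.comp continuous_fst) (fun z => hG z.1)
      (hvc.comp continuous_fst) continuous_snd).add hγc)
    (R := ‖B‖ * (‖B‖ * (evolutionBound (S.adj hS) T L * (c⁻¹ * N))) + R)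
    (fun z s hs => by
      refine (norm_add_le _ _).trans (add_le_add ?_ (hγR z s hs))
      refine B.le_opNorm_of_le ?_
      refine ContinuousLinearMap.le_of_opNorm_le_of_le _
        (LinearIsometryEquiv.norm_map ContinuousLinearMap.adjoint B).le ?_
      refine (norm_evolution_apply_le (S.adj hS) hT0 (norm_adjointReversed_le (hG z)) le_rfl
        (by linarith [hs.1]) _).trans ?_
      gcongr
      exact hvb z) x₀
  refine ⟨Θ, fun z t => ?_, hfix⟩
  -- `Function.invFun` agrees with the operator inverse here because the regularized Gramian is
  -- injective and the residual is its value at v z.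
  have hinv : Function.invFun (regularizedGramian S B T M ε (linearization f (IccExtend hT.le z)))
      (h - evolutionOperator S T (linearization f (IccExtend hT.le z)) T 0 x₀
        - ∫ s in (0 : ℝ)..T, evolutionOperator S T (linearization f (IccExtend hT.le z)) T s
          (g s (IccExtend hT.le z s))) = v z := by
    obtain ⟨u, hu⟩ := hunit z
    have hinj : Function.Injective (regGramian hS hT0 B M ε (hG z)) := by
      rw [← hu]
      exact Function.LeftInverse.injective (clm_unit_inv_apply u)
    have hres : h - evolutionOperator S T (linearization f (IccExtend hT.le z)) T 0 x₀
        - ∫ s in (0 : ℝ)..T, evolutionOperator S T (linearization f (IccExtend hT.le z)) T s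
          (g s (IccExtend hT.le z s)) = regGramian hS hT0 B M ε (hG z) (v z) := by
      rw [hv z, targetResidual, evolutionOperator_eq hT0 (hG z) (hGlin z) le_rfl hT0 le_rfl]
      congr 1
      refine intervalIntegral.integral_congr fun s hs => ?_
      rw [uIcc_of_le hT0] at hs
      rw [evolutionOperator_eq hT0 (hG z) (hGlin z) hs.1 hs.2 le_rfl, hγ z s hs]
    rw [hres, hreg z]
    exact Function.leftInverse_invFun hinj (v z)
  rw [hΘ, thetaFun, stateOf, evolutionOperator_eq hT0 (hG z) (hGlin z) le_rfl t.2.1 t.2.2]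
  congr 1
  refine intervalIntegral.integral_congr fun s hs => ?_
  rw [uIcc_of_le t.2.1] at hs
  have hsI : s ∈ Icc 0 T := ⟨hs.1, hs.2.trans t.2.2⟩
  simp only [feedbackControl, adjointControl]
  rw [hinv, adjoint_evolutionOperator_eq hS hT0 (hG z) (hGlin z) hsI,
    evolutionOperator_eq hT0 (hG z) (hGlin z) hs.1 hs.2 t.2.2, hγ z s hsI]
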